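/- Let $k$ be a finite field with $q$ elements, $v=\sqrt q\in\mathbb C$, let $A$ be a finite dimensional hereditary $k$-algebra, and let $m$ be an integer with $m=0$ or $m>2$; write $\mathbb Z_m=\mathbb Z/m\mathbb Z$ ($\mathbb Z_0=\mathbb Z$). **Notation.** $\mathbf{mod}\,A$ is the category of finite dimensional left $A$-modules, $\mathrm{Iso}(A)$ its set of isomorphism classes, $K(A)$ its Grothendieck group, $\hat M\in K(A)$ the class of $M$, $a_M=|\mathrm{Aut}(M)|$. The Euler form is the bilinear form on $K(A)$ with $\langle\hat M,\hat N\rangle=\langle M,N\rangle=\dim_k\mathrm{Hom}_A(M,N)-\dim_k\mathrm{Ext}^1_A(M,N)$, and $(\alpha,\beta)=\langle\alpha,\beta\rangle+\langle\beta,\alpha\rangle$. Put $F_{MN}^L=\frac{|\mathrm{Ext}^1_A(M,N)_L|}{|\mathrm{Hom}_A(M,N)|}\cdot\frac{a_L}{a_Ma_N}$, where $\mathrm{Ext}^1_A(M,N)_L$ is the set of equivalence classes of short exact sequences $0\to N\to L\to M\to0$ with middle term $L$, and $\gamma_{MN}^{XY}=\frac{|W_{MN}^{XY}|}{a_Ma_N}$,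 where $W_{MN}^{XY}$ is the set of triples $(f,g,h)$ with $0\to X\xrightarrow{g}M\xrightarrow{f}N\xrightarrow{h}Y\to0$ exact. **Heisenberg double.** $\mathrm{Heis}(A)$ is the associative unital $\mathbb C$-algebra with generators $Z^+_{[M]},Z^-_{[M]}$ ($[M]\in\mathrm{Iso}(A)$) and $K_\alpha,K^-_\alpha$ ($\alpha\in K(A)$) and relations $$Z^\pm_{[M]}Z^\pm_{[N]}=v^{\langle M,N\rangle}\sum_{[L]}F_{MN}^LZ^\pm_{[L]},\quad Z^\pm_{[0]}=1,\quad K_\alpha K_\beta=K_{\alpha+\beta},\quad K^-_\alpha K^-_\beta=K^-_{\alpha+\beta},\quad K_0=K_0^-=1,$$ $$K_\alpha Z^+_{[M]}=v^{(\alpha,\hat M)}Z^+_{[M]}K_\alpha,\qquad K^-_\alpha Z^-_{[M]}=v^{(\alpha,\hat M)}Z^-_{[M]}K^-_\alpha,$$ $$Z^-_{[M]}Z^+_{[N]}=\sum_{[X],[Y]}v^{\langle\hat M-\hat X,\hat X-\hat Y\rangle}\gamma_{MN}^{XY}K_{\hat M-\hat X}Z^+_{[Y]}Z^-_{[X]},$$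 $$K_\alpha Z^-_{[M]}=v^{-(\alpha,\hat M)}Z^-_{[M]}K_\alpha,\qquad K^-_\alpha Z^+_{[M]}=Z^+_{[M]}K^-_\alpha,\qquad K_\alpha K^-_\beta=v^{-(\alpha,\beta)}K^-_\beta K_\alpha.$$ **Bridgeland's Hall algebra.** Let $\mathcal C_m(\mathcal P)$ be the category of $m$-cyclic complexes $M_\bullet=(M_i,d_i:M_i\to M_{i+1})_{i\in\mathbb Z_m}$, $d_{i+1}d_i=0$, of finite dimensional projective $A$-modules (bounded complexes if $m=0$), with shift $M_\bullet[t]_i=M_{i+t}$ and differential $(-1)^td_{i+t}$; for $r\in\mathbb Z_m$, $[r]$ is the shift by the representative of $r$ in $\{0,\dots,m-1\}$ (by $r$ itself if $m=0$). The twisted Hall algebra $\mathcal H_{\rm tw}(\mathcal C_m(\mathcal P))$ has $\mathbb C$-basis the isomorphism classes $[M_\bullet]$ and product $$[M_\bullet]*[N_\bullet]=v^{\sum_{i}\langle M_i,N_i\rangle}\sum_{[L_\bullet]}\frac{|\mathrm{Ext}^1_{\mathcal C_m(\mathcal P)}(M_\bullet,N_\bullet)_{L_\bullet}|}{|\mathrm{Hom}_{\mathcal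 C_m(\mathcal P)}(M_\bullet,N_\bullet)|}[L_\bullet],$$ and $\mathcal{DH}_m(A)$ is its localization at the classes of all acyclic complexes. For a map $f:Q\to P$ of projectives let $C_f$ be the complex with $Q$ in degree $m-1$, $P$ in degree $0$, zero elsewhere and differential $f$; put $K_P=C_{\mathrm{id}_P}$. For $\alpha=\hat P-\hat Q\in K(A)$ with $P,Q$ projective and $r\in\mathbb Z_m$ put $K_{\alpha,r}=[K_P[r]]*[K_Q[r]]^{-1}$. For $M\in\mathbf{mod}\,A$ with minimal projective resolution $0\to\Omega_M\xrightarrow{\delta_M}P_M\to M\to0$ put $C_M=C_{\delta_M}$ and $$e_{M,r}=a_M^{-1}\,v^{\langle\hat\Omega_M,\hat M\rangle}\,K_{-\hat\Omega_M,r}*[C_M[r]]\in\mathcal{DH}_m(A).$$ **Corollary 3.3.** For each $i\in\mathbb Z_m$ there is an injective homomorphism of unital $\mathbb C$-algebras $J_i:\mathrm{Heis}(A)\hookrightarrow\mathcal{DH}_m(A)$ such that $$J_i(Z^+_{[M]})=e_{M,i},\quad J_i(Z^-_{[M]})=e_{M,i+1},\quad J_i(K_\alpha)=K_{\alpha,i},\quad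 J_i(K^-_\alpha)=K_{\alpha,i+1}$$ for all $M\in\mathbf{mod}\,A$ and $\alpha\in K(A)$. -/

import Mathlib

open CategoryTheory

universe u v

/-- A ring is (left) hereditary if all of its left ideals are projective. -/
class IsHereditaryRing (A : Type v) [Ring A] : Prop where
  projective_ideal : ∀ I : Ideal A, Module.Projective A I

namespace BridgelandHall

/-! ### Homological preliminaries on hereditary algebras -/

theorem projective_of_exact {A : Type*} [Ring A] {N M P : Type*} [AddCommGroup N] [Module A N]
    [AddCommGroup M] [Module A M] [AddCommGroup P] [Module A P] (f : N →ₗ[A] M) (g : M →ₗ[A] P)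
    (hf : Function.Injective f) (h : Function.Exact f g) (hg : Function.Surjective g)
    [Module.Projective A N] [Module.Projective A P] : Module.Projective A M := by
  obtain ⟨s, hs⟩ := Module.projective_lifting_property g LinearMap.id hg
  have hs' : ∀ x, g (s x) = x := fun x => LinearMap.congr_fun hs x
  have hfg : ∀ x, g (f x) = 0 := fun x => (h (f x)).2 ⟨x, rfl⟩
  refine Module.Projective.of_equiv (R := A) (LinearEquiv.ofBijective
    (LinearMap.coprod f s) ⟨?_, ?_⟩)
  · rw [← LinearMap.ker_eq_bot, LinearMap.ker_eq_bot']
    rintro ⟨a, b⟩ hab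
    simp only [LinearMap.coprod_apply] at hab
    have hb : b = 0 := by simpa [hfg, hs'] using congrArg g hab
    subst hb
    have ha : f a = f 0 := by simpa using hab
    simp [hf ha]
  · intro x
    obtain ⟨a, ha⟩ := (h (x - s (g x))).1 (by simp [hs'])
    exact ⟨(a, g x), by simp [ha]⟩

theorem projective_of_injective_pi (A : Type v) [Ring A] [IsHereditaryRing A] (n : ℕ) :
    ∀ (M : Type*) [AddCommGroup M] [Module A M] (f : M →ₗ[A] (Fin n → A)),
      Function.Injective f → Module.Projective A M := by
  induction n with
  | zero =>
    intro M _ _ f hf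
    have : Subsingleton M := hf.subsingleton
    infer_instance
  | succ n ih =>
    intro M _ _ f hf
    let φ : M →ₗ[A] A := (LinearMap.proj 0).comp f
    let τ : LinearMap.ker φ →ₗ[A] (Fin n → A) :=
      (LinearMap.funLeft A A Fin.succ).comp (f.comp (LinearMap.ker φ).subtype)
    have hτ : Function.Injective τ := by
      refine (injective_iff_map_eq_zero τ).2 ?_
      rintro ⟨x, hx⟩ h
      have hfx : f x = 0 := by
        ext i
        refine Fin.cases ?_ (fun j => ?_) i
        · exact hx
        · exact congrFun h j
      exact Subtype.ext (hf (hfx.trans (map_zero f).symm))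
    have h2 : Module.Projective A (LinearMap.ker φ) := ih _ τ hτ
    have h3 : Module.Projective A (LinearMap.range φ) :=
      IsHereditaryRing.projective_ideal (LinearMap.range φ)
    refine projective_of_exact (LinearMap.ker φ).subtype φ.rangeRestrict
      Subtype.val_injective ?_ φ.surjective_rangeRestrict
    intro x
    simp [Subtype.ext_iff]

/-- Over a hereditary ring, submodules of finitely generated projectives are projective. -/
theorem projective_submodule {A : Type v} [Ring A] [IsHereditaryRing A] {P : Type*}
    [AddCommGroup P] [Module A P] [Module.Finite A P] [Module.Projective A P]
    (N : Submodule A P) : Module.Projective A N := by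
  obtain ⟨n, f, hf⟩ := Module.Finite.exists_fin' A P
  obtain ⟨s, hs⟩ := Module.projective_lifting_property f LinearMap.id hf
  have hs' : Function.Injective s :=
    Function.LeftInverse.injective (g := f) (fun x => LinearMap.congr_fun hs x)
  exact projective_of_injective_pi A n N (s.comp N.subtype) (hs'.comp N.injective_subtype)

theorem finrank_alternating {k : Type*} [Field k] {V₁ V₂ V₃ V₄ V₅ V₆ : Type*}
    [AddCommGroup V₁] [AddCommGroup V₂] [AddCommGroup V₃] [AddCommGroup V₄] [AddCommGroup V₅]
    [AddCommGroup V₆] [Module k V₁] [Module k V₂] [Module k V₃] [Module k V₄] [Module k V₅]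
    [Module k V₆] [Module.Finite k V₁] [Module.Finite k V₂] [Module.Finite k V₃]
    [Module.Finite k V₄] [Module.Finite k V₅]
    (f₁ : V₁ →ₗ[k] V₂) (f₂ : V₂ →ₗ[k] V₃) (f₃ : V₃ →ₗ[k] V₄) (f₄ : V₄ →ₗ[k] V₅)
    (f₅ : V₅ →ₗ[k] V₆) (h₁ : Function.Injective f₁) (h₂ : Function.Exact f₁ f₂)
    (h₃ : Function.Exact f₂ f₃) (h₄ : Function.Exact f₃ f₄) (h₅ : Function.Exact f₄ f₅)
    (h₆ : Function.Surjective f₅) :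
    ((Module.finrank k V₂ : ℤ) - Module.finrank k V₅) =
      ((Module.finrank k V₁ : ℤ) - Module.finrank k V₄) +
      ((Module.finrank k V₃ : ℤ) - Module.finrank k V₆) := by
  have e₁ := LinearMap.finrank_range_add_finrank_ker f₁
  have e₂ := LinearMap.finrank_range_add_finrank_ker f₂
  have e₃ := LinearMap.finrank_range_add_finrank_ker f₃
  have e₄ := LinearMap.finrank_range_add_finrank_ker f₄
  have e₅ := LinearMap.finrank_range_add_finrank_ker f₅
  rw [h₂.linearMap_ker_eq] at e₂
  rw [h₃.linearMap_ker_eq] at e₃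
  rw [h₄.linearMap_ker_eq] at e₄
  rw [h₅.linearMap_ker_eq, LinearMap.range_eq_top.2 h₆, finrank_top] at e₅
  rw [LinearMap.ker_eq_bot.2 h₁, finrank_bot] at e₁
  omega

section Modules

open ModuleCat

theorem finite_carrier (k : Type u) [Field k] [Finite k] {A : Type v} [Ring A] [Algebra k A]
    [Module.Finite k A]
    (M : FGModuleCat.{v} A) : Finite M.obj := by
  have : Finite A := Module.finite_of_finite k
  exact Module.finite_of_finite A


theorem finite_hom (k : Type u) [Field k] [Finite k] {A : Type v} [Ring A] [Algebra k A]
    [Module.Finite k A]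
    (M N : FGModuleCat.{v} A) : Finite (M.obj ⟶ N.obj) := by
  have := finite_carrier k M
  have := finite_carrier k N
  exact Finite.of_injective (fun f : M.obj ⟶ N.obj => (f : M.obj → N.obj))
    (fun f g h => ModuleCat.hom_ext (DFunLike.coe_injective h))

/-- If `P → M` is surjective with `P` finitely generated projective, then its kernel is finitely
generated projective. -/
theorem finite_projective_ker (k : Type u) [Field k] [Finite k] {A : Type v}
    [Ring A] [Algebra k A] [Module.Finite k A] [IsHereditaryRing A]
    {P M : FGModuleCat.{v} A} [Module.Projective A P.obj]
    (f : P.obj →ₗ[A] M.obj) :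
    Module.Finite A (LinearMap.ker f) ∧ Module.Projective A (LinearMap.ker f) := by
  have := finite_carrier k P
  refine ⟨Module.Finite.of_finite, ?_⟩
  have : Module.Finite A P.obj := P.property
  exact projective_submodule _

theorem exists_resolution (k : Type u) [Field k] [Finite k] {A : Type v}
    [Ring A] [Algebra k A] [Module.Finite k A] [IsHereditaryRing A]
    (M : FGModuleCat.{v} A) : ∃ (K P : FGModuleCat.{v} A)
    (f : K.obj ⟶ P.obj) (g : P.obj ⟶ M.obj) (w : f ≫ g = 0),
    Projective K.obj ∧ Projective P.obj ∧ (ShortComplex.mk f g w).ShortExact := by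
  have hM : Module.Finite A M.obj := M.property
  obtain ⟨n, g, hg⟩ := Module.Finite.exists_fin' A M.obj
  have hP : Module.Projective A (FGModuleCat.of A (Fin n → A)).obj :=
    inferInstanceAs (Module.Projective A (Fin n → A))
  obtain ⟨h₁, h₂⟩ := finite_projective_ker k (P := FGModuleCat.of A (Fin n → A)) (M := M) g
  refine ⟨FGModuleCat.of A (LinearMap.ker g), FGModuleCat.of A (Fin n → A),
    ModuleCat.ofHom (LinearMap.ker g).subtype, ModuleCat.ofHom g, ?_, ?_, ?_, ?_⟩
  · ext x
    exact x.2
  · exact (IsProjective.iff_projective _).1 h₂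
  · exact (IsProjective.iff_projective _).1 hP
  · refine ShortComplex.ShortExact.mk' ?_ ?_ ?_
    · rw [ShortComplex.ShortExact.moduleCat_exact_iff_function_exact]
      intro x
      exact ⟨fun hx => ⟨⟨x, hx⟩, rfl⟩, by rintro ⟨y, rfl⟩; exact y.2⟩
    · exact (ModuleCat.mono_iff_injective _).2 Subtype.val_injective
    · exact (ModuleCat.epi_iff_surjective _).2 hg

theorem projectiveDimension_le_one (k : Type u) [Field k] [Finite k] {A : Type v}
    [Ring A] [Algebra k A] [Module.Finite k A] [IsHereditaryRing A]
    (M : FGModuleCat.{v} A) :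
    HasProjectiveDimensionLT M.obj 2 := by
  obtain ⟨K, P, f, g, w, hK, hP, hS⟩ := exists_resolution k M
  exact hS.hasProjectiveDimensionLT_X₃ 1 (inferInstanceAs (HasProjectiveDimensionLT K.obj 1))
    (inferInstanceAs (HasProjectiveDimensionLT P.obj 2))

theorem finite_ext_one (k : Type u) [Field k] [Finite k] {A : Type v}
    [Ring A] [Algebra k A] [Module.Finite k A] [IsHereditaryRing A]
    (M N : FGModuleCat.{v} A) : Finite (Abelian.Ext M.obj N.obj 1) := by
  obtain ⟨K, P, f, g, w, hK, hP, hS⟩ := exists_resolution k M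
  have h₀ : Finite (Abelian.Ext K.obj N.obj 0) := by
    have := finite_hom k K N
    exact Finite.of_equiv _ Abelian.Ext.homEquiv₀.symm
  refine Finite.of_surjective (fun x : Abelian.Ext K.obj N.obj 0 =>
    hS.extClass.comp x (add_zero 1)) fun x => ?_
  exact Abelian.Ext.contravariant_sequence_exact₃ hS N.obj x
    (Abelian.Ext.eq_zero_of_projective _) (add_zero 1)

/-- `⟨M, N⟩ = dim_k Hom_A(M, N) - dim_k Ext¹_A(M, N)`. -/
noncomputable def eulerDim (k : Type u) [Field k]
    {A : Type v} [Ring A] [Algebra k A] (M N : ModuleCat.{v} A) : ℤ :=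
  (Module.finrank k (M ⟶ N) : ℤ) - (Module.finrank k (Abelian.Ext M N 1) : ℤ)

theorem finrank_ext_zero (k : Type u) [Field k] {A : Type v} [Ring A] [Algebra k A]
    (M N : ModuleCat.{v} A) :
    Module.finrank k (Abelian.Ext M N 0) = Module.finrank k (M ⟶ N) :=
  (Abelian.Ext.linearEquiv₀ (R := k)).finrank_eq

open Abelian

theorem eulerDim_add_right (k : Type u) [Field k] [Finite k] {A : Type v}
    [Ring A] [Algebra k A] [Module.Finite k A] [IsHereditaryRing A]
    (X N L M : FGModuleCat.{v} A) (f : N.obj ⟶ L.obj) (g : L.obj ⟶ M.obj)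
    (w : f ≫ g = 0) (hS : (ShortComplex.mk f g w).ShortExact) :
    eulerDim k X.obj L.obj = eulerDim k X.obj N.obj + eulerDim k X.obj M.obj := by
  have hm : Mono f := hS.mono_f
  have hcg : (Ext.mk₀ g).comp hS.extClass (zero_add 1) = 0 := hS.comp_extClass
  have hcf : hS.extClass.comp (Ext.mk₀ f) (add_zero 1) = 0 := hS.extClass_comp
  have := projectiveDimension_le_one k X
  have fin0 : ∀ Y : FGModuleCat.{v} A, Module.Finite k (Ext X.obj Y.obj 0) := fun Y => by
    have := finite_hom k X Y
    have : Finite (Ext X.obj Y.obj 0) := Finite.of_equiv _ Ext.homEquiv₀.symm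
    exact Module.Finite.of_finite
  have fin1 : ∀ Y : FGModuleCat.{v} A, Module.Finite k (Ext X.obj Y.obj 1) := fun Y => by
    have := finite_ext_one k X Y
    exact Module.Finite.of_finite
  have := fin0 N; have := fin0 L; have := fin0 M; have := fin1 N; have := fin1 L
  have key := finrank_alternating (k := k)
    (Ext.postcompOfLinear (Ext.mk₀ f) k X.obj (add_zero 0))
    (Ext.postcompOfLinear (Ext.mk₀ g) k X.obj (add_zero 0))
    (Ext.postcompOfLinear hS.extClass k X.obj (zero_add 1))
    (Ext.postcompOfLinear (Ext.mk₀ f) k X.obj (add_zero 1))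
    (Ext.postcompOfLinear (Ext.mk₀ g) k X.obj (add_zero 1))
    (Ext.postcomp_mk₀_injective_of_mono X.obj f)
    (fun x => ⟨fun h => Ext.covariant_sequence_exact₂ X.obj hS x h, by
      rintro ⟨y, rfl⟩; simp [w]⟩)
    (fun x => ⟨fun h => Ext.covariant_sequence_exact₃ X.obj hS x (zero_add 1) h, by
      rintro ⟨y, rfl⟩; simp [hcg]⟩)
    (fun x => ⟨fun h => Ext.covariant_sequence_exact₁ X.obj hS x h (zero_add 1), by
      rintro ⟨y, rfl⟩; simp [hcf]⟩)
    (fun x => ⟨fun h => Ext.covariant_sequence_exact₂ X.obj hS x h, by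
      rintro ⟨y, rfl⟩; simp [w]⟩)
    (fun x => Ext.covariant_sequence_exact₃ X.obj hS x rfl
      (Ext.eq_zero_of_hasProjectiveDimensionLT _ 2 le_rfl))
  simp only [finrank_ext_zero] at key
  exact key

theorem eulerDim_add_left (k : Type u) [Field k] [Finite k] {A : Type v}
    [Ring A] [Algebra k A] [Module.Finite k A] [IsHereditaryRing A]
    (Y N L M : FGModuleCat.{v} A) (f : N.obj ⟶ L.obj) (g : L.obj ⟶ M.obj)
    (w : f ≫ g = 0) (hS : (ShortComplex.mk f g w).ShortExact) :
    eulerDim k L.obj Y.obj = eulerDim k N.obj Y.obj + eulerDim k M.obj Y.obj := by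
  have hm : Epi g := hS.epi_g
  have := projectiveDimension_le_one k M
  have fin0 : ∀ X : FGModuleCat.{v} A, Module.Finite k (Ext X.obj Y.obj 0) := fun X => by
    have := finite_hom k X Y
    have : Finite (Ext X.obj Y.obj 0) := Finite.of_equiv _ Ext.homEquiv₀.symm
    exact Module.Finite.of_finite
  have fin1 : ∀ X : FGModuleCat.{v} A, Module.Finite k (Ext X.obj Y.obj 1) := fun X => by
    have := finite_ext_one k X Y
    exact Module.Finite.of_finite
  have := fin0 N; have := fin0 L; have := fin0 M; have := fin1 M; have := fin1 L
  have key := finrank_alternating (k := k)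
    (Ext.precompOfLinear (Ext.mk₀ g) k Y.obj (zero_add 0))
    (Ext.precompOfLinear (Ext.mk₀ f) k Y.obj (zero_add 0))
    (Ext.precompOfLinear hS.extClass k Y.obj (add_zero 1))
    (Ext.precompOfLinear (Ext.mk₀ g) k Y.obj (zero_add 1))
    (Ext.precompOfLinear (Ext.mk₀ f) k Y.obj (zero_add 1))
    (Ext.precomp_mk₀_injective_of_epi Y.obj g)
    (fun x => ⟨fun h => Ext.contravariant_sequence_exact₂ hS Y.obj x h, by
      rintro ⟨y, rfl⟩; simp [w]⟩)
    (fun x => ⟨fun h => Ext.contravariant_sequence_exact₁ hS Y.obj x (add_zero 1) h, by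
      rintro ⟨y, rfl⟩; exact hS.extClass_comp_assoc y (h := add_zero 1)⟩)
    (fun x => ⟨fun h => Ext.contravariant_sequence_exact₃ hS Y.obj x h (add_zero 1), by
      rintro ⟨y, rfl⟩; exact hS.comp_extClass_assoc y (add_zero 1)⟩)
    (fun x => ⟨fun h => Ext.contravariant_sequence_exact₂ hS Y.obj x h, by
      rintro ⟨y, rfl⟩; simp [w]⟩)
    (fun x => Ext.contravariant_sequence_exact₁ hS Y.obj x rfl
      (Ext.eq_zero_of_hasProjectiveDimensionLT _ 2 le_rfl))
  simp only [finrank_ext_zero] at key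
  rw [eulerDim, eulerDim, eulerDim]
  linarith


/-! ### The Grothendieck group and the Euler form -/

/-- The defining relations `[L] = [N] + [M]` of the Grothendieck group, one for each short exact
sequence `0 → N → L → M → 0` of finite dimensional modules. -/
def grothendieckRelations (A : Type v) [Ring A] : Set (FreeAbelianGroup (FGModuleCat.{v} A)) :=
  {x | ∃ (N L M : FGModuleCat.{v} A) (f : N.obj ⟶ L.obj) (g : L.obj ⟶ M.obj) (w : f ≫ g = 0),
    (ShortComplex.mk f g w).ShortExact ∧
      x = FreeAbelianGroup.of L - (FreeAbelianGroup.of N + FreeAbelianGroup.of M)}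

/-- The Grothendieck group `K(A)` of the category of finite dimensional `A`-modules. -/
abbrev GrothendieckGroup (A : Type v) [Ring A] : Type (v + 1) :=
  FreeAbelianGroup (FGModuleCat.{v} A) ⧸ AddSubgroup.closure (grothendieckRelations A)

/-- The class of a module in `K(A)`. -/
def cl {A : Type v} [Ring A] (M : FGModuleCat.{v} A) : GrothendieckGroup A :=
  QuotientAddGroup.mk (FreeAbelianGroup.of M)

theorem cl_eq {A : Type v} [Ring A] {N L M : FGModuleCat.{v} A} {f : N.obj ⟶ L.obj}
    {g : L.obj ⟶ M.obj} {w : f ≫ g = 0} (hS : (ShortComplex.mk f g w).ShortExact) :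
    cl L = cl N + cl M := by
  have h : FreeAbelianGroup.of L - (FreeAbelianGroup.of N + FreeAbelianGroup.of M) ∈
      AddSubgroup.closure (grothendieckRelations A) :=
    AddSubgroup.subset_closure ⟨N, L, M, f, g, w, hS, rfl⟩
  have h' := (QuotientAddGroup.eq_zero_iff _).2 h
  rw [QuotientAddGroup.mk_sub, QuotientAddGroup.mk_add, sub_eq_zero] at h'
  exact h'

/-- Functions on modules that are additive on short exact sequences extend to `K(A)`. -/
def GrothendieckGroup.lift {A : Type v} [Ring A] {G : Type*} [AddCommGroup G]
    (φ : FGModuleCat.{v} A → G)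
    (hφ : ∀ (N L M : FGModuleCat.{v} A) (f : N.obj ⟶ L.obj) (g : L.obj ⟶ M.obj) (w : f ≫ g = 0),
      (ShortComplex.mk f g w).ShortExact → φ L = φ N + φ M) :
    GrothendieckGroup A →+ G :=
  QuotientAddGroup.lift _ (FreeAbelianGroup.lift φ) <| by
    rw [AddSubgroup.closure_le]
    rintro x ⟨N, L, M, f, g, w, hS, rfl⟩
    simp [hφ N L M f g w hS]

@[simp]
theorem GrothendieckGroup.lift_cl {A : Type v} [Ring A] {G : Type*} [AddCommGroup G]
    (φ : FGModuleCat.{v} A → G)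
    (hφ : ∀ (N L M : FGModuleCat.{v} A) (f : N.obj ⟶ L.obj) (g : L.obj ⟶ M.obj) (w : f ≫ g = 0),
      (ShortComplex.mk f g w).ShortExact → φ L = φ N + φ M) (M : FGModuleCat.{v} A) :
    GrothendieckGroup.lift φ hφ (cl M) = φ M := by
  simp [GrothendieckGroup.lift, cl]

theorem GrothendieckGroup.hom_ext {A : Type v} [Ring A] {G : Type*} [AddCommGroup G]
    {φ ψ : GrothendieckGroup A →+ G} (h : ∀ M, φ (cl M) = ψ (cl M)) : φ = ψ := by
  apply QuotientAddGroup.addMonoidHom_ext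
  ext M
  exact h M

/-- The Euler form `⟨·, ·⟩` on `K(A)`: the bilinear form with
`⟨M̂, N̂⟩ = dim_k Hom_A(M, N) - dim_k Ext¹_A(M, N)`, see `eulerForm_cl`. -/
noncomputable def eulerForm (k : Type u) [Field k] [Finite k] (A : Type v)
    [Ring A] [Algebra k A] [Module.Finite k A] [IsHereditaryRing A]
    : GrothendieckGroup A →+ GrothendieckGroup A →+ ℤ :=
  GrothendieckGroup.lift
    (fun M => GrothendieckGroup.lift (fun N => eulerDim k M.obj N.obj)
      fun N L M' f g w hS => eulerDim_add_right k M N L M' f g w hS)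
    fun N L M f g w hS => GrothendieckGroup.hom_ext fun Y => by
      simpa using eulerDim_add_left k Y N L M f g w hS

theorem eulerForm_cl (k : Type u) [Field k] [Finite k] {A : Type v}
    [Ring A] [Algebra k A] [Module.Finite k A] [IsHereditaryRing A]
    (M N : FGModuleCat.{v} A) :
    eulerForm k A (cl M) (cl N) = eulerDim k M.obj N.obj := by
  simp [eulerForm]

/-- The symmetric Euler form `(α, β) = ⟨α, β⟩ + ⟨β, α⟩`. -/
noncomputable def symEulerForm (k : Type u) [Field k] [Finite k] (A : Type v)
    [Ring A] [Algebra k A] [Module.Finite k A] [IsHereditaryRing A]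
    (α β : GrothendieckGroup A) : ℤ :=
  eulerForm k A α β + eulerForm k A β α

/-! ### Minimal projective resolutions -/

/-- A minimal projective resolution `0 → Ω → P → M → 0` of length one: `Ω` and `P` are finite
dimensional projective modules and the kernel of `ε : P → M` is superfluous in `P`, that is,
`ε` is a projective cover (and so is then the corestriction `Ω ≅ ker ε`). -/
structure MinimalResolution {A : Type v} [Ring A]
    (M : FGModuleCat.{v} A) where
  Ω : FGModuleCat.{v} A
  P : FGModuleCat.{v} A
  projective_Ω : Module.Projective A Ω
  projective_P : Module.Projective A P
  δ : Ω →ₗ[A] P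
  ε : P →ₗ[A] M
  injective_δ : Function.Injective δ
  exact : Function.Exact δ ε
  surjective_ε : Function.Surjective ε
  minimal : ∀ U : Submodule A P, U ⊔ LinearMap.ker ε = ⊤ → U = ⊤

theorem nonempty_minimalResolution (k : Type u) [Field k] [Finite k] {A : Type v}
    [Ring A] [Algebra k A] [Module.Finite k A] [IsHereditaryRing A]
    (M : FGModuleCat.{v} A) : Nonempty (MinimalResolution M) := by
  classical
  have hM : Module.Finite A M.obj := M.property
  let p : ℕ → Prop := fun n => ∃ (P : FGModuleCat.{v} A) (ε : P →ₗ[A] M),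
    Module.Projective A P ∧ Function.Surjective ε ∧ Nat.card P = n
  have hp : ∃ n, p n := by
    obtain ⟨n, g, hg⟩ := Module.Finite.exists_fin' A M.obj
    exact ⟨_, FGModuleCat.of A (Fin n → A), g,
      inferInstanceAs (Module.Projective A (Fin n → A)), hg, rfl⟩
  obtain ⟨P, ε, hP, hε, hcard⟩ := Nat.find_spec hp
  have hfin : Finite P := finite_carrier k P
  obtain ⟨h₁, h₂⟩ := finite_projective_ker k (P := P) (M := M) ε
  refine ⟨⟨FGModuleCat.of A (LinearMap.ker ε), P, h₂, hP, (LinearMap.ker ε).subtype, ε,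
    Subtype.val_injective, ?_, hε, ?_⟩⟩
  · intro x
    exact ⟨fun hx => ⟨⟨x, hx⟩, rfl⟩, by rintro ⟨y, rfl⟩; exact y.2⟩
  · intro U hU
    have : Module.Finite A U := Module.Finite.of_finite
    have hle : Nat.card P ≤ Nat.card U := by
      rw [hcard]
      refine Nat.find_min' hp ⟨FGModuleCat.of A U, ε.comp U.subtype, ?_, ?_, rfl⟩
      · exact projective_submodule U
      · intro y
        obtain ⟨x, rfl⟩ := hε y
        obtain ⟨a, ha, b, hb, rfl⟩ := Submodule.mem_sup.1 (hU ▸ Submodule.mem_top : x ∈ _)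
        exact ⟨⟨a, ha⟩, by simp [LinearMap.mem_ker.1 hb]⟩
    have hs : Function.Surjective U.subtype :=
      ((Nat.bijective_iff_injective_and_card _).2
        ⟨Subtype.val_injective, le_antisymm (Nat.card_le_card_of_injective _
          Subtype.val_injective) hle⟩).2
    rw [← Submodule.range_subtype U, LinearMap.range_eq_top.2 hs]

/-- A fixed minimal projective resolution of each module. -/
noncomputable def minimalResolution (k : Type u) [Field k] [Finite k] {A : Type v}
    [Ring A] [Algebra k A] [Module.Finite k A] [IsHereditaryRing A]
    (M : FGModuleCat.{v} A) : MinimalResolution M :=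
  Classical.choice (nonempty_minimalResolution k M)

theorem MinimalResolution.cl_eq_sub {A : Type v} [Ring A]
    {M : FGModuleCat.{v} A} (ρ : MinimalResolution M) :
    cl M = cl ρ.P - cl ρ.Ω := by
  have hw : ModuleCat.ofHom ρ.δ ≫ ModuleCat.ofHom ρ.ε = 0 := by
    ext x
    exact (ρ.exact _).2 ⟨x, rfl⟩
  have hS : (ShortComplex.mk (ModuleCat.ofHom ρ.δ) (ModuleCat.ofHom ρ.ε) hw).ShortExact := by
    refine ShortComplex.ShortExact.mk' ?_ ?_ ?_
    · rw [ShortComplex.ShortExact.moduleCat_exact_iff_function_exact]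
      exact ρ.exact
    · exact (ModuleCat.mono_iff_injective _).2 ρ.injective_δ
    · exact (ModuleCat.epi_iff_surjective _).2 ρ.surjective_ε
  rw [eq_sub_iff_add_eq', ← cl_eq (N := ρ.Ω) (L := ρ.P) (M := M) hS]

theorem cl_prod {A : Type v} [Ring A]
    (M N : FGModuleCat.{v} A) : cl (FGModuleCat.of A (M × N)) = cl M + cl N := by
  have hw : ModuleCat.ofHom (LinearMap.inl A M N) ≫ ModuleCat.ofHom (LinearMap.snd A M N) = 0 := by
    ext x
    rfl
  refine cl_eq (f := ModuleCat.ofHom (LinearMap.inl A M N))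
    (g := ModuleCat.ofHom (LinearMap.snd A M N)) (w := hw) (ShortComplex.ShortExact.mk' ?_ ?_ ?_)
  · rw [ShortComplex.ShortExact.moduleCat_exact_iff_function_exact]
    exact Function.Exact.inl_snd
  · exact (ModuleCat.mono_iff_injective _).2 LinearMap.inl_injective
  · exact (ModuleCat.epi_iff_surjective _).2 LinearMap.snd_surjective

/-- Every `α ∈ K(A)` is of the form `P̂ - Q̂` with `P` and `Q` projective. -/
theorem exists_projective_sub (k : Type u) [Field k] [Finite k] {A : Type v}
    [Ring A] [Algebra k A] [Module.Finite k A] [IsHereditaryRing A]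
    (α : GrothendieckGroup A) : ∃ PQ :
      FGModuleCat.{v} A × FGModuleCat.{v} A,
    Module.Projective A PQ.1 ∧ Module.Projective A PQ.2 ∧ α = cl PQ.1 - cl PQ.2 := by
  obtain ⟨x, rfl⟩ := QuotientAddGroup.mk_surjective α
  induction x using FreeAbelianGroup.induction_on with
  | zero =>
    have : Module.Projective A (FGModuleCat.of A (Fin 0 → A)) :=
      inferInstanceAs (Module.Projective A (Fin 0 → A))
    exact ⟨(FGModuleCat.of A (Fin 0 → A), FGModuleCat.of A (Fin 0 → A)), this, this, by simp⟩
  | of M =>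
    obtain ⟨ρ⟩ := nonempty_minimalResolution k M
    exact ⟨(ρ.P, ρ.Ω), ρ.projective_P, ρ.projective_Ω, ρ.cl_eq_sub⟩
  | neg M ih =>
    obtain ⟨⟨P, Q⟩, hP, hQ, h⟩ := ih
    exact ⟨(Q, P), hQ, hP, by rw [QuotientAddGroup.mk_neg, h]; simp⟩
  | add x y hx hy =>
    obtain ⟨⟨P, Q⟩, hP, hQ, h⟩ := hx
    obtain ⟨⟨P', Q'⟩, hP', hQ', h'⟩ := hy
    dsimp only at hP hQ hP' hQ'
    refine ⟨(FGModuleCat.of A (P × P'), FGModuleCat.of A (Q × Q')),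
      inferInstanceAs (Module.Projective A (P × P')),
      inferInstanceAs (Module.Projective A (Q × Q')), ?_⟩
    rw [QuotientAddGroup.mk_add, h, h']
    simp only [cl_prod]
    abel

end Modules

/-! ### Counting symbols -/

section Counting

/-- The complex number `v = √q`, where `q = |k|`. -/
noncomputable def vv (k : Type u) : ℂ := ((Real.sqrt (Nat.card k) : ℝ) : ℂ)

/-- The short exact sequences `0 → N → L → M → 0` with the given three terms. -/
structure Extension {C : Type*} [Category* C] [Limits.HasZeroMorphisms C] (M N L : C) where
  f : N ⟶ L
  g : L ⟶ M
  w : f ≫ g = 0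
  shortExact : (ShortComplex.mk f g w).ShortExact

/-- The usual equivalence of short exact sequences (with fixed end terms). -/
instance Extension.setoid {C : Type*} [Category* C] [Limits.HasZeroMorphisms C] (M N L : C) :
    Setoid (Extension M N L) where
  r E E' := ∃ φ : L ≅ L, E.f ≫ φ.hom = E'.f ∧ φ.hom ≫ E'.g = E.g
  iseqv :=
    { refl := fun E => ⟨Iso.refl L, by simp, by simp⟩
      symm := by
        rintro E E' ⟨φ, h₁, h₂⟩
        exact ⟨φ.symm, by simp [← h₁], by simp [← h₂]⟩
      trans := by
        rintro E E' E'' ⟨φ, h₁, h₂⟩ ⟨ψ, h₃, h₄⟩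
        exact ⟨φ ≪≫ ψ, by simp [← h₃, ← h₁], by simp [h₂, h₄]⟩ }

/-- `|Ext¹(M, N)_L|`: the number of equivalence classes of short exact sequences
`0 → N → L → M → 0` with middle term (isomorphic to) `L`. -/
noncomputable def extCard {C : Type*} [Category* C] [Limits.HasZeroMorphisms C] (M N L : C) : ℕ :=
  Nat.card (Quotient (Extension.setoid M N L))

variable {A : Type v} [Ring A]

/-- `a_M = |Aut M|`. -/
noncomputable def autCard (M : FGModuleCat.{v} A) : ℕ := Nat.card (M ≃ₗ[A] M)

/-- The Ringel–Hall number `F_{MN}^L`. -/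
noncomputable def hallNumber (M N L : FGModuleCat.{v} A) : ℂ :=
  ((extCard M.obj N.obj L.obj : ℂ) / (Nat.card (M.obj ⟶ N.obj) : ℂ)) *
    ((autCard L : ℂ) / ((autCard M : ℂ) * (autCard N : ℂ)))

/-- The set `W_{MN}^{XY}` of triples `(f, g, h)` such that
`0 → X → M → N → Y → 0`, with maps `g`, `f`, `h` in this order, is exact. -/
def exactTriples (M N X Y : FGModuleCat.{v} A) :
    Set ((M →ₗ[A] N) × (X →ₗ[A] M) × (N →ₗ[A] Y)) :=
  {t | Function.Injective t.2.1 ∧ Function.Exact t.2.1 t.1 ∧ Function.Exact t.1 t.2.2 ∧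
    Function.Surjective t.2.2}

/-- `γ_{MN}^{XY} = |W_{MN}^{XY}| / (a_M a_N)`. -/
noncomputable def gammaNumber (M N X Y : FGModuleCat.{v} A) : ℂ :=
  (Nat.card (exactTriples M N X Y) : ℂ) / ((autCard M : ℂ) * (autCard N : ℂ))

variable (A) in
/-- The set `Iso(A)` of isomorphism classes of finite dimensional `A`-modules. -/
abbrev IsoClass : Type (v + 1) := Quotient (isIsomorphicSetoid (FGModuleCat.{v} A))

/-- The isomorphism class `[M]`. -/
def isoClass (M : FGModuleCat.{v} A) : IsoClass A := Quotient.mk _ M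

end Counting

/-! ### The Heisenberg double -/

section Heisenberg

variable (k : Type u) [Field k] [Finite k] (A : Type v) [Ring A] [Algebra k A] [Module.Finite k A]

/-- The generators `Z⁺_{[M]}`, `Z⁻_{[M]}`, `K_α`, `K⁻_α` of the Heisenberg double. -/
inductive HeisGen (A : Type v) [Ring A] : Type (v + 1)
  | Zp (M : IsoClass A)
  | Zm (M : IsoClass A)
  | Kp (α : GrothendieckGroup A)
  | Km (α : GrothendieckGroup A)

namespace HeisGen

variable {A}

/-- `Z⁺_{[M]}` in the free algebra. -/
noncomputable abbrev zp (M : IsoClass A) : FreeAlgebra ℂ (HeisGen A) := FreeAlgebra.ι ℂ (Zp M)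
/-- `Z⁻_{[M]}` in the free algebra. -/
noncomputable abbrev zm (M : IsoClass A) : FreeAlgebra ℂ (HeisGen A) := FreeAlgebra.ι ℂ (Zm M)
/-- `K_α` in the free algebra. -/
noncomputable abbrev kp (α : GrothendieckGroup A) : FreeAlgebra ℂ (HeisGen A) :=
  FreeAlgebra.ι ℂ (Kp α)
/-- `K⁻_α` in the free algebra. -/
noncomputable abbrev km (α : GrothendieckGroup A) : FreeAlgebra ℂ (HeisGen A) :=
  FreeAlgebra.ι ℂ (Km α)

end HeisGen

open HeisGen

variable [IsHereditaryRing A]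

/-- The defining relations of the Heisenberg double. The relations `Zp_mul`, `Kp_add`, `Kp_Zp`,
`Kp_zero`, `Zp_zero` and the same ones for the other sign express that there are two copies of the
extended Ringel–Hall algebra (whose unit is `[0] = K_0`); the remaining ones are the
commutation relations between the two copies. All sums have only finitely many nonzero terms. -/
inductive HeisRel : FreeAlgebra ℂ (HeisGen A) → FreeAlgebra ℂ (HeisGen A) → Prop
  | Zp_mul (M N : FGModuleCat.{v} A) : HeisRel (zp (isoClass M) * zp (isoClass N))
      (vv k ^ eulerForm k A (cl M) (cl N) •
        ∑ᶠ L : IsoClass A, hallNumber M N L.out • zp L)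
  | Zm_mul (M N : FGModuleCat.{v} A) : HeisRel (zm (isoClass M) * zm (isoClass N))
      (vv k ^ eulerForm k A (cl M) (cl N) •
        ∑ᶠ L : IsoClass A, hallNumber M N L.out • zm L)
  | Zp_zero (M : FGModuleCat.{v} A) (hM : Subsingleton M) : HeisRel (zp (isoClass M)) 1
  | Zm_zero (M : FGModuleCat.{v} A) (hM : Subsingleton M) : HeisRel (zm (isoClass M)) 1
  | Kp_add (α β : GrothendieckGroup A) : HeisRel (kp α * kp β) (kp (α + β))
  | Km_add (α β : GrothendieckGroup A) : HeisRel (km α * km β) (km (α + β))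
  | Kp_zero : HeisRel (kp 0) 1
  | Km_zero : HeisRel (km 0) 1
  | Kp_Zp (α : GrothendieckGroup A) (M : FGModuleCat.{v} A) :
      HeisRel (kp α * zp (isoClass M))
        (vv k ^ symEulerForm k A α (cl M) • (zp (isoClass M) * kp α))
  | Km_Zm (α : GrothendieckGroup A) (M : FGModuleCat.{v} A) :
      HeisRel (km α * zm (isoClass M))
        (vv k ^ symEulerForm k A α (cl M) • (zm (isoClass M) * km α))
  | Zm_Zp (M N : FGModuleCat.{v} A) : HeisRel (zm (isoClass M) * zp (isoClass N))
      (∑ᶠ XY : IsoClass A × IsoClass A,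
        (vv k ^ eulerForm k A (cl M - cl XY.1.out) (cl XY.1.out - cl XY.2.out) *
            gammaNumber M N XY.1.out XY.2.out) •
          (kp (cl M - cl XY.1.out) * zp XY.2 * zm XY.1))
  | Kp_Zm (α : GrothendieckGroup A) (M : FGModuleCat.{v} A) :
      HeisRel (kp α * zm (isoClass M))
        (vv k ^ (-symEulerForm k A α (cl M)) • (zm (isoClass M) * kp α))
  | Km_Zp (α : GrothendieckGroup A) (M : FGModuleCat.{v} A) :
      HeisRel (km α * zp (isoClass M)) (zp (isoClass M) * km α)
  | Kp_Km (α β : GrothendieckGroup A) :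
      HeisRel (kp α * km β) (vv k ^ (-symEulerForm k A α β) • (km β * kp α))

/-- The Heisenberg double `Heis(A)` of the extended Ringel–Hall algebra of `A`. -/
abbrev Heis : Type (v + 1) := RingQuot (HeisRel k A)

namespace Heis

variable {A}

/-- The element `Z⁺_{[M]}` of `Heis(A)`. -/
noncomputable def Zp (M : FGModuleCat.{v} A) : Heis k A :=
  RingQuot.mkAlgHom ℂ (HeisRel k A) (zp (isoClass M))
/-- The element `Z⁻_{[M]}` of `Heis(A)`. -/
noncomputable def Zm (M : FGModuleCat.{v} A) : Heis k A :=
  RingQuot.mkAlgHom ℂ (HeisRel k A) (zm (isoClass M))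
/-- The element `K_α` of `Heis(A)`. -/
noncomputable def Kp (α : GrothendieckGroup A) : Heis k A :=
  RingQuot.mkAlgHom ℂ (HeisRel k A) (kp α)
/-- The element `K⁻_α` of `Heis(A)`. -/
noncomputable def Km (α : GrothendieckGroup A) : Heis k A :=
  RingQuot.mkAlgHom ℂ (HeisRel k A) (km α)

end Heis

end Heisenberg

/-! ### `m`-cyclic complexes of projectives -/

section Complexes

variable (m : ℕ) (A : Type v) [Ring A]

/-- `m`-cyclic complexes of `A`-modules: objects `M_i` and differentials `M_i → M_{i+1}` with
`d² = 0`, indexed by `i ∈ ℤ/m` (which is `ℤ` for `m = 0`). -/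
abbrev CyclicComplex : Type (v + 1) :=
  HomologicalComplex (ModuleCat.{v} A) (ComplexShape.up (ZMod m))

/-- The complexes with finite dimensional projective terms; they are required to have only finitely
many nonzero terms, which says that they are bounded if `m = 0` and is automatic if `m > 0`. -/
def isProjectiveComplex : ObjectProperty (CyclicComplex m A) := fun M =>
  (∀ i, Module.Finite A (M.X i) ∧ Module.Projective A (M.X i)) ∧
    {i | ¬ Limits.IsZero (M.X i)}.Finite

/-- The category `C_m(P)` of `m`-cyclic complexes (bounded complexes if `m = 0`) of finite
dimensional projective `A`-modules. -/
abbrev ProjComplex : Type (v + 1) := (isProjectiveComplex m A).FullSubcategory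

variable {A}

/-- The shift `M[t]`, with `M[t]_i = M_{i+t}` and differential `(-1)^t d_{i+t}`. -/
def shiftComplex (t : ℤ) (M : CyclicComplex m A) : CyclicComplex m A where
  X i := M.X (i + t)
  d i j := t.negOnePow • M.d (i + t) (j + t)
  shape i j hij := by
    rw [M.shape, smul_zero]
    intro h
    apply hij
    simp only [ComplexShape.up_Rel] at h ⊢
    exact add_right_cancel (b := (t : ZMod m)) (by rw [← h]; abel)
  d_comp_d' i j l _ _ := by simp

/-- The shift on `C_m(P)`. -/
def shift (t : ℤ) (M : ProjComplex m A) : ProjComplex m A where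
  obj := shiftComplex m t M.obj
  property := ⟨fun i => M.property.1 (i + t),
    M.property.2.preimage (f := fun i : ZMod m => i + t) (add_left_injective _).injOn⟩

/-- For `f : Q → P` with `Q`, `P` projective, the complex `C_f` with `Q` in degree `m - 1 = -1`,
`P` in degree `0`, zero elsewhere, and only nonzero differential `f : Q → P`. -/
noncomputable def cone {Q P : FGModuleCat.{v} A} (hQ : Module.Projective A Q)
    (hP : Module.Projective A P) (f : Q →ₗ[A] P) : ProjComplex m A where
  obj := HomologicalComplex.double (ModuleCat.ofHom f) (c := ComplexShape.up (ZMod m))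
    (i₀ := -1) (i₁ := 0) (by simp)
  property := by
    constructor
    · intro i
      have key : ∀ X : ModuleCat.{v} A,
          (Nonempty (X ≅ Q.obj) ∨ Nonempty (X ≅ P.obj) ∨ Limits.IsZero X) →
            Module.Finite A X ∧ Module.Projective A X := by
        rintro X (⟨⟨φ⟩⟩ | ⟨⟨φ⟩⟩ | h)
        · have : Module.Finite A Q.obj := Q.property
          exact ⟨Module.Finite.equiv φ.toLinearEquiv.symm,
            Module.Projective.of_equiv φ.toLinearEquiv.symm⟩
        · have : Module.Finite A P.obj := P.property
          exact ⟨Module.Finite.equiv φ.toLinearEquiv.symm,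
            Module.Projective.of_equiv φ.toLinearEquiv.symm⟩
        · have : Subsingleton X := ModuleCat.subsingleton_of_isZero h
          exact ⟨Module.Finite.of_finite, Module.Projective.of_free⟩
      apply key
      by_cases h₀ : i = -1
      · subst h₀
        exact Or.inl ⟨HomologicalComplex.doubleXIso₀ _ _⟩
      · by_cases h₁ : i = 0
        · subst h₁
          exact Or.inr (Or.inl ⟨HomologicalComplex.doubleXIso₁ _ _ (Ne.symm h₀)⟩)
        · exact Or.inr (Or.inr (HomologicalComplex.isZero_double_X _ _ i h₀ h₁))
    · refine Set.Finite.subset (Set.toFinite {-1, 0}) fun i hi => ?_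
      by_contra h
      simp only [Set.mem_insert_iff, Set.mem_singleton_iff, not_or] at h
      exact hi (HomologicalComplex.isZero_double_X _ _ i h.1 h.2)

/-- The complex `K_P = C_{id_P}`. -/
noncomputable def diskComplex {P : FGModuleCat.{v} A} (hP : Module.Projective A P) :
    ProjComplex m A :=
  cone m hP hP LinearMap.id

/-- The complex `C_M = C_δ` of a minimal projective resolution `0 → Ω → P → M → 0`, where `δ` is
the map `Ω → P`. -/
noncomputable def resolutionComplex {M : FGModuleCat.{v} A} (ρ : MinimalResolution M) :
    ProjComplex m A :=
  cone m ρ.projective_Ω ρ.projective_P ρ.δ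

variable (A) in
/-- Isomorphism classes of objects of `C_m(P)`. -/
abbrev ComplexClass : Type (v + 1) := Quotient (isIsomorphicSetoid (ProjComplex m A))

variable (A) in
/-- The zero complex. -/
def zeroComplex : ProjComplex m A where
  obj :=
    { X := fun _ => ModuleCat.of A PUnit
      d := fun _ _ => 0 }
  property := by
    have h : Limits.IsZero (ModuleCat.of A PUnit.{v + 1}) := ModuleCat.isZero_of_subsingleton _
    refine ⟨fun i => ?_, by simp [h]⟩
    have : Subsingleton (ModuleCat.of A PUnit.{v + 1}) := ModuleCat.subsingleton_of_isZero h
    exact ⟨Module.Finite.of_finite, inferInstance⟩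

end Complexes

/-! ### Bridgeland's Hall algebra -/

section Bridgeland

variable (k : Type u) [Field k] [Finite k] (m : ℕ) (A : Type v) [Ring A] [Algebra k A]
  [Module.Finite k A]

/-- The form `⟨M, N⟩ = ∑_i ⟨M_i, N_i⟩` on complexes; for `m = 0` the sum has finitely many nonzero
terms. -/
noncomputable def complexEuler {A : Type v} [Ring A] [Algebra k A] (M N : ProjComplex m A) : ℤ :=
  ∑ᶠ i : ZMod m, eulerDim k (M.obj.X i) (N.obj.X i)

/-- The vector space underlying the twisted Hall algebra of `C_m(P)`, with basis the isomorphism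
classes of complexes. -/
abbrev TwistedHall (m : ℕ) (A : Type v) [Ring A] : Type (v + 1) := ComplexClass m A →₀ ℂ

/-- The product of two basis elements of the twisted Hall algebra:
`[M] * [N] = v^⟨M, N⟩ ∑_{[L]} |Ext¹(M, N)_L| / |Hom(M, N)| [L]`.
The sum has only finitely many nonzero terms. -/
noncomputable def basisMul {A : Type v} [Ring A] [Algebra k A] (M N : ProjComplex m A) :
    TwistedHall m A :=
  vv k ^ complexEuler k m M N •
    ∑ᶠ L : ComplexClass m A,
      Finsupp.single L ((extCard M.obj N.obj L.out.obj : ℂ) / (Nat.card (M ⟶ N) : ℂ))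

/-- The product of the twisted Hall algebra: the bilinear extension of `basisMul`. -/
noncomputable def hallMul {A : Type v} [Ring A] [Algebra k A] (x y : TwistedHall m A) :
    TwistedHall m A :=
  x.sum fun M a => y.sum fun N b => (a * b) • basisMul k m M.out N.out

/-- The acyclic complexes in `C_m(P)`. -/
abbrev AcyclicComplex (m : ℕ) (A : Type v) [Ring A] : Type (v + 1) :=
  {M : ProjComplex m A // M.obj.Acyclic}

/-- The basis element `[M]` of the twisted Hall algebra. -/
noncomputable def basisElt {m : ℕ} {A : Type v} [Ring A] (M : ProjComplex m A) :
    TwistedHall m A :=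
  Finsupp.single (Quotient.mk _ M) 1

/-- Generators for the localization: the elements of the twisted Hall algebra, and a formal
inverse for each acyclic complex. -/
abbrev LocGen (m : ℕ) (A : Type v) [Ring A] : Type (v + 1) :=
  TwistedHall m A ⊕ AcyclicComplex m A

/-- The relations saying that the twisted Hall algebra maps to its localization by a homomorphism
of unital `ℂ`-algebras (the unit being the class of the zero complex) and that the classes of the
acyclic complexes become invertible. -/
inductive LocRel : FreeAlgebra ℂ (LocGen m A) → FreeAlgebra ℂ (LocGen m A) → Prop
  | add (x y : TwistedHall m A) : LocRel (FreeAlgebra.ι ℂ (Sum.inl (x + y)))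
      (FreeAlgebra.ι ℂ (Sum.inl x) + FreeAlgebra.ι ℂ (Sum.inl y))
  | smul (c : ℂ) (x : TwistedHall m A) : LocRel (FreeAlgebra.ι ℂ (Sum.inl (c • x)))
      (c • FreeAlgebra.ι ℂ (Sum.inl x))
  | mul (x y : TwistedHall m A) : LocRel (FreeAlgebra.ι ℂ (Sum.inl (hallMul k m x y)))
      (FreeAlgebra.ι ℂ (Sum.inl x) * FreeAlgebra.ι ℂ (Sum.inl y))
  | one : LocRel (FreeAlgebra.ι ℂ (Sum.inl (basisElt (zeroComplex m A)))) 1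
  | mul_inv (S : AcyclicComplex m A) :
      LocRel (FreeAlgebra.ι ℂ (Sum.inl (basisElt S.1)) * FreeAlgebra.ι ℂ (Sum.inr S)) 1
  | inv_mul (S : AcyclicComplex m A) :
      LocRel (FreeAlgebra.ι ℂ (Sum.inr S) * FreeAlgebra.ι ℂ (Sum.inl (basisElt S.1))) 1

/-- Bridgeland's Hall algebra `DH_m(A)`: the localization of the twisted Hall algebra of `C_m(P)`
at the classes of acyclic complexes, that is, the universal unital `ℂ`-algebra with a homomorphism
from the twisted Hall algebra under which these classes become invertible. -/
abbrev DH : Type (v + 1) := RingQuot (LocRel k m A)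

namespace DH

variable {A}

/-- The canonical map from the twisted Hall algebra to `DH_m(A)`. -/
noncomputable def of (x : TwistedHall m A) : DH k m A :=
  RingQuot.mkAlgHom ℂ (LocRel k m A) (FreeAlgebra.ι ℂ (Sum.inl x))

/-- The class `[M]` in `DH_m(A)`. -/
noncomputable def cls (M : ProjComplex m A) : DH k m A := of k m (basisElt M)

variable [IsHereditaryRing A]

/-- The element `K_{α,r} = [K_P[r]] * [K_Q[r]]⁻¹`, where `α = P̂ - Q̂` with `P`, `Q` projective.
The class of the acyclic complex `K_Q[r]` is invertible in `DH_m(A)`, so that `Ring.inverse` is its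
inverse. The shift by `r ∈ ℤ/m` is the one by the representative of `r` in `{0, …, m - 1}`
(`r` itself for `m = 0`). -/
noncomputable def K (r : ZMod m) (α : GrothendieckGroup A) : DH k m A :=
  let h := exists_projective_sub k α
  cls k m (shift m (r.cast : ℤ) (diskComplex m h.choose_spec.1)) *
    Ring.inverse (cls k m (shift m (r.cast : ℤ) (diskComplex m h.choose_spec.2.1)))

/-- The element `e_{M,r} = a_M⁻¹ v^⟨Ω̂_M, M̂⟩ K_{-Ω̂_M,r} * [C_M[r]]`. -/
noncomputable def e (r : ZMod m) (M : FGModuleCat.{v} A) : DH k m A :=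
  let ρ := minimalResolution k M
  ((autCard M : ℂ)⁻¹ * vv k ^ eulerForm k A (cl ρ.Ω) (cl M)) •
    (K k m r (-cl ρ.Ω) * cls k m (shift m (r.cast : ℤ) (resolutionComplex m ρ)))

end DH

end Bridgeland

end BridgelandHall

/-!
The first step is a formula for the product in the twisted Hall algebra that involves no extension
groups. Since the terms of `M` are projective, every extension of complexes of `M` by `N` splits in
each degree, and so it is `N ⊕ M` with differential `(d_N, θ; 0, d_M)` for a *twisting cochain*
`θ : M → N[1]`; equivalence of extensions is a coboundary condition on `θ`. Counting gives that
`[M] * [N]` is `v ^ (-∑ ⟨M_i, N_i⟩)` times the plain sum of the classes of the middle terms over all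
`θ` (`hallMul_basisElt`). Associativity is then immediate: both ways of multiplying three classes are
sums over block triangular differentials on `R ⊕ N ⊕ M` (`hcl_mul_assoc`).

As `A` is hereditary, acyclic complexes of projectives are contractible, so there are no nontrivial
extensions by or of them, and the class `[K]` of an acyclic complex commutes with each `[M]` up to a
nonzero scalar. Hence the acyclic classes form an Ore set, and an element of the twisted Hall algebra
that vanishes in `DH_m(A)` is killed by some `[K]` (`exists_acyclic_mul_eq_zero`).

The other complexes that occur have two terms. By Schanuel's lemma, `α ↦ K_{α,r}` is a homomorphism
(`exists_K_hom`), and `a_M e_{M,r}` can be computed from any projective resolution of `M` of length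
one, not only from the minimal one (`resElt_eq`). The relations of the Heisenberg double are checked
as follows.

* In the same degree, twisting cochains `C_M → C_N` are maps `θ : Ω_M → P_N`, and the middle term is
  a resolution of the pushout of `0 → Ω_M → P_M → M → 0` along `Ω_M → P_N → N`, hence of an extension
  of `M` by `N`; all extensions arise, equally often for each equivalence class
  (`ringelElt_mul_ringelElt`).
* Twisting cochains `C_M[1] → C_N` are anticommutative squares. Each induces a map `φ : M → N`, and
  each `φ` comes from the same number of squares. The middle term is a three-term complex
  `Ω_M → Ω_N ⊕ P_M → P_N`; as the image of the second map is projective, it is the direct sum of a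
  resolution of the cokernel of `φ` and a shifted resolution of the kernel of `φ`
  (`ringelElt_succ_mul_ringelElt`). Grouping the maps `φ` by kernel and cokernel gives `γ`.
* The commutation relations with `K_{α,r}` only involve the classes of terms of complexes
  (`hasWeight_cls`).

This gives `J` (`heisToDH`). For injectivity, the relations allow every element of the Heisenberg
double to be written as a combination of the monomials `K_α Z⁺_M K⁻_β Z⁻_N` (`span_heisMonomial`).
Given finitely many of them, multiplication by suitable units `K` turns their images into nonzero
multiples of classes of honest complexes `C_N[r+1] ⊕ C_M[r] ⊕ (contractible)`. Since `m = 0` or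
`m > 2`, these sit in three distinct degrees: homology recovers `M` and `N`, and the classes of the
outer two terms recover `α` and `β`. So the complexes are pairwise nonisomorphic, also after adding
an acyclic complex, and the images are linearly independent (`linearIndependent_heisToDH`).
-/

namespace BridgelandHall

/-! ### Counting extensions -/

/-- The two extensions agree up to an isomorphism of their middle terms that is compatible with the
end terms. -/
def Extension.Equiv {C : Type*} [Category* C] [Limits.HasZeroMorphisms C] {M N L L' : C}
    (E : Extension M N L) (E' : Extension M N L') : Prop :=
  ∃ φ : L ≅ L', E.f ≫ φ.hom = E'.f ∧ φ.hom ≫ E'.g = E.g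

theorem Extension.Equiv.symm {C : Type*} [Category* C] [Limits.HasZeroMorphisms C]
    {M N L L' : C} {E : Extension M N L} {E' : Extension M N L'} (h : E.Equiv E') :
    E'.Equiv E := by
  obtain ⟨φ, h₁, h₂⟩ := h
  exact ⟨φ.symm, by simp [← h₁], by simp [← h₂]⟩

theorem Extension.Equiv.trans {C : Type*} [Category* C] [Limits.HasZeroMorphisms C]
    {M N L L' L'' : C} {E : Extension M N L} {E' : Extension M N L'} {E'' : Extension M N L''}
    (h : E.Equiv E') (h' : E'.Equiv E'') : E.Equiv E'' := by
  obtain ⟨φ, h₁, h₂⟩ := h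
  obtain ⟨ψ, h₃, h₄⟩ := h'
  exact ⟨φ ≪≫ ψ, by simp [← h₃, ← h₁], by simp [h₂, h₄]⟩

/-- Transport of an extension along an isomorphism of middle terms. -/
def Extension.transport {C : Type*} [Category* C] [Limits.HasZeroMorphisms C] {M N L L' : C}
    (E : Extension M N L) (φ : L ≅ L') : Extension M N L' where
  f := E.f ≫ φ.hom
  g := φ.inv ≫ E.g
  w := by simp [E.w]
  shortExact := ShortComplex.shortExact_of_iso
    (ShortComplex.isoMk (S₁ := ShortComplex.mk E.f E.g E.w)
      (S₂ := ShortComplex.mk (E.f ≫ φ.hom) (φ.inv ≫ E.g) (by simp [E.w]))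
      (Iso.refl _) φ (Iso.refl _)) E.shortExact

theorem Extension.equiv_transport {C : Type*} [Category* C] [Limits.HasZeroMorphisms C]
    {M N L L' : C} (E : Extension M N L) (φ : L ≅ L') : E.Equiv (E.transport φ) :=
  ⟨φ, rfl, by simp [transport]⟩

/-- If a finite abelian group `Θ` parametrizes all extensions of `M` by `N`, and two parameters give
equivalent extensions exactly when they differ by an element of the image of `D`, then each
equivalence class of extensions occurs `|im D|` times. -/
theorem card_middle_iso {C : Type*} [Category* C] [Limits.HasZeroMorphisms C] {M N : C}
    {Θ S : Type*} [AddCommGroup Θ] [AddCommGroup S] (D : S →+ Θ)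
    (X : Θ → C) (E : ∀ θ, Extension M N (X θ))
    (hsurj : ∀ (L : C) (E' : Extension M N L), ∃ θ, (E θ).Equiv E')
    (hequiv : ∀ θ θ', (E θ).Equiv (E θ') ↔ θ' - θ ∈ D.range) (L : C) :
    Nat.card {θ // Nonempty (X θ ≅ L)} = extCard M N L * Nat.card D.range := by
  choose σ hσ using fun q : Quotient (Extension.setoid M N L) => hsurj L q.out
  have hX : ∀ (q : Quotient (Extension.setoid M N L)) (b : D.range),
      (E (σ q + b)).Equiv q.out := fun q b =>
    (((hequiv (σ q) (σ q + b)).2 (by simp)).symm).trans (hσ q)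
  rw [extCard, ← Nat.card_prod]
  symm
  refine Nat.card_congr (Equiv.ofBijective
    (fun x => ⟨σ x.1 + x.2, let ⟨φ, _⟩ := hX x.1 x.2; ⟨φ⟩⟩) ⟨?_, ?_⟩)
  · rintro ⟨q, b⟩ ⟨q', b'⟩ h
    have h' : σ q + b = σ q' + b' := congrArg Subtype.val h
    have hq : q = q' := by
      rw [← q.out_eq, ← q'.out_eq]
      refine Quotient.sound ?_
      have := hX q b
      rw [h'] at this
      exact this.symm.trans (hX q' b')
    subst hq
    simpa using h'
  · rintro ⟨θ, ⟨φ⟩⟩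
    let q : Quotient (Extension.setoid M N L) := Quotient.mk _ ((E θ).transport φ)
    have h₁ : q.out ≈ (E θ).transport φ := Quotient.mk_out _
    have h₂ : (E (σ q)).Equiv (E θ) :=
      ((hσ q).trans h₁).trans ((E θ).equiv_transport φ).symm
    exact ⟨(q, ⟨θ - σ q, (hequiv _ _).1 h₂⟩), Subtype.ext (by simp)⟩

theorem card_eq_card_ker_mul_card_range {S Θ : Type*} [AddCommGroup S] [AddCommGroup Θ]
    (D : S →+ Θ) : Nat.card S = Nat.card D.ker * Nat.card D.range := by
  rw [AddSubgroup.card_eq_card_quotient_mul_card_addSubgroup D.ker, mul_comm,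
    Nat.card_congr (QuotientAddGroup.quotientKerEquivRange D).toEquiv]

/-- A sum over a finite type, grouped by the fibres of a map. -/
theorem sum_comp_eq_finsum {ι Q V : Type*} [Fintype ι] [AddCommGroup V] [Module ℂ V] (f : ι → Q)
    (F : Q → V) : ∑ i, F (f i) = ∑ᶠ q, (Nat.card {i // f i = q} : ℂ) • F q := by
  classical
  rw [finsum_eq_sum_of_support_subset (s := Finset.univ.image f)]
  · rw [← Finset.sum_fiberwise_of_maps_to (s := Finset.univ) (t := Finset.univ.image f) (g := f)
      (fun i _ => Finset.mem_image_of_mem f (Finset.mem_univ i))]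
    refine Finset.sum_congr rfl fun q _ => ?_
    rw [Finset.sum_congr rfl (g := fun _ => F q) (fun i hi => by rw [(Finset.mem_filter.1 hi).2]),
      Finset.sum_const, Nat.card_eq_fintype_card, Fintype.card_subtype, Nat.cast_smul_eq_nsmul]
  · intro q hq
    by_contra h
    refine hq ?_
    have : IsEmpty {i // f i = q} := ⟨fun i => h (by
      simp only [Finset.coe_image, Finset.coe_univ, Set.image_univ]
      exact ⟨i.1, i.2⟩)⟩
    simp

theorem finite_support_card_fiber {ι Q : Type*} [Finite ι] (f : ι → Q) :
    {q | Nat.card {i // f i = q} ≠ 0}.Finite := by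
  refine (Set.finite_range f).subset fun q hq => ?_
  by_contra h
  exact hq (by
    have : IsEmpty {i // f i = q} := ⟨fun i => h ⟨i.1, i.2⟩⟩
    simp)

/-- If all fibres of `f` have the same cardinality `c`, then summing `F ∘ f` multiplies by `c`. -/
theorem sum_comp_of_card_fiber {ι κ V : Type*} [Fintype ι] [Fintype κ] [AddCommGroup V]
    [Module ℂ V] (f : ι → κ) (c : ℂ) (hc : ∀ x, (Nat.card {i // f i = x} : ℂ) = c) (F : κ → V) :
    ∑ i, F (f i) = c • ∑ x, F x := by
  rw [sum_comp_eq_finsum f F, finsum_eq_sum_of_fintype, Finset.smul_sum]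
  exact Finset.sum_congr rfl fun x _ => by rw [hc]

theorem card_fiber_addMonoidHom {G H : Type*} [AddGroup G] [AddGroup H] (f : G →+ H)
    (hf : Function.Surjective f) (x : H) : Nat.card {g // f g = x} = Nat.card f.ker := by
  obtain ⟨g₀, rfl⟩ := hf x
  refine Nat.card_congr ⟨fun g => ⟨g.1 - g₀, by simp [AddMonoidHom.mem_ker, g.2]⟩,
    fun g => ⟨g.1 + g₀, by rw [map_add, AddMonoidHom.mem_ker.1 g.2, zero_add]⟩, ?_, ?_⟩
  · intro g; simp
  · intro g; simp

/-! ### Classes and Euler forms of modules -/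

section

variable {A : Type v} [Ring A]

/-- The class in `K(A)` of an unbundled finitely generated module. -/
def mcl (A : Type v) [Ring A] (V : Type v) [AddCommGroup V] [Module A V] [Module.Finite A V] :
    GrothendieckGroup A :=
  cl (FGModuleCat.of A V)

theorem mcl_exact {N L M : Type v} [AddCommGroup N] [AddCommGroup L] [AddCommGroup M]
    [Module A N] [Module A L] [Module A M] [Module.Finite A N] [Module.Finite A L]
    [Module.Finite A M] (f : N →ₗ[A] L) (g : L →ₗ[A] M) (hf : Function.Injective f)
    (h : Function.Exact f g) (hg : Function.Surjective g) : mcl A L = mcl A N + mcl A M := by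
  have hw : ModuleCat.ofHom f ≫ ModuleCat.ofHom g = 0 := by
    ext x
    exact (h _).2 ⟨x, rfl⟩
  refine cl_eq (f := ModuleCat.ofHom f) (g := ModuleCat.ofHom g) (w := hw)
    (ShortComplex.ShortExact.mk' ?_ ?_ ?_)
  · rw [ShortComplex.ShortExact.moduleCat_exact_iff_function_exact]
    exact h
  · exact (ModuleCat.mono_iff_injective _).2 hf
  · exact (ModuleCat.epi_iff_surjective _).2 hg

theorem mcl_prod (N M : Type v) [AddCommGroup N] [AddCommGroup M]
    [Module A N] [Module A M] [Module.Finite A N] [Module.Finite A M] :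
    mcl A (N × M) = mcl A N + mcl A M :=
  cl_prod (FGModuleCat.of A N) (FGModuleCat.of A M)

theorem mcl_subsingleton (N : Type v) [AddCommGroup N] [Module A N] [Module.Finite A N]
    [Subsingleton N] : mcl A N = 0 := by
  have := mcl_exact (A := A) (0 : N →ₗ[A] N) (0 : N →ₗ[A] N) (Function.injective_of_subsingleton _)
    (fun x => ⟨fun _ => ⟨0, Subsingleton.elim _ _⟩, fun _ => rfl⟩)
    (fun x => ⟨0, Subsingleton.elim _ _⟩)
  simpa using this

theorem mcl_congr {N M : Type v} [AddCommGroup N] [AddCommGroup M]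
    [Module A N] [Module A M] [Module.Finite A N] [Module.Finite A M] (e : N ≃ₗ[A] M) :
    mcl A N = mcl A M := by
  have := mcl_exact (A := A) e.toLinearMap (0 : M →ₗ[A] PUnit.{v + 1}) e.injective
    (fun x => ⟨fun _ => ⟨e.symm x, by simp⟩, fun _ => Subsingleton.elim _ _⟩)
    (fun x => ⟨0, Subsingleton.elim _ _⟩)
  rw [this, mcl_subsingleton (A := A) PUnit.{v + 1}, add_zero]

end

theorem vv_zpow_two_mul (k : Type u) (n : ℤ) : vv k ^ (2 * n) = (Nat.card k : ℂ) ^ n := by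
  rw [zpow_mul]
  congr 1
  rw [vv, zpow_ofNat, ← Complex.ofReal_pow, Real.sq_sqrt (Nat.cast_nonneg _)]
  simp

section

variable (k : Type u) [Field k] [Finite k]

theorem vv_ne_zero : vv k ≠ 0 := by
  have : (0 : ℝ) < Nat.card k := by exact_mod_cast Nat.card_pos
  rw [vv]
  exact_mod_cast (Real.sqrt_pos.2 this).ne'

variable {A : Type v} [Ring A] [Algebra k A] [Module.Finite k A] [IsHereditaryRing A]

theorem eulerDim_eq_eulerForm (M N : ModuleCat.{v} A) [Module.Finite A M] [Module.Finite A N] :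
    eulerDim k M N = eulerForm k A (mcl A M) (mcl A N) :=
  (eulerForm_cl k (FGModuleCat.of A M) (FGModuleCat.of A N)).symm

/-- For projective `P` there is no `Ext¹`, so the Euler form counts the maps `P → N`. -/
theorem card_hom_of_projective (P N : Type v) [AddCommGroup P] [AddCommGroup N] [Module A P]
    [Module A N] [Module.Finite A P] [Module.Finite A N] [Module.Projective A P] :
    (Nat.card (P →ₗ[A] N) : ℂ) = vv k ^ (2 * eulerForm k A (mcl A P) (mcl A N)) := by
  have h := eulerForm_cl k (FGModuleCat.of A P) (FGModuleCat.of A N)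
  have hP : Projective (FGModuleCat.of A P).obj :=
    (IsProjective.iff_projective _).1 (inferInstanceAs (Module.Projective A P))
  have : Subsingleton (Abelian.Ext (FGModuleCat.of A P).obj (FGModuleCat.of A N).obj 1) :=
    ⟨fun x y => by
      rw [Abelian.Ext.eq_zero_of_projective x, Abelian.Ext.eq_zero_of_projective y]⟩
  rw [eulerDim, Module.finrank_zero_of_subsingleton
    (M := Abelian.Ext (FGModuleCat.of A P).obj (FGModuleCat.of A N).obj 1), Nat.cast_zero, sub_zero] at h
  change _ = vv k ^ (2 * eulerForm k A (cl (FGModuleCat.of A P)) (cl (FGModuleCat.of A N)))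
  rw [h, vv_zpow_two_mul, zpow_natCast]
  have hfin := finite_hom k (FGModuleCat.of A P) (FGModuleCat.of A N)
  have : Module.Finite k ((FGModuleCat.of A P).obj ⟶ (FGModuleCat.of A N).obj) :=
    Module.Finite.of_finite
  have e : (P →ₗ[A] N) ≃ ((FGModuleCat.of A P).obj ⟶ (FGModuleCat.of A N).obj) :=
    (ModuleCat.homEquiv (M := ModuleCat.of A P) (N := ModuleCat.of A N)).symm
  rw [Nat.card_congr e, Module.natCard_eq_pow_finrank (K := k)]
  push_cast
  rfl

end

/-! ### Extensions of complexes of projectives -/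

section

variable {m : ℕ} {A : Type v} [Ring A]

instance finite_term (M : ProjComplex m A) (i : ZMod m) : Module.Finite A (M.obj.X i) :=
  (M.property.1 i).1

instance projective_term (M : ProjComplex m A) (i : ZMod m) : Module.Projective A (M.obj.X i) :=
  (M.property.1 i).2

/-- The differential as a linear map. -/
def dif (M : ProjComplex m A) (i j : ZMod m) : M.obj.X i →ₗ[A] M.obj.X j := (M.obj.d i j).hom

theorem dif_dif (M : ProjComplex m A) (i j l : ZMod m) (x : M.obj.X i) :
    dif M j l (dif M i j x) = 0 := by
  have := M.obj.d_comp_d i j l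
  exact LinearMap.congr_fun (congrArg ModuleCat.Hom.hom this) x

theorem dif_shape (M : ProjComplex m A) {i j : ZMod m} (h : i + 1 ≠ j) : dif M i j = 0 := by
  rw [dif, M.obj.shape i j h]
  rfl

theorem moduleCat_hom_ext {V W : ModuleCat.{v} A} {f g : V ⟶ W}
    (h : ∀ x, f.hom x = g.hom x) : f = g :=
  ModuleCat.hom_ext (LinearMap.ext h)

theorem isZero_iff_subsingleton (V : ModuleCat.{v} A) : Limits.IsZero V ↔ Subsingleton V :=
  ⟨fun h => ModuleCat.subsingleton_of_isZero h, fun _ => ModuleCat.isZero_of_subsingleton V⟩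

theorem finite_nontrivial (M : ProjComplex m A) : {i | Nontrivial (M.obj.X i)}.Finite := by
  refine M.property.2.subset fun i hi h => ?_
  have := (isZero_iff_subsingleton _).1 h
  exact not_subsingleton_iff_nontrivial.2 hi this

/-- A complex of projectives from its terms and differentials, given as linear maps. -/
abbrev mkComplex (X : ZMod m → Type v) [∀ i, AddCommGroup (X i)] [∀ i, Module A (X i)]
    [∀ i, Module.Finite A (X i)] [∀ i, Module.Projective A (X i)]
    (hX : {i | Nontrivial (X i)}.Finite) (d : ∀ i j, X i →ₗ[A] X j)
    (hs : ∀ i j, i + 1 ≠ j → d i j = 0) (hd : ∀ i j l x, d j l (d i j x) = 0) :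
    ProjComplex m A where
  obj :=
    { X := fun i => ModuleCat.of A (X i)
      d := fun i j => ModuleCat.ofHom (d i j)
      shape := fun i j h => by rw [hs i j h]; rfl
      d_comp_d' := fun i j l _ _ => by
        ext x
        exact hd i j l x }
  property := ⟨fun i => ⟨(inferInstance : Module.Finite A (X i)),
      (inferInstance : Module.Projective A (X i))⟩, hX.subset fun i hi => by
    by_contra h
    exact hi ((isZero_iff_subsingleton _).2 (not_nontrivial_iff_subsingleton.1 h))⟩

/-- Isomorphisms of complexes from linear equivalences of the terms. -/
def isoOfEquiv {L L' : CyclicComplex m A} (e : ∀ i, L.X i ≃ₗ[A] L'.X i)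
    (h : ∀ i j x, i + 1 = j → (L'.d i j).hom (e i x) = e j ((L.d i j).hom x)) : L ≅ L' :=
  HomologicalComplex.Hom.isoOfComponents (fun i => (e i).toModuleIso) fun i j hij => by
    ext x
    exact h i j x hij

theorem nonempty_iso_of_equiv {L L' : ProjComplex m A} (e : ∀ i, L.obj.X i ≃ₗ[A] L'.obj.X i)
    (h : ∀ i j x, i + 1 = j → dif L' i j (e i x) = e j (dif L i j x)) : Nonempty (L ≅ L') :=
  ⟨ObjectProperty.isoMk _ (isoOfEquiv e h)⟩

theorem exists_equiv_of_iso {L L' : ProjComplex m A} (φ : L ≅ L') :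
    ∃ e : ∀ i, L.obj.X i ≃ₗ[A] L'.obj.X i, ∀ i j x, dif L' i j (e i x) = e j (dif L i j x) := by
  let ψ : L.obj ≅ L'.obj := (isProjectiveComplex m A).ι.mapIso φ
  refine ⟨fun i => (HomologicalComplex.Hom.isoApp ψ i).toLinearEquiv, fun i j x => ?_⟩
  exact LinearMap.congr_fun (congrArg ModuleCat.Hom.hom (ψ.hom.comm i j)) x

theorem nonempty_iso_obj_iff {L L' : ProjComplex m A} :
    Nonempty (L.obj ≅ L'.obj) ↔ Nonempty (L ≅ L') :=
  ⟨fun ⟨φ⟩ => ⟨ObjectProperty.isoMk _ φ⟩, fun ⟨φ⟩ => ⟨(isProjectiveComplex m A).ι.mapIso φ⟩⟩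

/-- The twisting cochains `θ : M → N[1]`: families of maps `M_i → N_{i+1}` for which the matrix
`(d_N, θ; 0, d_M)` is a differential on `N ⊕ M`. They are indexed by two degrees, with value zero
unless the second is the successor of the first. -/
def twist (M N : ProjComplex m A) : AddSubgroup (∀ i j, M.obj.X i →ₗ[A] N.obj.X j) where
  carrier := {θ | (∀ i j, i + 1 ≠ j → θ i j = 0) ∧
    ∀ i j l x, dif N j l (θ i j x) + θ j l (dif M i j x) = 0}
  zero_mem' := by simp
  add_mem' := by
    rintro θ η ⟨h₁, h₂⟩ ⟨h₃, h₄⟩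
    refine ⟨fun i j h => by simp [h₁ i j h, h₃ i j h], fun i j l x => ?_⟩
    rw [← add_zero (0 : N.obj.X l)]
    nth_rewrite 1 [← h₂ i j l x]
    nth_rewrite 1 [← h₄ i j l x]
    simp only [Pi.add_apply, LinearMap.add_apply, map_add]
    abel
  neg_mem' := by
    rintro θ ⟨h₁, h₂⟩
    refine ⟨fun i j h => by simp [h₁ i j h], fun i j l x => ?_⟩
    rw [← neg_zero, ← h₂ i j l x]
    simp only [Pi.neg_apply, LinearMap.neg_apply, map_neg]
    abel

variable {M N R : ProjComplex m A}

theorem twist_shape (θ : twist M N) {i j : ZMod m} (h : i + 1 ≠ j) : θ.1 i j = 0 := θ.2.1 i j h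

theorem twist_cond (θ : twist M N) (i j l : ZMod m) (x : M.obj.X i) :
    dif N j l (θ.1 i j x) + θ.1 j l (dif M i j x) = 0 := θ.2.2 i j l x

theorem finite_nontrivial_prod (M N : ProjComplex m A) :
    {i | Nontrivial (N.obj.X i × M.obj.X i)}.Finite := by
  refine ((finite_nontrivial M).union (finite_nontrivial N)).subset fun i hi => ?_
  by_contra h
  simp only [Set.mem_union, Set.mem_ofPred_eq, not_or, not_nontrivial_iff_subsingleton] at h
  have := h.1
  have := h.2
  exact not_subsingleton_iff_nontrivial.2 hi inferInstance

/-- The complex `N ⊕ M` with differential `(d_N, θ; 0, d_M)`. -/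
abbrev tsum (θ : twist M N) : ProjComplex m A :=
  mkComplex (fun i => N.obj.X i × M.obj.X i) (finite_nontrivial_prod M N)
    (fun i j => ((dif N i j).comp (LinearMap.fst A _ _) +
      (θ.1 i j).comp (LinearMap.snd A _ _)).prod ((dif M i j).comp (LinearMap.snd A _ _)))
    (fun i j h => by
      ext x <;> simp [dif_shape _ h, twist_shape θ h])
    (fun i j l x => by
      have := twist_cond θ i j l x.2
      ext
      · simpa [dif_dif] using this
      · simp [dif_dif])

theorem dif_tsum (θ : twist M N) (i j : ZMod m) (x : N.obj.X i × M.obj.X i) :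
    dif (tsum θ) i j x = ((dif N i j x.1 + θ.1 i j x.2, dif M i j x.2) : _ × _) := rfl

/-- The direct sum of complexes (with the second complex as first component). -/
abbrev dsum (M N : ProjComplex m A) : ProjComplex m A := tsum (0 : twist M N)

theorem dif_dsum (i j : ZMod m) (x : N.obj.X i × M.obj.X i) :
    dif (dsum M N) i j x = ((dif N i j x.1, dif M i j x.2) : _ × _) := by
  rw [dif_tsum]
  simp

/-- The extension of `M` by `N` with middle term `N ⊕ M` and differential `(d_N, θ; 0, d_M)`. -/
def tsumExt (θ : twist M N) : Extension M.obj N.obj (tsum θ).obj where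
  f := { f := fun i => ModuleCat.ofHom (LinearMap.inl A (N.obj.X i) (M.obj.X i))
         comm' := fun i j _ => by
          refine moduleCat_hom_ext fun x => ?_
          refine (dif_tsum θ i j (x, 0)).trans ?_
          simp
          rfl }
  g := { f := fun i => ModuleCat.ofHom (LinearMap.snd A (N.obj.X i) (M.obj.X i))
         comm' := fun i j _ => moduleCat_hom_ext fun x => rfl }
  w := by
    ext i x
    rfl
  shortExact := by
    refine HomologicalComplex.shortExact_of_degreewise_shortExact _ fun i => ?_
    refine ShortComplex.ShortExact.mk' ?_ ?_ ?_
    · rw [ShortComplex.ShortExact.moduleCat_exact_iff_function_exact]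
      exact (Function.Exact.inl_snd :
        Function.Exact (LinearMap.inl A (N.obj.X i) (M.obj.X i)) (LinearMap.snd A _ _))
    · exact (ModuleCat.mono_iff_injective _).2
        (LinearMap.inl_injective : Function.Injective (LinearMap.inl A (N.obj.X i) (M.obj.X i)))
    · exact (ModuleCat.epi_iff_surjective _).2
        (LinearMap.snd_surjective : Function.Surjective (LinearMap.snd A (N.obj.X i) (M.obj.X i)))

/-- Every extension by a complex `M` with projective terms splits in each degree, and so it comes
from a twisting cochain. -/
theorem exists_twist {L : CyclicComplex m A} (E : Extension M.obj N.obj L) :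
    ∃ θ : twist M N, (tsumExt θ).Equiv E := by
  have hE := fun i => (HomologicalComplex.shortExact_iff_degreewise_shortExact _).1 E.shortExact i
  let f : ∀ i, N.obj.X i →ₗ[A] L.X i := fun i => (E.f.f i).hom
  let g : ∀ i, L.X i →ₗ[A] M.obj.X i := fun i => (E.g.f i).hom
  have hf : ∀ i, Function.Injective (f i) := fun i =>
    (ModuleCat.mono_iff_injective _).1 (hE i).mono_f
  have hg : ∀ i, Function.Surjective (g i) := fun i =>
    (ModuleCat.epi_iff_surjective _).1 (hE i).epi_g
  have hfg : ∀ i, Function.Exact (f i) (g i) := fun i =>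
    (ShortComplex.ShortExact.moduleCat_exact_iff_function_exact _).1 (hE i).exact
  have hdf : ∀ i j x, (L.d i j).hom (f i x) = f j (dif N i j x) := fun i j x =>
    LinearMap.congr_fun (congrArg ModuleCat.Hom.hom (E.f.comm i j)) x
  have hdg : ∀ i j x, dif M i j (g i x) = g j ((L.d i j).hom x) := fun i j x =>
    LinearMap.congr_fun (congrArg ModuleCat.Hom.hom (E.g.comm i j)) x
  have hdd : ∀ i j l x, (L.d j l).hom ((L.d i j).hom x) = 0 := fun i j l x =>
    LinearMap.congr_fun (congrArg ModuleCat.Hom.hom (L.d_comp_d i j l)) x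
  choose s hs using fun i => Module.projective_lifting_property (g i) LinearMap.id (hg i)
  have hs' : ∀ i x, g i (s i x) = x := fun i x => LinearMap.congr_fun (hs i) x
  have hgf : ∀ i x, g i (f i x) = 0 := fun i x => (hfg i _).2 ⟨x, rfl⟩
  have hbij : ∀ i, Function.Bijective (LinearMap.coprod (f i) (s i)) := by
    intro i
    constructor
    · rw [← LinearMap.ker_eq_bot, LinearMap.ker_eq_bot']
      rintro ⟨a, b⟩ hab
      simp only [LinearMap.coprod_apply] at hab
      have hb : b = 0 := by simpa [hgf, hs'] using congrArg (g i) hab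
      subst hb
      have ha : f i a = f i 0 := by simpa using hab
      simp [hf i ha]
    · intro x
      obtain ⟨a, ha⟩ := (hfg i (x - s i (g i x))).1 (by simp [hs'])
      exact ⟨(a, g i x), by simp [ha]⟩
  let e : ∀ i, (N.obj.X i × M.obj.X i) ≃ₗ[A] L.X i := fun i =>
    LinearEquiv.ofBijective (LinearMap.coprod (f i) (s i)) (hbij i)
  have he : ∀ i x, e i x = f i x.1 + s i x.2 := fun i x => rfl
  let θ : ∀ i j, M.obj.X i →ₗ[A] N.obj.X j := fun i j =>
    (LinearMap.fst A _ _).comp ((e j).symm.toLinearMap.comp ((L.d i j).hom.comp (s i)))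
  have hθ : ∀ i j x, (L.d i j).hom (s i x) = f j (θ i j x) + s j (dif M i j x) := by
    intro i j x
    obtain ⟨⟨a, b⟩, hab⟩ := (e j).surjective ((L.d i j).hom (s i x))
    have h₁ : θ i j x = a := by simp [θ, ← hab]
    have h₂ : b = dif M i j x := by
      have := congrArg (g j) hab
      rw [← hdg, hs', he] at this
      simpa [hgf, hs'] using this
    rw [h₁, ← h₂, ← hab, he]
  have hθ' : θ ∈ twist M N := by
    constructor
    · intro i j hij
      have : L.d i j = 0 := L.shape i j hij
      ext x
      simp [θ, this]
    · intro i j l x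
      have h := hdd i j l (s i x)
      rw [hθ, map_add, hdf, hθ, dif_dif, map_zero, add_zero, ← map_add] at h
      exact (hf l) (by rw [h, map_zero])
  refine ⟨⟨θ, hθ'⟩, isoOfEquiv (L := (tsum ⟨θ, hθ'⟩).obj) e ?_, ?_, ?_⟩
  · intro i j x _
    change (L.d i j).hom (e i x) = e j (dif (tsum ⟨θ, hθ'⟩) i j x)
    rw [dif_tsum, he, he, map_add, hdf, hθ, map_add, add_assoc]
  · refine HomologicalComplex.hom_ext _ _ fun i => moduleCat_hom_ext fun x => ?_
    change e i (x, 0) = f i x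
    simp [he]
  · refine HomologicalComplex.hom_ext _ _ fun i => moduleCat_hom_ext fun x => ?_
    change g i (e i x) = x.2
    simp [he, hgf, hs']

/-- The twisting cochain `d s - s d`, for which the extension of `M` by `N` splits. -/
def coboundary (M N : ProjComplex m A) : (∀ i, M.obj.X i →ₗ[A] N.obj.X i) →+ twist M N where
  toFun s := ⟨fun i j => (dif N i j).comp (s i) - (s j).comp (dif M i j), by
    constructor
    · intro i j h
      simp [dif_shape _ h]
    · intro i j l x
      simp [dif_dif]⟩
  map_zero' := by
    ext i j x
    simp
  map_add' s t := by
    ext i j x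
    simp only [AddSubgroup.coe_add, Pi.add_apply, LinearMap.sub_apply, LinearMap.comp_apply,
      LinearMap.add_apply, map_add]
    abel

theorem coboundary_apply (s : ∀ i, M.obj.X i →ₗ[A] N.obj.X i) (i j : ZMod m) (x : M.obj.X i) :
    (coboundary M N s).1 i j x = dif N i j (s i x) - s j (dif M i j x) := rfl

/-- An equivalence of `tsumExt θ` and `tsumExt η` is unitriangular, and its off-diagonal entry
exhibits `η - θ` as a coboundary. -/
theorem tsumExt_equiv_iff (θ η : twist M N) :
    (tsumExt θ).Equiv (tsumExt η) ↔ η - θ ∈ (coboundary M N).range := by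
  constructor
  · rintro ⟨φ, h₁, h₂⟩
    let p : ∀ i, (N.obj.X i × M.obj.X i) →ₗ[A] (N.obj.X i × M.obj.X i) :=
      fun i => (φ.hom.f i).hom
    have hd : ∀ i j x, dif (tsum η) i j (p i x) = p j (dif (tsum θ) i j x) := fun i j x =>
      LinearMap.congr_fun (congrArg ModuleCat.Hom.hom (φ.hom.comm i j)) x
    have hp₁ : ∀ i x, p i (x, 0) = (x, 0) := fun i x =>
      LinearMap.congr_fun (congrArg ModuleCat.Hom.hom
        (congrArg (fun q => HomologicalComplex.Hom.f q i) h₁)) x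
    have hp₂ : ∀ i x, (p i x).2 = x.2 := fun i x =>
      LinearMap.congr_fun (congrArg ModuleCat.Hom.hom
        (congrArg (fun q => HomologicalComplex.Hom.f q i) h₂)) x
    let s : ∀ i, M.obj.X i →ₗ[A] N.obj.X i := fun i =>
      (LinearMap.fst A _ _).comp ((p i).comp (LinearMap.inr A _ _))
    have hp : ∀ i x, p i x = (x.1 + s i x.2, x.2) := by
      intro i x
      have h : p i x = p i (x.1, 0) + p i (0, x.2) := by rw [← map_add]; simp
      ext
      · rw [h, hp₁]; rfl
      · exact hp₂ i x
    refine ⟨-s, ?_⟩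
    ext i j x
    have h := congrArg Prod.fst (hd i j (0, x))
    rw [hp, hp, dif_tsum, dif_tsum] at h
    simp only [zero_add, map_zero] at h
    rw [map_neg]
    change -(dif N i j (s i x) - s j (dif M i j x)) = η.1 i j x - θ.1 i j x
    rw [neg_sub, sub_eq_sub_iff_add_eq_add, add_comm, ← h, add_comm]
  · rintro ⟨s, hs⟩
    have hs' : ∀ i j x, η.1 i j x = θ.1 i j x + (dif N i j (s i x) - s j (dif M i j x)) := by
      intro i j x
      rw [← coboundary_apply, hs]
      simp
    let e : ∀ i, (N.obj.X i × M.obj.X i) ≃ₗ[A] (N.obj.X i × M.obj.X i) := fun i =>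
      { toFun := fun x => (x.1 - s i x.2, x.2)
        invFun := fun x => (x.1 + s i x.2, x.2)
        map_add' := fun x y => by ext <;> simp; abel
        map_smul' := fun a x => by ext <;> simp [smul_sub]
        left_inv := fun x => by simp
        right_inv := fun x => by simp }
    have he : ∀ i x, e i x = (x.1 - s i x.2, x.2) := fun i x => rfl
    refine ⟨isoOfEquiv (L := (tsum θ).obj) (L' := (tsum η).obj) e ?_, ?_, ?_⟩
    · intro i j x _
      change dif (tsum η) i j (e i x) = e j (dif (tsum θ) i j x)
      rw [he, he, dif_tsum, dif_tsum]
      ext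
      · simp only [map_sub, hs']
        abel
      · rfl
    · refine HomologicalComplex.hom_ext _ _ fun i => moduleCat_hom_ext fun x => ?_
      change e i (x, 0) = (x, 0)
      simp [he]
    · exact HomologicalComplex.hom_ext _ _ fun i => moduleCat_hom_ext fun x => rfl

/-- The kernel of `s ↦ d s - s d` consists of the morphisms of complexes. -/
theorem card_coboundary_ker (M N : ProjComplex m A) :
    Nat.card (coboundary M N).ker = Nat.card (M ⟶ N) := by
  refine Nat.card_congr ⟨fun s => ObjectProperty.homMk
    { f := fun i => ModuleCat.ofHom (s.1 i), comm' := fun i j _ => ?_ },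
    fun φ => ⟨fun i => (φ.hom.f i).hom, ?_⟩, fun s => rfl, fun φ => rfl⟩
  · ext x
    have h : (coboundary M N s.1).1 i j x = 0 := by rw [AddMonoidHom.mem_ker.1 s.2]; rfl
    rw [coboundary_apply, sub_eq_zero] at h
    exact h
  · rw [AddMonoidHom.mem_ker]
    ext i j x
    rw [coboundary_apply]
    exact sub_eq_zero.2 (LinearMap.congr_fun (congrArg ModuleCat.Hom.hom (φ.hom.comm i j)) x)

/-- The number of twisting cochains with a given middle term. -/
theorem card_tsum_iso (M N L : ProjComplex m A) :
    Nat.card {θ : twist M N // Nonempty (tsum θ ≅ L)} =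
      extCard M.obj N.obj L.obj * Nat.card (coboundary M N).range := by
  rw [← card_middle_iso (coboundary M N) (fun θ => (tsum θ).obj) tsumExt
    (fun L E => exists_twist E) tsumExt_equiv_iff L.obj]
  exact Nat.card_congr (Equiv.subtypeEquivRight fun θ => nonempty_iso_obj_iff.symm)

/-- Isomorphic complexes with corresponding twisting cochains have isomorphic middle terms. -/
theorem tsum_iso (θ : twist M N) {M' N' : ProjComplex m A} (a : ∀ i, M.obj.X i ≃ₗ[A] M'.obj.X i)
    (ha : ∀ i j x, dif M' i j (a i x) = a j (dif M i j x))
    (b : ∀ i, N.obj.X i ≃ₗ[A] N'.obj.X i)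
    (hb : ∀ i j x, dif N' i j (b i x) = b j (dif N i j x)) (θ' : twist M' N')
    (hθ : ∀ i j x, θ'.1 i j (a i x) = b j (θ.1 i j x)) : Nonempty (tsum θ ≅ tsum θ') := by
  refine nonempty_iso_of_equiv (L := tsum θ) (L' := tsum θ')
    (fun i => (b i).prodCongr (a i)) fun i j x _ => ?_
  change dif (tsum θ') i j (b i x.1, a i x.2) = _
  rw [dif_tsum, dif_tsum]
  ext
  · simp [hb, hθ]
  · simp [ha]

/-- Isomorphisms of `M` and `N` induce a bijection of twisting cochains. -/
def twistCongr {M' N' : ProjComplex m A} (a : ∀ i, M.obj.X i ≃ₗ[A] M'.obj.X i)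
    (ha : ∀ i j x, dif M' i j (a i x) = a j (dif M i j x))
    (b : ∀ i, N.obj.X i ≃ₗ[A] N'.obj.X i)
    (hb : ∀ i j x, dif N' i j (b i x) = b j (dif N i j x)) : twist M N ≃ twist M' N' where
  toFun θ := ⟨fun i j => (b j).toLinearMap.comp ((θ.1 i j).comp (a i).symm.toLinearMap), by
    constructor
    · intro i j h
      simp [twist_shape θ h]
    · intro i j l x
      obtain ⟨x, rfl⟩ := (a i).surjective x
      simp [ha, hb, ← map_add, twist_cond]⟩
  invFun θ := ⟨fun i j => (b j).symm.toLinearMap.comp ((θ.1 i j).comp (a i).toLinearMap), by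
    constructor
    · intro i j h
      simp [twist_shape θ h]
    · intro i j l x
      apply (b l).injective
      simp [← ha, ← hb, twist_cond]⟩
  left_inv θ := by
    ext i j x
    simp
  right_inv θ := by
    ext i j x
    simp

end

/-! ### The product of two classes -/

section

variable {ι : Type*} {V : ι → Type*}

/-- A product of types, almost all of which have one element, is a product over a finite set. -/
noncomputable def piEquivOfFinite [∀ i, Nonempty (V i)] (s : Set ι) (h : {i | Nontrivial (V i)} ⊆ s) :
    (∀ i, V i) ≃ ∀ i : s, V i := by
  classical
  have : ∀ i : {i // i ∉ s}, Subsingleton (V i) := fun i =>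
    not_nontrivial_iff_subsingleton.1 fun h' => i.2 (h h')
  have : Unique (∀ i : {i // i ∉ s}, V i) :=
    { default := fun i => Classical.arbitrary _
      uniq := fun x => funext fun i => Subsingleton.elim _ _ }
  exact (Equiv.piEquivPiSubtypeProd (· ∈ s) V).trans (Equiv.prodUnique _ _)

theorem finite_pi_of_finite_nontrivial [∀ i, Nonempty (V i)] [∀ i, Finite (V i)]
    (h : {i | Nontrivial (V i)}.Finite) : Finite (∀ i, V i) :=
  have := h.to_subtype
  Finite.of_equiv _ (piEquivOfFinite _ subset_rfl).symm

theorem card_pi_of_finite_nontrivial [∀ i, Nonempty (V i)] (s : Finset ι)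
    (h : {i | Nontrivial (V i)} ⊆ s) : Nat.card (∀ i, V i) = ∏ i ∈ s, Nat.card (V i) := by
  rw [Nat.card_congr (piEquivOfFinite (s : Set ι) h), Nat.card_pi]
  exact Finset.prod_coe_sort s fun i => Nat.card (V i)

end

section

variable {m : ℕ} {A : Type v} [Ring A]

theorem finite_nontrivial_hom (M N : ProjComplex m A) :
    {i | Nontrivial (M.obj.X i →ₗ[A] N.obj.X i)}.Finite := by
  refine (finite_nontrivial M).subset fun i hi => ?_
  by_contra h
  have := not_nontrivial_iff_subsingleton.1 h
  exact not_subsingleton_iff_nontrivial.2 hi inferInstance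

theorem basisElt_congr {M N : ProjComplex m A} (h : Nonempty (M ≅ N)) :
    basisElt M = basisElt N := by
  rw [basisElt, basisElt, Quotient.sound (s := isIsomorphicSetoid (ProjComplex m A)) h]

variable [Finite A]

instance finite_of_term (M : ProjComplex m A) (i : ZMod m) : Finite (M.obj.X i) :=
  Module.finite_of_finite A

instance finite_linearMap_term (M N : ProjComplex m A) (i j : ZMod m) :
    Finite (M.obj.X i →ₗ[A] N.obj.X j) :=
  Finite.of_injective (fun f : M.obj.X i →ₗ[A] N.obj.X j => (f : M.obj.X i → N.obj.X j))
    DFunLike.coe_injective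

instance (M N : ProjComplex m A) : Finite (∀ i, M.obj.X i →ₗ[A] N.obj.X i) :=
  finite_pi_of_finite_nontrivial (finite_nontrivial_hom M N)

instance (M N : ProjComplex m A) : Finite (twist M N) := by
  have h : {i | Nontrivial (M.obj.X i →ₗ[A] N.obj.X (i + 1))}.Finite := by
    refine (finite_nontrivial M).subset fun i hi => ?_
    by_contra h
    have := not_nontrivial_iff_subsingleton.1 h
    exact not_subsingleton_iff_nontrivial.2 hi inferInstance
  have : Finite (∀ i, M.obj.X i →ₗ[A] N.obj.X (i + 1)) := finite_pi_of_finite_nontrivial h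
  refine Finite.of_injective (fun (θ : twist M N) i => θ.1 i (i + 1)) fun θ η hθ => ?_
  ext i j x
  by_cases hij : i + 1 = j
  · subst hij
    exact LinearMap.congr_fun (congrFun hθ i) x
  · rw [twist_shape θ hij, twist_shape η hij]

noncomputable instance (M N : ProjComplex m A) : Fintype (twist M N) := Fintype.ofFinite _

end

section

variable {m : ℕ} {A : Type v} [Ring A]

/-- The class in `K(A)` of the term of degree `i`. -/
def tcl (M : ProjComplex m A) (i : ZMod m) : GrothendieckGroup A := mcl A (M.obj.X i)

theorem tcl_tsum {M N : ProjComplex m A} (θ : twist M N) (i : ZMod m) :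
    tcl (tsum θ) i = tcl N i + tcl M i :=
  mcl_prod _ _

theorem tcl_congr {M N : ProjComplex m A} (h : Nonempty (M ≅ N)) : tcl M = tcl N := by
  obtain ⟨φ⟩ := h
  obtain ⟨e, -⟩ := exists_equiv_of_iso φ
  exact funext fun i => mcl_congr (e i)

theorem finite_support_tcl (M : ProjComplex m A) : {i | tcl M i ≠ 0}.Finite := by
  refine (finite_nontrivial M).subset fun i hi => ?_
  by_contra h
  have := not_nontrivial_iff_subsingleton.1 h
  exact hi (mcl_subsingleton _)

end

section

variable (k : Type u) [Field k] [Finite k] {m : ℕ} {A : Type v} [Ring A] [Algebra k A]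
  [Module.Finite k A] [IsHereditaryRing A]

theorem complexEuler_eq (M N : ProjComplex m A) :
    complexEuler k m M N = ∑ᶠ i, eulerForm k A (tcl M i) (tcl N i) :=
  finsum_congr fun i => eulerDim_eq_eulerForm k (M.obj.X i) (N.obj.X i)

theorem complexEuler_eq_sum (M N : ProjComplex m A) (s : Finset (ZMod m))
    (h : ∀ i ∉ s, tcl M i = 0 ∨ tcl N i = 0) :
    complexEuler k m M N = ∑ i ∈ s, eulerForm k A (tcl M i) (tcl N i) := by
  rw [complexEuler_eq, finsum_eq_sum_of_support_subset]
  intro i hi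
  by_contra h'
  exact hi (by rcases h i h' with h | h <;> simp [h])

theorem finite_support_euler (M N : ProjComplex m A) :
    (Function.support fun i => eulerForm k A (tcl M i) (tcl N i)).Finite :=
  (finite_support_tcl M).subset fun i hi h => hi (by simp [h])

theorem complexEuler_tsum_left {M N : ProjComplex m A} (θ : twist M N) (R : ProjComplex m A) :
    complexEuler k m (tsum θ) R = complexEuler k m N R + complexEuler k m M R := by
  simp only [complexEuler_eq]
  rw [← finsum_add_distrib (finite_support_euler k N R) (finite_support_euler k M R)]
  simp only [tcl_tsum, map_add, AddMonoidHom.add_apply]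

theorem complexEuler_tsum_right {M N : ProjComplex m A} (θ : twist M N) (R : ProjComplex m A) :
    complexEuler k m R (tsum θ) = complexEuler k m R N + complexEuler k m R M := by
  simp only [complexEuler_eq]
  rw [← finsum_add_distrib (finite_support_euler k R N) (finite_support_euler k R M)]
  simp only [tcl_tsum, map_add]

theorem complexEuler_congr {M M' N N' : ProjComplex m A} (h : Nonempty (M ≅ M'))
    (h' : Nonempty (N ≅ N')) : complexEuler k m M N = complexEuler k m M' N' := by
  rw [complexEuler_eq, complexEuler_eq, tcl_congr h, tcl_congr h']

/-- The number of families of maps `M_i → N_i`. As the terms are projective, it is the power of `v`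
prescribed by the Euler form. -/
theorem card_pi_hom (M N : ProjComplex m A) :
    (Nat.card (∀ i, M.obj.X i →ₗ[A] N.obj.X i) : ℂ) = vv k ^ (2 * complexEuler k m M N) := by
  have : Finite A := Module.finite_of_finite k
  have hfin := finite_nontrivial_hom M N
  rw [card_pi_of_finite_nontrivial hfin.toFinset (by simp),
    complexEuler_eq_sum k M N ((finite_nontrivial M).toFinset ∪ hfin.toFinset)
      (fun i hi => by
        simp only [Finset.mem_union, Set.Finite.mem_toFinset, Set.mem_ofPred_eq, not_or,
          not_nontrivial_iff_subsingleton] at hi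
        have := hi.1
        exact Or.inl (mcl_subsingleton _)), Finset.mul_sum]
  have h₁ : ∏ i ∈ hfin.toFinset, Nat.card (M.obj.X i →ₗ[A] N.obj.X i) =
      ∏ i ∈ (finite_nontrivial M).toFinset ∪ hfin.toFinset,
        Nat.card (M.obj.X i →ₗ[A] N.obj.X i) := by
    refine Finset.prod_subset Finset.subset_union_right fun i _ hi => ?_
    simp only [Set.Finite.mem_toFinset, Set.mem_ofPred_eq, not_nontrivial_iff_subsingleton] at hi
    exact Nat.card_unique
  rw [h₁, Nat.cast_prod]
  have h₂ : ∀ (s : Finset (ZMod m)) (f : ZMod m → ℤ),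
      vv k ^ (∑ i ∈ s, f i) = ∏ i ∈ s, vv k ^ f i := by
    classical
    intro s f
    induction s using Finset.induction_on with
    | empty => simp
    | insert a s ha ih => rw [Finset.sum_insert ha, Finset.prod_insert ha,
        zpow_add₀ (vv_ne_zero k), ih]
  rw [h₂]
  exact Finset.prod_congr rfl fun i _ => card_hom_of_projective k _ _

variable [Finite A]

/-- The basic product formula: up to a power of `v`, the product of two classes in the twisted Hall
algebra is the sum, over all twisting cochains, of the classes of the middle terms. -/
theorem basisMul_eq (M N : ProjComplex m A) :
    basisMul k m M N = vv k ^ (-complexEuler k m M N) • ∑ θ : twist M N, basisElt (tsum θ) := by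
  have hv := vv_ne_zero k
  have h₁ := sum_comp_eq_finsum (fun θ : twist M N => (Quotient.mk _ (tsum θ) : ComplexClass m A))
    (fun L => (Finsupp.single L 1 : TwistedHall m A))
  have h₂ : ∀ L : ComplexClass m A,
      (extCard M.obj N.obj L.out.obj : ℂ) / (Nat.card (M ⟶ N) : ℂ) =
        vv k ^ (-(2 * complexEuler k m M N)) * Nat.card {θ : twist M N // Quotient.mk _ (tsum θ) = L} := by
    intro L
    have e : Nat.card {θ : twist M N // Quotient.mk _ (tsum θ) = L} =
        extCard M.obj N.obj L.out.obj * Nat.card (coboundary M N).range := by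
      rw [← card_tsum_iso]
      refine Nat.card_congr (Equiv.subtypeEquivRight fun θ => ?_)
      conv_lhs => rw [← L.out_eq]
      exact Quotient.eq (r := isIsomorphicSetoid (ProjComplex m A))
    have h₃ := card_pi_hom k M N
    -- The kernel and the range of `coboundary` contribute `|Hom(M, N)|` and the factor in
    -- `card_tsum_iso`.
    rw [card_eq_card_ker_mul_card_range (coboundary M N), card_coboundary_ker] at h₃
    have h₄ : Nat.card (M ⟶ N) ≠ 0 := by
      rw [← card_coboundary_ker]
      exact Nat.card_pos.ne'
    have h₅ : Nat.card (coboundary M N).range ≠ 0 := Nat.card_pos.ne'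
    rw [e, zpow_neg, ← h₃]
    push_cast
    have : (Nat.card (M ⟶ N) : ℂ) ≠ 0 := by exact_mod_cast h₄
    have : (Nat.card (coboundary M N).range : ℂ) ≠ 0 := by exact_mod_cast h₅
    field_simp
  have h₆ : ∑ θ : twist M N, basisElt (tsum θ) =
      ∑ θ : twist M N, (Finsupp.single (Quotient.mk _ (tsum θ)) 1 : TwistedHall m A) := rfl
  rw [basisMul, h₆, h₁, finsum_congr fun L => by
    rw [h₂ L, ← mul_one (_ * (Nat.card _ : ℂ)), ← smul_eq_mul _ (1 : ℂ), ← Finsupp.smul_single,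
      mul_smul]]
  rw [← smul_finsum' _ ((finite_support_card_fiber
    (fun θ : twist M N => (Quotient.mk _ (tsum θ) : ComplexClass m A))).subset fun L hL h => hL (by
      simp [h])), smul_smul, ← zpow_add₀ hv]
  congr 2
  ring

/-- The bilinear product on basis elements, for arbitrary representatives. -/
theorem hallMul_basisElt (M N : ProjComplex m A) :
    hallMul k m (basisElt M) (basisElt N) =
      vv k ^ (-complexEuler k m M N) • ∑ θ : twist M N, basisElt (tsum θ) := by
  have hM : Nonempty ((Quotient.mk _ M : ComplexClass m A).out ≅ M) :=
    Quotient.mk_out (s := isIsomorphicSetoid (ProjComplex m A)) M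
  have hN : Nonempty ((Quotient.mk _ N : ComplexClass m A).out ≅ N) :=
    Quotient.mk_out (s := isIsomorphicSetoid (ProjComplex m A)) N
  rw [hallMul, basisElt, basisElt, Finsupp.sum_single_index (by simp),
    Finsupp.sum_single_index (by simp), mul_one, one_smul, basisMul_eq,
    complexEuler_congr k hM hN]
  obtain ⟨φ⟩ := hM
  obtain ⟨ψ⟩ := hN
  obtain ⟨a, ha⟩ := exists_equiv_of_iso φ
  obtain ⟨b, hb⟩ := exists_equiv_of_iso ψ
  congr 1
  refine Fintype.sum_equiv (twistCongr a ha b hb) _ _ fun θ => ?_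
  exact basisElt_congr (tsum_iso θ a ha b hb _ fun i j x => by simp [twistCongr])

end

/-! ### The twisted Hall algebra as a ring -/

section

variable (k : Type u) [Field k] (m : ℕ) (A : Type v) [Ring A] [Algebra k A]

/-- The twisted Hall algebra, as a type synonym carrying the Hall product. -/
def HallRing (k : Type u) [Field k] (m : ℕ) (A : Type v) [Ring A] [Algebra k A] :
    Type (v + 1) := TwistedHall m A

noncomputable instance : AddCommGroup (HallRing k m A) :=
  inferInstanceAs (AddCommGroup (TwistedHall m A))

noncomputable instance : Module ℂ (HallRing k m A) :=
  inferInstanceAs (Module ℂ (TwistedHall m A))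

/-- The Hall product as a bilinear map. -/
noncomputable def hallBilin : TwistedHall m A →ₗ[ℂ] TwistedHall m A →ₗ[ℂ] TwistedHall m A :=
  Finsupp.linearCombination ℂ fun M : ComplexClass m A =>
    Finsupp.linearCombination ℂ fun N : ComplexClass m A => basisMul k m M.out N.out

theorem hallBilin_apply (x y : TwistedHall m A) : hallBilin k m A x y = hallMul k m x y := by
  rw [hallBilin, Finsupp.linearCombination_apply, hallMul, Finsupp.sum, Finsupp.sum,
    LinearMap.sum_apply]
  refine Finset.sum_congr rfl fun M _ => ?_
  rw [LinearMap.smul_apply, Finsupp.linearCombination_apply, Finsupp.smul_sum]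
  simp only [smul_smul]

noncomputable instance : Mul (HallRing k m A) := ⟨fun x y => hallMul k m x y⟩

variable {m A}

/-- The class of a complex as an element of the ring. -/
noncomputable def hcl (M : ProjComplex m A) : HallRing k m A := basisElt M

noncomputable instance : One (HallRing k m A) := ⟨hcl k (zeroComplex m A)⟩

/-- The Hall product as a bilinear map on `HallRing`. -/
noncomputable def HallRing.mulBilin : HallRing k m A →ₗ[ℂ] HallRing k m A →ₗ[ℂ] HallRing k m A :=
  hallBilin k m A

theorem HallRing.mul_def (x y : HallRing k m A) : x * y = HallRing.mulBilin k x y :=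
  (hallBilin_apply k m A x y).symm

theorem HallRing.mul_add' (x y z : HallRing k m A) : x * (y + z) = x * y + x * z := by
  simp only [HallRing.mul_def, map_add]

theorem HallRing.add_mul' (x y z : HallRing k m A) : (x + y) * z = x * z + y * z := by
  simp only [HallRing.mul_def, LinearMap.map_add₂]

theorem HallRing.smul_mul' (c : ℂ) (x y : HallRing k m A) : c • x * y = c • (x * y) := by
  simp only [HallRing.mul_def, LinearMap.map_smul₂]

theorem HallRing.mul_smul' (c : ℂ) (x y : HallRing k m A) : x * c • y = c • (x * y) := by
  simp only [HallRing.mul_def, map_smul]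

theorem HallRing.sum_mul' {ι : Type*} (s : Finset ι) (f : ι → HallRing k m A)
    (y : HallRing k m A) : (∑ i ∈ s, f i) * y = ∑ i ∈ s, f i * y := by
  simp only [HallRing.mul_def, LinearMap.map_sum₂]

theorem HallRing.mul_sum' {ι : Type*} (s : Finset ι) (f : ι → HallRing k m A)
    (y : HallRing k m A) : y * (∑ i ∈ s, f i) = ∑ i ∈ s, y * f i := by
  simp only [HallRing.mul_def, map_sum]

theorem HallRing.zero_mul' (x : HallRing k m A) : 0 * x = 0 := by
  simp only [HallRing.mul_def, LinearMap.map_zero₂]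

theorem HallRing.mul_zero' (x : HallRing k m A) : x * 0 = 0 := by
  simp only [HallRing.mul_def, map_zero]

variable {k} in
theorem HallRing.induction {p : HallRing k m A → Prop} (x : HallRing k m A) (h0 : p 0)
    (hadd : ∀ x y, p x → p y → p (x + y)) (hbasis : ∀ (c : ℂ) (M : ProjComplex m A), p (c • hcl k M)) : p x := by
  refine Finsupp.induction_linear (motive := p) x h0 hadd fun L c => ?_
  have : (Finsupp.single L c : TwistedHall m A) = c • basisElt L.out := by
    rw [basisElt, Finsupp.smul_single, smul_eq_mul, mul_one, Quotient.out_eq]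
  rw [this]
  exact hbasis c L.out

theorem hcl_congr {M N : ProjComplex m A} (h : Nonempty (M ≅ N)) : hcl k M = hcl k N :=
  basisElt_congr h

instance (i : ZMod m) : Subsingleton ((zeroComplex m A).obj.X i) :=
  inferInstanceAs (Subsingleton PUnit)

theorem tcl_zeroComplex (i : ZMod m) : tcl (zeroComplex m A) i = 0 :=
  mcl_subsingleton _

end

section

variable {m : ℕ} {A : Type v} [Ring A]

variable {M N R : ProjComplex m A}

/-- The third entry of a block triangular differential on `R ⊕ N ⊕ M`, the other two being `θ` and
`η`. -/
def IsTriTwist (θ : twist M N) (η : twist N R) (c : ∀ i j, M.obj.X i →ₗ[A] R.obj.X j) : Prop :=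
  (∀ i j, i + 1 ≠ j → c i j = 0) ∧
    ∀ i j l y, dif R j l (c i j y) + c j l (dif M i j y) + η.1 j l (θ.1 i j y) = 0

/-- Block triangular differentials on `R ⊕ N ⊕ M` whose diagonal blocks are the given
differentials. -/
abbrev TriTwist (M N R : ProjComplex m A) : Type v :=
  {t : twist M N × twist N R × (∀ i j, M.obj.X i →ₗ[A] R.obj.X j) // IsTriTwist t.1 t.2.1 t.2.2}

/-- Twisting cochains on `tsum θ`, with the terms of `tsum θ` written as products. -/
abbrev TwistFrom (θ : twist M N) (R : ProjComplex m A) : Type v :=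
  {η : ∀ i j, (N.obj.X i × M.obj.X i) →ₗ[A] R.obj.X j //
    (∀ i j, i + 1 ≠ j → η i j = 0) ∧ ∀ i j l (n : N.obj.X i) (y : M.obj.X i),
      dif R j l (η i j (n, y)) + η j l (dif N i j n + θ.1 i j y, dif M i j y) = 0}

/-- Twisting cochains into `tsum θ`, with the terms of `tsum θ` written as products. -/
abbrev TwistTo (M : ProjComplex m A) (θ : twist N R) : Type v :=
  {η : ∀ i j, M.obj.X i →ₗ[A] (R.obj.X j × N.obj.X j) //
    (∀ i j, i + 1 ≠ j → η i j = 0) ∧ ∀ i j l (y : M.obj.X i),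
      (dif R j l (η i j y).1 + θ.1 j l (η i j y).2, dif N j l (η i j y).2) +
        η j l (dif M i j y) = 0}

/-- The identification of `TwistFrom` with the twisting cochains on `tsum θ`. -/
def twistFromEquiv (θ : twist M N) (R : ProjComplex m A) : twist (tsum θ) R ≃ TwistFrom θ R where
  toFun η := ⟨η.1, η.2.1, fun i j l n y => η.2.2 i j l (n, y)⟩
  invFun η := ⟨η.1, η.2.1, fun i j l x => η.2.2 i j l x.1 x.2⟩
  left_inv _ := rfl
  right_inv _ := rfl

/-- The identification of `TwistTo` with the twisting cochains into `tsum θ`. -/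
def twistToEquiv (M : ProjComplex m A) (θ : twist N R) : twist M (tsum θ) ≃ TwistTo M θ where
  toFun η := ⟨η.1, η.2.1, fun i j l y => η.2.2 i j l y⟩
  invFun η := ⟨η.1, η.2.1, fun i j l y => η.2.2 i j l y⟩
  left_inv _ := rfl
  right_inv _ := rfl

/-- The differential of `tsum η` with `η : tsum θ → R[1]`, as a block triangular matrix. -/
def twistSigmaLeft (M N R : ProjComplex m A) :
    (Σ θ : twist M N, TwistFrom θ R) ≃ TriTwist M N R where
  toFun x := ⟨(x.1, ⟨fun i j => (x.2.1 i j).comp (LinearMap.inl A (N.obj.X i) (M.obj.X i)), by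
      obtain ⟨h₁, h₂⟩ := x.2.2
      refine ⟨fun i j h => ?_, fun i j l n => ?_⟩
      · dsimp only
        rw [h₁ i j h, LinearMap.zero_comp]
      · have := h₂ i j l n 0
        rw [map_zero, map_zero, add_zero] at this
        exact this⟩,
      fun i j => (x.2.1 i j).comp (LinearMap.inr A (N.obj.X i) (M.obj.X i))), by
      obtain ⟨h₁, h₂⟩ := x.2.2
      refine ⟨fun i j h => ?_, fun i j l y => ?_⟩
      · dsimp only
        rw [h₁ i j h, LinearMap.zero_comp]
      · have := h₂ i j l 0 y
        rw [map_zero, zero_add] at this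
        simp only [LinearMap.comp_apply, LinearMap.inr_apply, LinearMap.inl_apply]
        rw [← this, add_assoc, ← map_add, Prod.mk_add_mk, zero_add, add_zero]⟩
  invFun t := ⟨t.1.1, ⟨fun i j => LinearMap.coprod (t.1.2.1.1 i j) (t.1.2.2 i j), by
      obtain ⟨⟨θ, η, c⟩, h₁, h₂⟩ := t
      refine ⟨fun i j h => ?_, fun i j l n y => ?_⟩
      · dsimp only at h₁ ⊢
        rw [twist_shape η h, h₁ i j h, LinearMap.coprod_zero_left, LinearMap.zero_comp]
      · have h₃ := twist_cond η i j l n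
        have h₄ := h₂ i j l y
        dsimp only at h₄ ⊢
        simp only [LinearMap.coprod_apply, map_add]
        rw [← add_zero (0 : R.obj.X l)]
        nth_rewrite 1 [← h₃]
        rw [← h₄]
        abel⟩⟩
  left_inv x := by
    obtain ⟨θ, η⟩ := x
    refine Sigma.ext rfl (heq_of_eq (Subtype.ext ?_))
    funext i j
    exact LinearMap.coprod_comp_inl_inr _
  right_inv t := by
    obtain ⟨⟨θ, η, c⟩, h⟩ := t
    refine Subtype.ext (Prod.ext rfl (Prod.ext (Subtype.ext ?_) ?_))
    · funext i j
      exact LinearMap.coprod_inl _ _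
    · funext i j
      exact LinearMap.coprod_inr _ _

/-- The differential of `tsum η` with `η : M → (tsum θ)[1]`, as a block triangular matrix. -/
def twistSigmaRight (M N R : ProjComplex m A) :
    (Σ θ : twist N R, TwistTo M θ) ≃ TriTwist M N R where
  toFun x := ⟨(⟨fun i j => (LinearMap.snd A (R.obj.X j) (N.obj.X j)).comp (x.2.1 i j), by
      obtain ⟨h₁, h₂⟩ := x.2.2
      refine ⟨fun i j h => ?_, fun i j l y => congrArg Prod.snd (h₂ i j l y)⟩
      dsimp only
      rw [h₁ i j h, LinearMap.comp_zero]⟩, x.1,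
      fun i j => (LinearMap.fst A (R.obj.X j) (N.obj.X j)).comp (x.2.1 i j)), by
      obtain ⟨h₁, h₂⟩ := x.2.2
      refine ⟨fun i j h => ?_, fun i j l y => ?_⟩
      · dsimp only
        rw [h₁ i j h, LinearMap.comp_zero]
      · have h₃ : dif R j l (x.2.1 i j y).1 + x.1.1 j l (x.2.1 i j y).2 +
            (x.2.1 j l (dif M i j y)).1 = 0 := congrArg Prod.fst (h₂ i j l y)
        rw [add_right_comm] at h₃
        exact h₃⟩
  invFun t := ⟨t.1.2.1, ⟨fun i j => (t.1.2.2 i j).prod (t.1.1.1 i j), by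
      obtain ⟨⟨θ, η, c⟩, h₁, h₂⟩ := t
      refine ⟨fun i j h => ?_, fun i j l y => ?_⟩
      · dsimp only at h₁ ⊢
        rw [twist_shape θ h, h₁ i j h]
        rfl
      · have h₃ := twist_cond θ i j l y
        have h₄ := h₂ i j l y
        rw [add_right_comm] at h₄
        exact Prod.ext h₄ h₃⟩⟩
  left_inv x := rfl
  right_inv t := rfl

/-- The two bracketings of `R ⊕ N ⊕ M` with the same block triangular differential are
isomorphic. -/
theorem tsum_assoc (t : TriTwist M N R) :
    Nonempty (tsum ((twistFromEquiv _ _).symm ((twistSigmaLeft M N R).symm t).2) ≅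
      tsum ((twistToEquiv _ _).symm ((twistSigmaRight M N R).symm t).2)) := by
  obtain ⟨⟨θ, η, c⟩, h⟩ := t
  refine nonempty_iso_of_equiv
    (L := tsum ((twistFromEquiv _ _).symm ((twistSigmaLeft M N R).symm ⟨⟨θ, η, c⟩, h⟩).2))
    (L' := tsum ((twistToEquiv _ _).symm ((twistSigmaRight M N R).symm ⟨⟨θ, η, c⟩, h⟩).2))
    (fun i => (LinearEquiv.prodAssoc A (R.obj.X i) (N.obj.X i) (M.obj.X i)).symm)
    fun i j x _ => ?_
  obtain ⟨r, n, y⟩ := x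
  refine Prod.ext (Prod.ext ?_ rfl) rfl
  exact add_assoc _ _ _

end

section

variable (k : Type u) [Field k] [Finite k] {m : ℕ} {A : Type v} [Ring A] [Algebra k A]
  [Module.Finite k A] [IsHereditaryRing A]

theorem complexEuler_zero_left (M : ProjComplex m A) :
    complexEuler k m (zeroComplex m A) M = 0 := by
  rw [complexEuler_eq_sum k _ _ ∅ fun i _ => Or.inl (tcl_zeroComplex i), Finset.sum_empty]

theorem complexEuler_zero_right (M : ProjComplex m A) :
    complexEuler k m M (zeroComplex m A) = 0 := by
  rw [complexEuler_eq_sum k _ _ ∅ fun i _ => Or.inr (tcl_zeroComplex i), Finset.sum_empty]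

variable [Finite A]

theorem hcl_mul_hcl (M N : ProjComplex m A) :
    hcl k M * hcl k N = vv k ^ (-complexEuler k m M N) • ∑ θ : twist M N, hcl k (tsum θ) :=
  hallMul_basisElt k M N

/-- Both products are the same power of `v` times the sum over all block triangular differentials on
`R ⊕ N ⊕ M`. -/
theorem hcl_mul_assoc (M N R : ProjComplex m A) :
    hcl k M * hcl k N * hcl k R = hcl k M * (hcl k N * hcl k R) := by
  have hv := vv_ne_zero k
  rw [hcl_mul_hcl k M N, hcl_mul_hcl k N R, HallRing.smul_mul', HallRing.mul_smul',
    HallRing.sum_mul', HallRing.mul_sum']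
  have h₁ : ∀ θ : twist M N, hcl k (tsum θ) * hcl k R =
      vv k ^ (-(complexEuler k m N R + complexEuler k m M R)) •
        ∑ η : twist (tsum θ) R, hcl k (tsum η) := fun θ => by
    rw [hcl_mul_hcl, complexEuler_tsum_left]
  have h₂ : ∀ θ : twist N R, hcl k M * hcl k (tsum θ) =
      vv k ^ (-(complexEuler k m M R + complexEuler k m M N)) •
        ∑ η : twist M (tsum θ), hcl k (tsum η) := fun θ => by
    rw [hcl_mul_hcl, complexEuler_tsum_right]
  simp only [h₁, h₂]
  rw [← Finset.smul_sum, ← Finset.smul_sum, smul_smul, smul_smul, ← zpow_add₀ hv, ← zpow_add₀ hv]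
  congr 1
  · congr 1
    ring
  · have : Finite (TriTwist M N R) := Finite.of_equiv _
      ((Equiv.sigmaCongrRight fun θ => twistFromEquiv θ R).trans (twistSigmaLeft M N R))
    have : Fintype (TriTwist M N R) := Fintype.ofFinite _
    rw [Finset.sum_sigma', Finset.sum_sigma']
    trans ∑ t : TriTwist M N R,
        hcl k (tsum ((twistFromEquiv _ _).symm ((twistSigmaLeft M N R).symm t).2))
    · symm
      exact Fintype.sum_equiv ((twistSigmaLeft M N R).symm.trans
        (Equiv.sigmaCongrRight fun θ => (twistFromEquiv θ R).symm)) _ _ fun t => rfl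
    · rw [Finset.sum_congr rfl fun t _ => hcl_congr k (tsum_assoc t)]
      exact Fintype.sum_equiv ((twistSigmaRight M N R).symm.trans
        (Equiv.sigmaCongrRight fun θ => (twistToEquiv M θ).symm)) _ _ fun t => rfl

theorem HallRing.mul_assoc' (x y z : HallRing k m A) : x * y * z = x * (y * z) := by
  induction x using HallRing.induction with
  | h0 => simp only [HallRing.zero_mul']
  | hadd x x' h h' => simp only [HallRing.add_mul', h, h']
  | hbasis c M =>
    induction y using HallRing.induction with
    | h0 => simp only [HallRing.zero_mul', HallRing.mul_zero']
    | hadd x x' h h' => simp only [HallRing.add_mul', HallRing.mul_add', h, h']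
    | hbasis c' N =>
      induction z using HallRing.induction with
      | h0 => simp only [HallRing.mul_zero']
      | hadd x x' h h' => simp only [HallRing.mul_add', h, h']
      | hbasis c'' R =>
        simp only [HallRing.smul_mul', HallRing.mul_smul', hcl_mul_assoc]

theorem one_mul_hcl (M : ProjComplex m A) : 1 * hcl k M = hcl k M := by
  have : Unique (twist (zeroComplex m A) M) :=
    { default := 0
      uniq := fun θ => by
        ext i j x
        rw [Subsingleton.elim x 0, map_zero, map_zero] }
  change hcl k (zeroComplex m A) * hcl k M = _
  rw [hcl_mul_hcl, complexEuler_zero_left, Fintype.sum_unique, neg_zero, zpow_zero, one_smul]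
  refine hcl_congr k (nonempty_iso_of_equiv (L := tsum (default : twist (zeroComplex m A) M))
    (fun i => LinearEquiv.ofBijective (LinearMap.fst A (M.obj.X i) ((zeroComplex m A).obj.X i))
      ⟨fun x y h => Prod.ext h (Subsingleton.elim _ _), fun x => ⟨(x, 0), rfl⟩⟩) fun i j x _ => ?_)
  change dif M i j x.1 = dif M i j x.1 + (default : twist (zeroComplex m A) M).1 i j x.2
  rw [Subsingleton.elim x.2 0, map_zero, add_zero]

theorem hcl_mul_one (M : ProjComplex m A) : hcl k M * 1 = hcl k M := by
  have : Unique (twist M (zeroComplex m A)) :=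
    { default := 0
      uniq := fun θ => by
        ext i j x
        exact Subsingleton.elim _ _ }
  change hcl k M * hcl k (zeroComplex m A) = _
  rw [hcl_mul_hcl, complexEuler_zero_right, Fintype.sum_unique, neg_zero, zpow_zero, one_smul]
  exact hcl_congr k (nonempty_iso_of_equiv (L := tsum (default : twist M (zeroComplex m A)))
    (fun i => LinearEquiv.ofBijective (LinearMap.snd A ((zeroComplex m A).obj.X i) (M.obj.X i))
      ⟨fun x y h => Prod.ext (Subsingleton.elim _ _) h, fun x => ⟨(0, x), rfl⟩⟩) fun i j x _ => rfl)

noncomputable instance : Ring (HallRing k m A) :=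
  { (inferInstance : AddCommGroup (HallRing k m A)),
    (inferInstance : Mul (HallRing k m A)),
    (inferInstance : One (HallRing k m A)) with
    left_distrib := HallRing.mul_add' k
    right_distrib := HallRing.add_mul' k
    zero_mul := HallRing.zero_mul' k
    mul_zero := HallRing.mul_zero' k
    mul_assoc := HallRing.mul_assoc' k
    one_mul := fun x => by
      induction x using HallRing.induction with
      | h0 => simp only [HallRing.mul_zero']
      | hadd x x' h h' => rw [HallRing.mul_add', h, h']
      | hbasis c M => rw [HallRing.mul_smul', one_mul_hcl]
    mul_one := fun x => by
      induction x using HallRing.induction with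
      | h0 => simp only [HallRing.zero_mul']
      | hadd x x' h h' => rw [HallRing.add_mul', h, h']
      | hbasis c M => rw [HallRing.smul_mul', hcl_mul_one] }

noncomputable instance : Algebra ℂ (HallRing k m A) :=
  Algebra.ofModule (fun c x y => HallRing.smul_mul' k c x y)
    (fun c x y => HallRing.mul_smul' k c x y)

end

/-! ### Acyclic complexes -/

section

variable {m : ℕ} {A : Type v} [Ring A] {M N K : ProjComplex m A}

theorem acyclic_iff : M.obj.Acyclic ↔ ∀ i j l, i + 1 = j → j + 1 = l → ∀ x, dif M j l x = 0 →
    ∃ y, dif M i j y = x := by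
  have h : ∀ i j l : ZMod m, i + 1 = j → j + 1 = l →
      (M.obj.ExactAt j ↔ ∀ x, dif M j l x = 0 → ∃ y, dif M i j y = x) := fun i j l hi hj => by
    rw [HomologicalComplex.exactAt_iff' _ i j l (ComplexShape.prev_eq' _ hi)
      (ComplexShape.next_eq' _ hj), ShortComplex.moduleCat_exact_iff]
    rfl
  refine ⟨fun hM i j l hi hj => (h i j l hi hj).1 (hM j), fun hM j => ?_⟩
  exact (h (j - 1) j (j + 1) (by simp) rfl).2 (hM _ _ _ (by simp) rfl)

theorem acyclic_zeroComplex : (zeroComplex m A).obj.Acyclic :=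
  acyclic_iff.2 fun _ _ _ _ _ _ _ => ⟨0, Subsingleton.elim _ _⟩

theorem acyclic_dsum (hM : M.obj.Acyclic) (hN : N.obj.Acyclic) : (dsum M N).obj.Acyclic := by
  rw [acyclic_iff] at *
  intro i j l hi hj x hx
  rw [dif_dsum] at hx
  obtain ⟨y₁, h₁⟩ := hN i j l hi hj x.1 (congrArg Prod.fst hx)
  obtain ⟨y₂, h₂⟩ := hM i j l hi hj x.2 (congrArg Prod.snd hx)
  refine ⟨(y₁, y₂), ?_⟩
  rw [dif_dsum, h₁, h₂]

/-- Over a hereditary ring an acyclic complex of projectives is contractible. The contraction `h` is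
indexed by two degrees, and only the values `h i j` with `j + 1 = i` matter. -/
theorem exists_contraction [IsHereditaryRing A] (hK : K.obj.Acyclic) :
    ∃ h : ∀ i j, K.obj.X i →ₗ[A] K.obj.X j, ∀ i j l x, j + 1 = i → i + 1 = l →
      dif K j i (h i j x) + h l i (dif K i l x) = x := by
  rw [acyclic_iff] at hK
  have hσ : ∀ i j, ∃ σ : LinearMap.ker (dif K i (i + 1)) →ₗ[A] K.obj.X j, j + 1 = i →
      ∀ z, dif K j i (σ z) = z.1 := by
    intro i j
    by_cases hij : j + 1 = i
    · have := projective_submodule (LinearMap.ker (dif K i (i + 1)))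
      let p : K.obj.X j →ₗ[A] LinearMap.ker (dif K i (i + 1)) :=
        (dif K j i).codRestrict _ fun x => dif_dif K j i (i + 1) x
      have hp : Function.Surjective p := fun z => by
        obtain ⟨y, hy⟩ := hK j i (i + 1) hij rfl z.1 z.2
        exact ⟨y, Subtype.ext hy⟩
      obtain ⟨σ, h⟩ := Module.projective_lifting_property p LinearMap.id hp
      exact ⟨σ, fun _ z => congrArg Subtype.val (LinearMap.congr_fun h z)⟩
    · exact ⟨0, fun h => absurd h hij⟩
  choose σ hσ using hσ
  let π : ∀ i, K.obj.X i →ₗ[A] LinearMap.ker (dif K i (i + 1)) := fun i =>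
    (LinearMap.id - (σ (i + 1) i).comp
      ((dif K i (i + 1)).codRestrict _ fun x => dif_dif K i (i + 1) (i + 1 + 1) x)).codRestrict _
      fun x => by
        simp only [LinearMap.mem_ker, LinearMap.sub_apply, map_sub, LinearMap.comp_apply, hσ,
          LinearMap.id_apply]
        exact sub_self _
  have hπ : ∀ i x, (π i x : K.obj.X i) = x - σ (i + 1) i ⟨dif K i (i + 1) x, dif_dif K _ _ _ x⟩ :=
    fun i x => rfl
  refine ⟨fun i j => (σ i j).comp (π i), fun i j l x hj hl => ?_⟩
  subst hl
  have h : π (i + 1) (dif K i (i + 1) x) = ⟨dif K i (i + 1) x, dif_dif K _ _ _ x⟩ := by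
    apply Subtype.ext
    rw [hπ, sub_eq_self]
    have : (⟨dif K (i + 1) (i + 1 + 1) (dif K i (i + 1) x), dif_dif K _ _ _ _⟩ :
      LinearMap.ker (dif K (i + 1 + 1) (i + 1 + 1 + 1))) = 0 := Subtype.ext (dif_dif K _ _ _ _)
    rw [this, map_zero]
  rw [LinearMap.comp_apply, LinearMap.comp_apply, hσ i j hj, h, hπ, sub_add_cancel]

/-- With a contraction `h` of `K`, the cochain `θ` is the coboundary of `-θ h`. -/
theorem twist_acyclic_left [IsHereditaryRing A] (hK : K.obj.Acyclic) (θ : twist K M) :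
    θ ∈ (coboundary K M).range := by
  obtain ⟨h, hh⟩ := exists_contraction hK
  refine ⟨fun i => -(θ.1 (i - 1) i).comp (h i (i - 1)), ?_⟩
  ext i l x
  by_cases hl : i + 1 = l
  · obtain rfl : i = l - 1 := eq_sub_of_add_eq hl
    have h₁ := hh (l - 1) (l - 1 - 1) l x (by simp) (by simp)
    have h₂ := twist_cond θ (l - 1 - 1) (l - 1) l (h (l - 1) (l - 1 - 1) x)
    rw [coboundary_apply]
    simp only [LinearMap.neg_apply, LinearMap.comp_apply, map_neg]
    nth_rewrite 3 [← h₁]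
    rw [eq_neg_of_add_eq_zero_left h₂, map_add]
    abel
  · rw [twist_shape _ hl, twist_shape _ hl]

/-- With a contraction `h` of `K`, the cochain `θ` is the coboundary of `h θ`. -/
theorem twist_acyclic_right [IsHereditaryRing A] (hK : K.obj.Acyclic) (θ : twist M K) :
    θ ∈ (coboundary M K).range := by
  obtain ⟨h, hh⟩ := exists_contraction hK
  refine ⟨fun i => (h (i + 1) i).comp (θ.1 i (i + 1)), ?_⟩
  ext i l x
  by_cases hl : i + 1 = l
  · subst hl
    have h₁ := hh (i + 1) i (i + 1 + 1) (θ.1 i (i + 1) x) rfl rfl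
    have h₂ := twist_cond θ i (i + 1) (i + 1 + 1) x
    rw [coboundary_apply]
    simp only [LinearMap.comp_apply]
    rw [eq_neg_of_add_eq_zero_right h₂, map_neg, sub_neg_eq_add, h₁]
  · rw [twist_shape _ hl, twist_shape _ hl]

theorem tsum_iso_dsum {θ : twist M N} (h : θ ∈ (coboundary M N).range) :
    Nonempty (tsum θ ≅ dsum M N) := by
  obtain ⟨φ, -, -⟩ := (tsumExt_equiv_iff θ 0).2 (by simpa using h)
  exact nonempty_iso_obj_iff.1 ⟨φ⟩

theorem dsum_comm (M N : ProjComplex m A) : Nonempty (dsum M N ≅ dsum N M) := by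
  refine nonempty_iso_of_equiv (L := dsum M N) (L' := dsum N M)
    (fun i => LinearEquiv.prodComm A (N.obj.X i) (M.obj.X i)) fun i j x _ => ?_
  rw [dif_dsum]
  exact (congrArg Prod.swap (dif_dsum (M := M) (N := N) i j x)).symm

theorem card_twist_dsum_right (K M N : ProjComplex m A) :
    Nat.card (twist K (dsum M N)) = Nat.card (twist K M) * Nat.card (twist K N) := by
  rw [Nat.card_congr (twistToEquiv K (0 : twist M N)), ← Nat.card_prod]
  refine Nat.card_congr
    ⟨fun η => (⟨fun i j => (LinearMap.snd A _ _).comp (η.1 i j), ?_⟩,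
      ⟨fun i j => (LinearMap.fst A _ _).comp (η.1 i j), ?_⟩),
    fun η => ⟨fun i j => (η.2.1 i j).prod (η.1.1 i j), ?_⟩, fun η => rfl, fun η => rfl⟩
  · refine ⟨fun i j h => ?_, fun i j l y => congrArg Prod.snd (η.2.2 i j l y)⟩
    dsimp only
    rw [η.2.1 i j h, LinearMap.comp_zero]
  · refine ⟨fun i j h => ?_, fun i j l y => ?_⟩
    · dsimp only
      rw [η.2.1 i j h, LinearMap.comp_zero]
    · have h : dif N j l (η.1 i j y).1 + (0 : twist M N).1 j l (η.1 i j y).2 +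
        (η.1 j l (dif K i j y)).1 = 0 := congrArg Prod.fst (η.2.2 i j l y)
      have h0 : (0 : twist M N).1 j l (η.1 i j y).2 = 0 := rfl
      rw [h0, add_zero] at h
      exact h
  · refine ⟨fun i j h => ?_, fun i j l y => ?_⟩
    · dsimp only
      rw [twist_shape η.1 h, twist_shape η.2 h]
      rfl
    · have h₁ := twist_cond η.1 i j l y
      have h₂ := twist_cond η.2 i j l y
      refine Prod.ext ?_ h₁
      change dif N j l (η.2.1 i j y) + (0 : twist M N).1 j l (η.1.1 i j y) +
        η.2.1 j l (dif K i j y) = 0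
      rw [AddSubgroup.coe_zero, Pi.zero_apply, Pi.zero_apply, LinearMap.zero_apply, add_zero, h₂]

theorem card_twist_dsum_left (K M N : ProjComplex m A) :
    Nat.card (twist (dsum M N) K) = Nat.card (twist M K) * Nat.card (twist N K) := by
  rw [Nat.card_congr (twistFromEquiv (0 : twist M N) K), mul_comm, ← Nat.card_prod]
  have h0 : ∀ i j x, (0 : twist M N).1 i j x = 0 := fun _ _ _ => rfl
  simp only [TwistFrom, h0, add_zero]
  refine Nat.card_congr
    ⟨fun η => (⟨fun i j => (η.1 i j).comp (LinearMap.inl A _ _), ?_⟩,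
      ⟨fun i j => (η.1 i j).comp (LinearMap.inr A _ _), ?_⟩),
    fun η => ⟨fun i j => (η.1.1 i j).coprod (η.2.1 i j), ?_⟩, fun η => ?_, fun η => ?_⟩
  · refine ⟨fun i j h => ?_, fun i j l n => ?_⟩
    · dsimp only
      rw [η.2.1 i j h, LinearMap.zero_comp]
    · have h := η.2.2 i j l n 0
      rw [map_zero] at h
      exact h
  · refine ⟨fun i j h => ?_, fun i j l n => ?_⟩
    · dsimp only
      rw [η.2.1 i j h, LinearMap.zero_comp]
    · have h := η.2.2 i j l 0 n
      rw [map_zero] at h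
      exact h
  · refine ⟨fun i j h => ?_, fun i j l n y => ?_⟩
    · dsimp only
      rw [twist_shape η.1 h, twist_shape η.2 h, LinearMap.coprod_zero_left, LinearMap.zero_comp]
    · have h₁ := twist_cond η.1 i j l n
      have h₂ := twist_cond η.2 i j l y
      simp only [LinearMap.coprod_apply, map_add]
      rw [add_add_add_comm, h₁, h₂, add_zero]
  · refine Subtype.ext ?_
    funext i j
    exact LinearMap.coprod_comp_inl_inr _
  · refine Prod.ext (Subtype.ext ?_) (Subtype.ext ?_)
    · funext i j
      exact LinearMap.coprod_inl _ _
    · funext i j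
      exact LinearMap.coprod_inr _ _

theorem card_twist_congr {M' N' : ProjComplex m A} (hM : Nonempty (M ≅ M'))
    (hN : Nonempty (N ≅ N')) : Nat.card (twist M N) = Nat.card (twist M' N') := by
  obtain ⟨φ⟩ := hM
  obtain ⟨ψ⟩ := hN
  obtain ⟨a, ha⟩ := exists_equiv_of_iso φ
  obtain ⟨b, hb⟩ := exists_equiv_of_iso ψ
  exact Nat.card_congr (twistCongr a ha b hb)

end

/-! ### Localization at the acyclic complexes -/

section

variable (k : Type u) [Field k] [Finite k] {m : ℕ} {A : Type v} [Ring A] [Algebra k A]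

/-- The scalar with `[M] * [N] = splitCoeff M N • [M ⊕ N]` if all extensions of `M` by `N` split. -/
noncomputable def splitCoeff (M N : ProjComplex m A) : ℂ :=
  vv k ^ (-complexEuler k m M N) * Nat.card (twist M N)

theorem splitCoeff_ne_zero [Finite A] (M N : ProjComplex m A) : splitCoeff k M N ≠ 0 :=
  mul_ne_zero (zpow_ne_zero _ (vv_ne_zero k)) (Nat.cast_ne_zero.2 Nat.card_pos.ne')

variable [Module.Finite k A] [IsHereditaryRing A]

theorem splitCoeff_congr {M M' N N' : ProjComplex m A} (hM : Nonempty (M ≅ M'))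
    (hN : Nonempty (N ≅ N')) : splitCoeff k M N = splitCoeff k M' N' := by
  rw [splitCoeff, splitCoeff, complexEuler_congr k hM hN, card_twist_congr hM hN]

theorem splitCoeff_dsum_right (K M N : ProjComplex m A) :
    splitCoeff k K (dsum M N) = splitCoeff k K M * splitCoeff k K N := by
  rw [splitCoeff, complexEuler_tsum_right, card_twist_dsum_right, neg_add,
    zpow_add₀ (vv_ne_zero k), splitCoeff, splitCoeff]
  push_cast
  ring

theorem splitCoeff_dsum_left (K M N : ProjComplex m A) :
    splitCoeff k (dsum M N) K = splitCoeff k M K * splitCoeff k N K := by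
  rw [splitCoeff, complexEuler_tsum_left, card_twist_dsum_left, neg_add,
    zpow_add₀ (vv_ne_zero k), splitCoeff, splitCoeff]
  push_cast
  ring

/-- The scalar by which `[K]`, with `K` acyclic, commutes with `[M]`. -/
noncomputable def commCoeff (K M : ProjComplex m A) : ℂ := splitCoeff k K M / splitCoeff k M K

/-- The linear map scaling each class `[M]` by `commCoeff K M`. -/
noncomputable def basisScale (K : ProjComplex m A) : TwistedHall m A →ₗ[ℂ] TwistedHall m A :=
  Finsupp.linearCombination ℂ fun L : ComplexClass m A => commCoeff k K L.out • basisElt L.out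

theorem basisScale_basisElt (K M : ProjComplex m A) :
    basisScale k K (basisElt M) = commCoeff k K M • basisElt M := by
  have hM : Nonempty ((Quotient.mk _ M : ComplexClass m A).out ≅ M) :=
    Quotient.mk_out (s := isIsomorphicSetoid (ProjComplex m A)) M
  have hK : Nonempty (K ≅ K) := ⟨Iso.refl K⟩
  rw [basisScale, basisElt, Finsupp.linearCombination_single, one_smul, commCoeff, commCoeff,
    splitCoeff_congr k hK hM, splitCoeff_congr k hM hK, basisElt_congr hM, basisElt]

variable [Finite A]

theorem hcl_mul_of_split {M N : ProjComplex m A}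
    (h : ∀ θ : twist M N, θ ∈ (coboundary M N).range) :
    hcl k M * hcl k N = splitCoeff k M N • hcl k (dsum M N) := by
  rw [hcl_mul_hcl, Finset.sum_congr rfl fun θ _ => hcl_congr k (tsum_iso_dsum (h θ)),
    Finset.sum_const, Finset.card_univ, ← Nat.card_eq_fintype_card, ← Nat.cast_smul_eq_nsmul ℂ,
    smul_smul, splitCoeff]

theorem hcl_acyclic_mul {K : ProjComplex m A} (hK : K.obj.Acyclic) (M : ProjComplex m A) :
    hcl k K * hcl k M = splitCoeff k K M • hcl k (dsum M K) := by
  rw [hcl_mul_of_split k (twist_acyclic_left hK), hcl_congr k (dsum_comm K M)]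

theorem hcl_mul_acyclic {K : ProjComplex m A} (hK : K.obj.Acyclic) (M : ProjComplex m A) :
    hcl k M * hcl k K = splitCoeff k M K • hcl k (dsum M K) :=
  hcl_mul_of_split k (twist_acyclic_right hK)

/-- `basisScale` on the ring `HallRing`. -/
noncomputable def commScale (K : ProjComplex m A) : HallRing k m A →ₗ[ℂ] HallRing k m A :=
  basisScale k K

theorem commScale_hcl (K M : ProjComplex m A) :
    commScale k K (hcl k M) = commCoeff k K M • hcl k M :=
  basisScale_basisElt k K M

/-- The class of an acyclic complex is a normal element of the twisted Hall algebra. -/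
theorem acyclic_mul_eq {K : ProjComplex m A} (hK : K.obj.Acyclic) (x : HallRing k m A) :
    hcl k K * x = commScale k K x * hcl k K := by
  induction x using HallRing.induction with
  | h0 => rw [map_zero, mul_zero, zero_mul]
  | hadd x y hx hy => rw [map_add, mul_add, add_mul, hx, hy]
  | hbasis c M =>
    rw [map_smul, commScale_hcl, mul_smul_comm, smul_mul_assoc, smul_mul_assoc,
      hcl_acyclic_mul k hK, hcl_mul_acyclic k hK, smul_smul (commCoeff k K M), commCoeff,
      div_mul_cancel₀ _ (splitCoeff_ne_zero k M K)]

/-- Applying `commScale K` moves `[K]` from the right to the left. -/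
theorem commScale_mul_acyclic {K : ProjComplex m A} (hK : K.obj.Acyclic) (x : HallRing k m A) :
    commScale k K (x * hcl k K) = commCoeff k K K • (hcl k K * x) := by
  induction x using HallRing.induction with
  | h0 => simp only [zero_mul, map_zero, mul_zero, smul_zero]
  | hadd x y hx hy => rw [add_mul, map_add, hx, hy, mul_add, smul_add]
  | hbasis c M =>
    have h := splitCoeff_ne_zero k M K
    have h' := splitCoeff_ne_zero k K K
    rw [smul_mul_assoc, map_smul, mul_smul_comm, hcl_mul_acyclic k hK, hcl_acyclic_mul k hK,
      map_smul, commScale_hcl, smul_smul, smul_smul, smul_smul, smul_smul, commCoeff, commCoeff,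
      splitCoeff_dsum_right, splitCoeff_dsum_left]
    congr 1
    field_simp

variable (m A) in
/-- The nonzero multiples of classes of acyclic complexes. -/
noncomputable def acyclicSubmonoid : Submonoid (HallRing k m A) where
  carrier := {x | ∃ (c : ℂ) (K : ProjComplex m A), c ≠ 0 ∧ K.obj.Acyclic ∧ x = c • hcl k K}
  one_mem' := ⟨1, zeroComplex m A, one_ne_zero, acyclic_zeroComplex, (one_smul _ _).symm⟩
  mul_mem' := by
    rintro _ _ ⟨c, K, hc, hK, rfl⟩ ⟨c', K', hc', hK', rfl⟩
    refine ⟨c * (c' * splitCoeff k K K'), dsum K' K,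
      mul_ne_zero hc (mul_ne_zero hc' (splitCoeff_ne_zero k K K')), acyclic_dsum hK' hK, ?_⟩
    rw [smul_mul_assoc, mul_smul_comm, hcl_acyclic_mul k hK, smul_smul, smul_smul,
      mul_assoc]

theorem exists_ore (r : HallRing k m A) (s : acyclicSubmonoid k m A) :
    ∃ r' : HallRing k m A, (s : HallRing k m A) * r = r' * s := by
  obtain ⟨_, c, K, hc, hK, rfl⟩ := s
  exact ⟨commScale k K r, by
    dsimp only
    rw [smul_mul_assoc, mul_smul_comm, acyclic_mul_eq k hK]⟩

noncomputable instance : OreLocalization.OreSet (acyclicSubmonoid k m A) where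
  ore_right_cancel := by
    rintro r₁ r₂ ⟨_, c, K, hc, hK, rfl⟩ h
    refine ⟨⟨_, c, K, hc, hK, rfl⟩, ?_⟩
    dsimp only at h ⊢
    rw [mul_smul_comm, mul_smul_comm] at h
    have h' := smul_right_injective _ hc h
    -- Applying `commScale K` to `r₁ * [K] = r₂ * [K]` gives `[K] * r₁ = [K] * r₂`.
    have h'' := congrArg (commScale k K) h'
    rw [commScale_mul_acyclic k hK, commScale_mul_acyclic k hK] at h''
    rw [smul_mul_assoc, smul_mul_assoc, smul_right_injective _ (div_ne_zero
      (splitCoeff_ne_zero k K K) (splitCoeff_ne_zero k K K)) h'']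
  oreNum r s := (exists_ore k r s).choose
  oreDenom _ s := s
  ore_eq r s := (exists_ore k r s).choose_spec

variable (m A) in
/-- The Ore localization of the twisted Hall algebra at the classes of acyclic complexes. -/
abbrev OreDH : Type (v + 1) := OreLocalization (acyclicSubmonoid k m A) (HallRing k m A)

/-- The canonical map from the twisted Hall algebra to its Ore localization. -/
noncomputable def toOre : HallRing k m A →+* OreDH k m A := OreLocalization.numeratorRingHom

theorem toOre_smul (c : ℂ) (x : HallRing k m A) : toOre k (c • x) = c • toOre k x := by
  rw [Algebra.smul_def, map_mul, Algebra.smul_def]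
  rfl

/-- The class of an acyclic complex, as an element of the multiplicative set. -/
noncomputable def acyclicElt (K : AcyclicComplex m A) : acyclicSubmonoid k m A :=
  ⟨hcl k K.1, 1, K.1, one_ne_zero, K.2, (one_smul _ _).symm⟩

variable (m A) in
/-- The homomorphism from `DH_m(A)`, given by generators and relations, to the Ore localization. -/
noncomputable def dhToOre : DH k m A →ₐ[ℂ] OreDH k m A :=
  RingQuot.liftAlgHom ℂ ⟨FreeAlgebra.lift ℂ (Sum.elim (fun x : TwistedHall m A => toOre k x)
    fun K => ((OreLocalization.numeratorUnit (acyclicElt k K))⁻¹ : Units _).val), by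
      intro x y h
      cases h with
      | add x y =>
        simp only [map_add, FreeAlgebra.lift_ι_apply, Sum.elim_inl]
        exact map_add (toOre k) x y
      | smul c x =>
        simp only [map_smul, FreeAlgebra.lift_ι_apply, Sum.elim_inl]
        exact toOre_smul k c x
      | mul x y =>
        simp only [map_mul, FreeAlgebra.lift_ι_apply, Sum.elim_inl]
        exact (toOre k).map_mul x y
      | one =>
        simp only [FreeAlgebra.lift_ι_apply, Sum.elim_inl, map_one]
        exact map_one (toOre k)
      | mul_inv K =>
        simp only [map_mul, FreeAlgebra.lift_ι_apply, Sum.elim_inl, Sum.elim_inr, map_one]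
        exact Units.mul_inv (OreLocalization.numeratorUnit (acyclicElt k K))
      | inv_mul K =>
        simp only [map_mul, FreeAlgebra.lift_ι_apply, Sum.elim_inl, Sum.elim_inr, map_one]
        exact Units.inv_mul (OreLocalization.numeratorUnit (acyclicElt k K))⟩

theorem dhToOre_of (x : TwistedHall m A) : dhToOre k m A (DH.of k m x) = toOre k x := by
  rw [dhToOre, DH.of, RingQuot.liftAlgHom_mkAlgHom_apply, FreeAlgebra.lift_ι_apply, Sum.elim_inl]

/-- An element of the twisted Hall algebra vanishing in `DH_m(A)` is killed by an acyclic
complex. -/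
theorem exists_acyclic_mul_eq_zero {x : HallRing k m A} (h : DH.of k m x = 0) :
    ∃ K : ProjComplex m A, K.obj.Acyclic ∧ hcl k K * x = 0 := by
  have h₁ : toOre k x = toOre k 0 :=
    (dhToOre_of k x).symm.trans (by rw [h, map_zero, map_zero])
  obtain ⟨⟨_, c, K, hc, hK, rfl⟩, v, h₂, h₃⟩ := OreLocalization.oreDiv_eq_iff.1 h₁
  refine ⟨K, hK, ?_⟩
  rw [Submonoid.smul_def, smul_zero] at h₂
  rw [OneMemClass.coe_one, mul_one, mul_one] at h₃
  rw [← h₃, smul_eq_mul, smul_mul_assoc] at h₂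
  exact (smul_eq_zero.1 h₂.symm).resolve_left hc

end

/-! ### Projective resolutions of length one -/

section

variable {A : Type v} [Ring A]

/-- `0 → Ω → P → M → 0` is exact. -/
structure IsRes {Ω P M : Type*} [AddCommGroup Ω] [AddCommGroup P] [AddCommGroup M] [Module A Ω]
    [Module A P] [Module A M] (δ : Ω →ₗ[A] P) (ε : P →ₗ[A] M) : Prop where
  injective : Function.Injective δ
  exact : Function.Exact δ ε
  surjective : Function.Surjective ε

/-- An isomorphism of the targets of two injective maps that matches their ranges lifts to the
sources. -/
theorem exists_equiv_of_range {X Y X' Y' : Type*} [AddCommGroup X] [AddCommGroup Y]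
    [AddCommGroup X'] [AddCommGroup Y'] [Module A X] [Module A Y] [Module A X'] [Module A Y']
    (f : X →ₗ[A] Y) (f' : X' →ₗ[A] Y') (hf : Function.Injective f) (hf' : Function.Injective f')
    (β : Y ≃ₗ[A] Y') (h : ∀ y, y ∈ LinearMap.range f ↔ β y ∈ LinearMap.range f') :
    ∃ α : X ≃ₗ[A] X', ∀ x, f' (α x) = β (f x) := by
  have h' : (LinearMap.range f).map β.toLinearMap = LinearMap.range f' := by
    ext y
    obtain ⟨y, rfl⟩ := β.surjective y
    rw [← h]
    simp
  let α : X ≃ₗ[A] X' := (LinearEquiv.ofInjective f hf).trans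
    ((β.submoduleMap (LinearMap.range f)).trans
      ((LinearEquiv.ofEq _ _ h').trans (LinearEquiv.ofInjective f' hf').symm))
  refine ⟨α, fun x => ?_⟩
  have : LinearEquiv.ofInjective f' hf' (α x) =
      LinearEquiv.ofEq _ _ h' (β.submoduleMap (LinearMap.range f)
        (LinearEquiv.ofInjective f hf x)) := by simp [α]
  exact congrArg Subtype.val this

/-- Schanuel's lemma, as an isomorphism of two-term complexes. -/
theorem schanuel {Ω P Ω' P' M : Type*} [AddCommGroup Ω] [AddCommGroup P] [AddCommGroup Ω']
    [AddCommGroup P'] [AddCommGroup M] [Module A Ω] [Module A P] [Module A Ω'] [Module A P']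
    [Module A M] [Module.Projective A P] [Module.Projective A P'] {δ : Ω →ₗ[A] P}
    {ε : P →ₗ[A] M} {δ' : Ω' →ₗ[A] P'} {ε' : P' →ₗ[A] M} (h : IsRes δ ε) (h' : IsRes δ' ε') :
    ∃ (α : (Ω × P') ≃ₗ[A] (Ω' × P)) (β : (P × P') ≃ₗ[A] (P' × P)),
      ∀ x, (δ'.prodMap LinearMap.id) (α x) = β ((δ.prodMap LinearMap.id) x) := by
  obtain ⟨s, hs⟩ := Module.projective_lifting_property ε' ε h'.surjective
  obtain ⟨t, ht⟩ := Module.projective_lifting_property ε ε' h.surjective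
  have hs' : ∀ x, ε' (s x) = ε x := fun x => LinearMap.congr_fun hs x
  have ht' : ∀ x, ε (t x) = ε' x := fun x => LinearMap.congr_fun ht x
  let β : (P × P') ≃ₗ[A] (P' × P) :=
    { toFun := fun x => (x.2 + s (x.1 - t x.2), x.1 - t x.2)
      invFun := fun y => (y.2 + t (y.1 - s y.2), y.1 - s y.2)
      map_add' := fun x y => by
        ext <;> simp only [Prod.fst_add, Prod.snd_add, map_add, map_sub] <;> abel
      map_smul' := fun a x => by
        ext <;> simp [smul_sub]
      left_inv := fun x => by simp
      right_inv := fun x => by simp }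
  have hβ : ∀ x, β x = (x.2 + s (x.1 - t x.2), x.1 - t x.2) := fun x => rfl
  have hr : ∀ y : P × P', y ∈ LinearMap.range (δ.prodMap (LinearMap.id : P' →ₗ[A] P')) ↔
      ε y.1 = 0 := fun y => by
    rw [h.exact y.1]
    constructor
    · rintro ⟨x, rfl⟩
      exact ⟨x.1, rfl⟩
    · rintro ⟨w, hw⟩
      exact ⟨(w, y.2), Prod.ext hw rfl⟩
  have hr' : ∀ y : P' × P, y ∈ LinearMap.range (δ'.prodMap (LinearMap.id : P →ₗ[A] P)) ↔
      ε' y.1 = 0 := fun y => by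
    rw [h'.exact y.1]
    constructor
    · rintro ⟨x, rfl⟩
      exact ⟨x.1, rfl⟩
    · rintro ⟨w, hw⟩
      exact ⟨(w, y.2), Prod.ext hw rfl⟩
  obtain ⟨α, hα⟩ := exists_equiv_of_range (δ.prodMap (LinearMap.id : P' →ₗ[A] P'))
    (δ'.prodMap (LinearMap.id : P →ₗ[A] P)) (h.injective.prodMap Function.injective_id)
    (h'.injective.prodMap Function.injective_id) β fun y => by
      rw [hr, hr', hβ]
      simp [hs', ht']
  exact ⟨α, β, hα⟩

theorem MinimalResolution.isRes {M : FGModuleCat.{v} A} (ρ : MinimalResolution M) :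
    IsRes ρ.δ ρ.ε :=
  ⟨ρ.injective_δ, ρ.exact, ρ.surjective_ε⟩

variable {Ω P M N : Type v} [AddCommGroup Ω] [AddCommGroup P] [AddCommGroup M] [AddCommGroup N]
  [Module A Ω] [Module A P] [Module A M] [Module A N]

/-- The pushout of `δ : Ω → P` along `ψ : Ω → N`. -/
abbrev Push (δ : Ω →ₗ[A] P) (ψ : Ω →ₗ[A] N) : Type v := (N × P) ⧸ LinearMap.range (ψ.prod δ)

/-- The map `N → Push δ ψ`. -/
def pushInl (δ : Ω →ₗ[A] P) (ψ : Ω →ₗ[A] N) : N →ₗ[A] Push δ ψ :=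
  (Submodule.mkQ _).comp (LinearMap.inl A N P)

/-- The map `Push δ ψ → M` induced by `ε : P → M`. -/
def pushDesc {δ : Ω →ₗ[A] P} {ε : P →ₗ[A] M} (h : IsRes δ ε) (ψ : Ω →ₗ[A] N) :
    Push δ ψ →ₗ[A] M :=
  Submodule.liftQ _ (ε.comp (LinearMap.snd A N P)) <| by
    rintro _ ⟨w, rfl⟩
    exact (h.exact _).2 ⟨w, rfl⟩

theorem pushDesc_mk {δ : Ω →ₗ[A] P} {ε : P →ₗ[A] M} (h : IsRes δ ε) (ψ : Ω →ₗ[A] N) (x : N × P) :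
    pushDesc h ψ (Submodule.Quotient.mk x) = ε x.2 := rfl

theorem push_mk_eq_zero {δ : Ω →ₗ[A] P} {ψ : Ω →ₗ[A] N} {x : N × P} :
    (Submodule.Quotient.mk x : Push δ ψ) = 0 ↔ ∃ w, ψ w = x.1 ∧ δ w = x.2 := by
  rw [Submodule.Quotient.mk_eq_zero]
  exact exists_congr fun w => Prod.ext_iff

/-- The pushout extension is exact. -/
theorem isRes_push {δ : Ω →ₗ[A] P} {ε : P →ₗ[A] M} (h : IsRes δ ε) (ψ : Ω →ₗ[A] N) :
    IsRes (pushInl δ ψ) (pushDesc h ψ) := by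
  refine ⟨(injective_iff_map_eq_zero _).2 fun n hn => ?_, fun x => ⟨fun hx => ?_, ?_⟩, fun y => ?_⟩
  · obtain ⟨w, h₁, h₂⟩ := push_mk_eq_zero.1 hn
    rw [LinearMap.inl_apply] at h₁ h₂
    have : w = 0 := h.injective (by simpa using h₂)
    simpa [this] using h₁.symm
  · obtain ⟨⟨n, x⟩, rfl⟩ := Submodule.Quotient.mk_surjective _ x
    obtain ⟨w, rfl⟩ := (h.exact x).1 hx
    refine ⟨n - ψ w, ?_⟩
    refine sub_eq_zero.1 (push_mk_eq_zero (x := (n - ψ w, 0) - (n, δ w)).2 ⟨-w, ?_, ?_⟩)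
    · simp
    · simp
  · rintro ⟨n, rfl⟩
    exact (pushDesc_mk h ψ _).trans (map_zero ε)
  · obtain ⟨x, rfl⟩ := h.surjective y
    exact ⟨Submodule.Quotient.mk (0, x), rfl⟩

theorem shortExact_of_isRes {N L M : Type v} [AddCommGroup N] [AddCommGroup L] [AddCommGroup M]
    [Module A N] [Module A L] [Module A M] {f : N →ₗ[A] L} {g : L →ₗ[A] M} (h : IsRes f g) :
    ∃ w, (ShortComplex.mk (ModuleCat.ofHom f) (ModuleCat.ofHom g) w).ShortExact := by
  refine ⟨?_, ShortComplex.ShortExact.mk' ?_ ?_ ?_⟩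
  · ext x
    exact (h.exact _).2 ⟨x, rfl⟩
  · rw [ShortComplex.ShortExact.moduleCat_exact_iff_function_exact]
    exact h.exact
  · exact (ModuleCat.mono_iff_injective _).2 h.injective
  · exact (ModuleCat.epi_iff_surjective _).2 h.surjective

theorem isRes_of_shortExact {N L M : ModuleCat.{v} A} {f : N ⟶ L} {g : L ⟶ M} {w : f ≫ g = 0}
    (h : (ShortComplex.mk f g w).ShortExact) : IsRes f.hom g.hom :=
  ⟨(ModuleCat.mono_iff_injective _).1 h.mono_f,
    (ShortComplex.ShortExact.moduleCat_exact_iff_function_exact _).1 h.exact,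
    (ModuleCat.epi_iff_surjective _).1 h.epi_g⟩

/-- The pushout extension `0 → N → Push δ ψ → M → 0`. -/
def pushExt {δ : Ω →ₗ[A] P} {ε : P →ₗ[A] M} (h : IsRes δ ε) (ψ : Ω →ₗ[A] N) :
    Extension (ModuleCat.of A M) (ModuleCat.of A N) (ModuleCat.of A (Push δ ψ)) where
  f := ModuleCat.ofHom (pushInl δ ψ)
  g := ModuleCat.ofHom (pushDesc h ψ)
  w := (shortExact_of_isRes (isRes_push h ψ)).choose
  shortExact := (shortExact_of_isRes (isRes_push h ψ)).choose_spec

/-- A map between two extensions of `M` by `N` is an isomorphism. -/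
theorem bijective_of_isRes {N L L' M : Type*} [AddCommGroup N] [AddCommGroup L] [AddCommGroup L']
    [AddCommGroup M] [Module A N] [Module A L] [Module A L'] [Module A M]
    {f : N →ₗ[A] L} {g : L →ₗ[A] M} {f' : N →ₗ[A] L'} {g' : L' →ₗ[A] M} (h : IsRes f g)
    (h' : IsRes f' g') (φ : L →ₗ[A] L') (h₁ : ∀ x, φ (f x) = f' x) (h₂ : ∀ x, g' (φ x) = g x) :
    Function.Bijective φ := by
  constructor
  · refine (injective_iff_map_eq_zero _).2 fun x hx => ?_
    obtain ⟨n, rfl⟩ := (h.exact x).1 (by rw [← h₂, hx, map_zero])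
    rw [h₁] at hx
    have : n = 0 := h'.injective (by rw [hx, map_zero])
    rw [this, map_zero]
  · intro y
    obtain ⟨x, hx⟩ := h.surjective (g' y)
    obtain ⟨n, hn⟩ := (h'.exact (y - φ x)).1 (by rw [map_sub, h₂, hx, sub_self])
    exact ⟨f n + x, by rw [map_add, h₁, hn, sub_add_cancel]⟩

/-- Every extension of `M` by `N` is a pushout of a given projective resolution of `M`. -/
theorem exists_push_equiv [Module.Projective A P] {δ : Ω →ₗ[A] P} {ε : P →ₗ[A] M}
    (h : IsRes δ ε) {L : Type*} [AddCommGroup L] [Module A L] {f : N →ₗ[A] L} {g : L →ₗ[A] M}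
    (hL : IsRes f g) : ∃ (ψ : Ω →ₗ[A] N) (e : Push δ ψ ≃ₗ[A] L),
      (∀ n, e (pushInl δ ψ n) = f n) ∧ ∀ x, g (e x) = pushDesc h ψ x := by
  obtain ⟨s, hs⟩ := Module.projective_lifting_property g ε hL.surjective
  have hs' : ∀ x, g (s x) = ε x := fun x => LinearMap.congr_fun hs x
  have hr : ∀ w, (-(s.comp δ)) w ∈ LinearMap.range f := fun w => by
    refine (hL.exact _).1 ?_
    rw [LinearMap.neg_apply, map_neg, LinearMap.comp_apply, hs', (h.exact _).2 ⟨w, rfl⟩, neg_zero]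
  let ψ : Ω →ₗ[A] N := (LinearEquiv.ofInjective f hL.injective).symm.toLinearMap.comp
    ((-(s.comp δ)).codRestrict _ hr)
  have hψ : ∀ w, f (ψ w) = -s (δ w) := fun w => by
    have : LinearEquiv.ofInjective f hL.injective (ψ w) = ⟨-s (δ w), hr w⟩ := by
      simp only [ψ, LinearMap.comp_apply, LinearEquiv.coe_coe, LinearEquiv.apply_symm_apply]
      rfl
    exact congrArg Subtype.val this
  let φ : Push δ ψ →ₗ[A] L := Submodule.liftQ _ (f.coprod s) <| by
    rintro _ ⟨w, rfl⟩
    simp [hψ]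
  have h₁ : ∀ n, φ (pushInl δ ψ n) = f n := fun n => by
    change f n + s 0 = f n
    rw [map_zero, add_zero]
  have h₂ : ∀ x, g (φ x) = pushDesc h ψ x := fun x => by
    obtain ⟨⟨n, x⟩, rfl⟩ := Submodule.Quotient.mk_surjective _ x
    change g (f n + s x) = ε x
    rw [map_add, (hL.exact _).2 ⟨n, rfl⟩, zero_add, hs']
  exact ⟨ψ, LinearEquiv.ofBijective φ (bijective_of_isRes (isRes_push h ψ) hL φ h₁ h₂), h₁, h₂⟩

theorem pushExt_surjective [Module.Projective A P] {δ : Ω →ₗ[A] P} {ε : P →ₗ[A] M}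
    (h : IsRes δ ε) {L : ModuleCat.{v} A} (E : Extension (ModuleCat.of A M) (ModuleCat.of A N) L) :
    ∃ ψ : Ω →ₗ[A] N, (pushExt h ψ).Equiv E := by
  obtain ⟨ψ, e, h₁, h₂⟩ := exists_push_equiv h (isRes_of_shortExact E.shortExact)
  exact ⟨ψ, e.toModuleIso, moduleCat_hom_ext h₁, moduleCat_hom_ext h₂⟩

/-- Composition with `δ` on the right. -/
def precompHom (δ : Ω →ₗ[A] P) (N : Type v) [AddCommGroup N] [Module A N] :
    (P →ₗ[A] N) →+ (Ω →ₗ[A] N) where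
  toFun s := s.comp δ
  map_zero' := LinearMap.zero_comp δ
  map_add' _ _ := LinearMap.ext fun _ => rfl

/-- Two pushouts of the same resolution are equivalent extensions if and only if the difference of
the maps `Ω → N` extends to `P`. -/
theorem pushExt_equiv_iff {δ : Ω →ₗ[A] P} {ε : P →ₗ[A] M} (h : IsRes δ ε) (ψ ψ' : Ω →ₗ[A] N) :
    (pushExt h ψ).Equiv (pushExt h ψ') ↔ ψ' - ψ ∈ (precompHom δ N).range := by
  have hpush := isRes_push h ψ'
  constructor
  · rintro ⟨φ, h₁, h₂⟩
    let p : Push δ ψ →ₗ[A] Push δ ψ' := φ.hom.hom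
    have h₁' : ∀ n, p (pushInl δ ψ n) = pushInl δ ψ' n := fun n =>
      LinearMap.congr_fun (congrArg ModuleCat.Hom.hom h₁) n
    have h₂' : ∀ x, pushDesc h ψ' (p x) = pushDesc h ψ x := fun x =>
      LinearMap.congr_fun (congrArg ModuleCat.Hom.hom h₂) x
    let d : P →ₗ[A] Push δ ψ' := p.comp ((Submodule.mkQ _).comp (LinearMap.inr A N P)) -
      (Submodule.mkQ _).comp (LinearMap.inr A N P)
    have hd : ∀ x, d x ∈ LinearMap.range (pushInl δ ψ') := fun x => by
      refine (hpush.exact _).1 ?_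
      change pushDesc h ψ' (p (Submodule.Quotient.mk (0, x)) - Submodule.Quotient.mk (0, x)) = 0
      rw [map_sub, h₂']
      exact sub_self _
    let s : P →ₗ[A] N := (LinearEquiv.ofInjective _ hpush.injective).symm.toLinearMap.comp
      (d.codRestrict _ hd)
    have hs : ∀ x, pushInl δ ψ' (s x) = d x := fun x => by
      have : LinearEquiv.ofInjective _ hpush.injective (s x) = ⟨d x, hd x⟩ := by
        simp only [s, LinearMap.comp_apply, LinearEquiv.coe_coe, LinearEquiv.apply_symm_apply]
        rfl
      exact congrArg Subtype.val this
    refine ⟨s, LinearMap.ext fun w => ?_⟩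
    have e₁ : pushInl δ ψ (ψ w) + Submodule.Quotient.mk (0, δ w) = 0 :=
      push_mk_eq_zero.2 ⟨w, (add_zero _).symm, (zero_add _).symm⟩
    have e₂ : pushInl δ ψ' (ψ' w) + Submodule.Quotient.mk (0, δ w) = 0 :=
      push_mk_eq_zero.2 ⟨w, (add_zero _).symm, (zero_add _).symm⟩
    have e₃ : p (pushInl δ ψ (ψ w)) + p (Submodule.Quotient.mk (0, δ w)) = 0 := by
      rw [← map_add, e₁, map_zero]
    have e₄ : pushInl δ ψ' (s (δ w)) = p (Submodule.Quotient.mk (0, δ w)) -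
      Submodule.Quotient.mk (0, δ w) := hs (δ w)
    rw [h₁'] at e₃
    have e₅ : pushInl δ ψ' (s (δ w)) = pushInl δ ψ' (ψ' w - ψ w) := by
      rw [e₄, map_sub, eq_neg_of_add_eq_zero_right e₃, eq_neg_of_add_eq_zero_left e₂]
      abel
    exact hpush.injective e₅
  · rintro ⟨s, hs⟩
    have hs' : ∀ w, ψ w + s (δ w) = ψ' w := fun w => by
      have : s (δ w) = ψ' w - ψ w := LinearMap.congr_fun hs w
      rw [this, add_sub_cancel]
    let φ : Push δ ψ →ₗ[A] Push δ ψ' := Submodule.mapQ _ _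
      ((LinearMap.fst A N P + s.comp (LinearMap.snd A N P)).prod (LinearMap.snd A N P)) <| by
        rintro _ ⟨w, rfl⟩
        exact ⟨w, Prod.ext (hs' w).symm rfl⟩
    have h₁ : ∀ n, φ (pushInl δ ψ n) = pushInl δ ψ' n := fun n => by
      change Submodule.Quotient.mk (n + s 0, (0 : P)) = Submodule.Quotient.mk (n, (0 : P))
      rw [map_zero, add_zero]
    have h₂ : ∀ x, pushDesc h ψ' (φ x) = pushDesc h ψ x := fun x => by
      obtain ⟨x, rfl⟩ := Submodule.Quotient.mk_surjective _ x
      rfl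
    exact ⟨(LinearEquiv.ofBijective φ (bijective_of_isRes (isRes_push h ψ) hpush φ h₁
      h₂)).toModuleIso, moduleCat_hom_ext h₁, moduleCat_hom_ext h₂⟩

/-- Maps `P → N` that vanish on `Ω` are maps `M → N`. -/
theorem card_precompHom_ker {δ : Ω →ₗ[A] P} {ε : P →ₗ[A] M} (h : IsRes δ ε) :
    Nat.card (precompHom δ N).ker = Nat.card (M →ₗ[A] N) := by
  symm
  refine Nat.card_congr (Equiv.ofBijective (fun φ => ⟨φ.comp ε, ?_⟩) ⟨fun φ φ' e => ?_, ?_⟩)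
  · rw [AddMonoidHom.mem_ker]
    refine LinearMap.ext fun w => ?_
    change φ (ε (δ w)) = 0
    rw [(h.exact _).2 ⟨w, rfl⟩, map_zero]
  · refine LinearMap.ext fun y => ?_
    obtain ⟨x, rfl⟩ := h.surjective y
    exact LinearMap.congr_fun (congrArg Subtype.val e) x
  · rintro ⟨s, hs⟩
    have hk : LinearMap.ker ε ≤ LinearMap.ker s := fun x hx => by
      obtain ⟨w, rfl⟩ := (h.exact x).1 hx
      exact LinearMap.congr_fun (AddMonoidHom.mem_ker.1 hs) w
    refine ⟨((LinearMap.ker ε).liftQ s hk).comp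
      (ε.quotKerEquivOfSurjective h.surjective).symm.toLinearMap, Subtype.ext ?_⟩
    refine LinearMap.ext fun x => ?_
    have : (ε.quotKerEquivOfSurjective h.surjective).symm (ε x) = Submodule.Quotient.mk x := by
      rw [LinearEquiv.symm_apply_eq]
      rfl
    change (LinearMap.ker ε).liftQ s hk ((ε.quotKerEquivOfSurjective h.surjective).symm (ε x)) = s x
    rw [this]
    rfl

/-- Each equivalence class of extensions occurs equally often among the pushouts along all maps `Ω →
N`. -/
theorem card_push_iso [Module.Projective A P] {δ : Ω →ₗ[A] P} {ε : P →ₗ[A] M} (h : IsRes δ ε)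
    (L : ModuleCat.{v} A) :
    Nat.card {ψ : Ω →ₗ[A] N // Nonempty (ModuleCat.of A (Push δ ψ) ≅ L)} =
      extCard (ModuleCat.of A M) (ModuleCat.of A N) L * Nat.card (precompHom δ N).range :=
  card_middle_iso (precompHom δ N) (fun ψ => ModuleCat.of A (Push δ ψ)) (pushExt h)
    (fun _ E => pushExt_surjective h E) (pushExt_equiv_iff h) L

/-- The map `(δ_N, θ; 0, δ)` from `Ω_N ⊕ Ω` to `P_N ⊕ P`. -/
def blockMap {Ω' P' : Type*} [AddCommGroup Ω'] [AddCommGroup P'] [Module A Ω'] [Module A P']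
    (δ' : Ω' →ₗ[A] P') (θ : Ω →ₗ[A] P') (δ : Ω →ₗ[A] P) : (Ω' × Ω) →ₗ[A] (P' × P) :=
  (δ'.coprod θ).prod (δ.comp (LinearMap.snd A Ω' Ω))

/-- The horseshoe lemma: a resolution of a pushout from resolutions of the end terms. -/
theorem isRes_blockMap {Ω' P' : Type v} [AddCommGroup Ω'] [AddCommGroup P'] [Module A Ω']
    [Module A P'] {δ : Ω →ₗ[A] P} {ε : P →ₗ[A] M} (h : IsRes δ ε) {δ' : Ω' →ₗ[A] P'}
    {ε' : P' →ₗ[A] N} (h' : IsRes δ' ε') (θ : Ω →ₗ[A] P') :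
    IsRes (blockMap δ' θ δ) ((Submodule.mkQ (LinearMap.range ((ε'.comp θ).prod δ))).comp
      (ε'.prodMap LinearMap.id)) := by
  refine ⟨(injective_iff_map_eq_zero _).2 ?_, ?_, ?_⟩
  · rintro ⟨a, w⟩ hw
    have h₁ : δ' a + θ w = 0 := congrArg Prod.fst hw
    have h₂ : δ w = 0 := congrArg Prod.snd hw
    have hw0 : w = 0 := h.injective (by rw [h₂, map_zero])
    subst hw0
    rw [map_zero, add_zero] at h₁
    have ha0 : a = 0 := h'.injective (by rw [h₁, map_zero])
    rw [ha0]
    rfl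
  · rintro ⟨p, x⟩
    constructor
    · intro hx
      obtain ⟨w, h₁, h₂⟩ := push_mk_eq_zero.1 hx
      obtain ⟨a, ha⟩ := (h'.exact (p - θ w)).1 (by
        rw [map_sub, sub_eq_zero]
        exact h₁.symm)
      refine ⟨(a, w), Prod.ext ?_ h₂⟩
      change δ' a + θ w = p
      rw [ha, sub_add_cancel]
    · rintro ⟨⟨a, w⟩, hw⟩
      have h₁ : δ' a + θ w = p := congrArg Prod.fst hw
      have h₂ : δ w = x := congrArg Prod.snd hw
      refine push_mk_eq_zero.2 ⟨w, ?_, h₂⟩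
      change ε' (θ w) = ε' p
      rw [← h₁, map_add, (h'.exact _).2 ⟨a, rfl⟩, zero_add]
  · intro y
    obtain ⟨⟨n, x⟩, rfl⟩ := Submodule.Quotient.mk_surjective _ y
    obtain ⟨p, rfl⟩ := h'.surjective n
    exact ⟨(p, x), rfl⟩

theorem IsRes.comp_equiv {P M M' Ω : Type*} [AddCommGroup Ω] [AddCommGroup P] [AddCommGroup M]
    [AddCommGroup M'] [Module A Ω] [Module A P] [Module A M] [Module A M'] {δ : Ω →ₗ[A] P}
    {ε : P →ₗ[A] M} (h : IsRes δ ε) (e : M ≃ₗ[A] M') : IsRes δ (e.toLinearMap.comp ε) :=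
  ⟨h.injective, fun x => by
    rw [← h.exact x]
    simp, e.surjective.comp h.surjective⟩

end

/-! ### Extending additive functions from projectives -/

section

variable (k : Type u) [Field k] [Finite k] {A : Type v} [Ring A] [Algebra k A]
  [Module.Finite k A] [IsHereditaryRing A]

/-- A function on finitely generated projectives that is additive on direct sums and invariant under
isomorphisms extends to the Grothendieck group. -/
theorem exists_lift_of_projective (k : Type u) [Field k] [Finite k] {A : Type v} [Ring A]
    [Algebra k A] [Module.Finite k A] [IsHereditaryRing A] {G : Type*} [AddCommGroup G] (u : FGModuleCat.{v} A → G)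
    (hiso : ∀ P Q : FGModuleCat.{v} A, Module.Projective A P → Module.Projective A Q →
      Nonempty (P ≃ₗ[A] Q) → u P = u Q)
    (hprod : ∀ P Q : FGModuleCat.{v} A, Module.Projective A P → Module.Projective A Q →
      u (FGModuleCat.of A (P × Q)) = u P + u Q) :
    ∃ φ : GrothendieckGroup A →+ G, ∀ P : FGModuleCat.{v} A, Module.Projective A P →
      φ (cl P) = u P := by
  -- By Schanuel's lemma, `u P - u Ω` does not depend on the resolution of `M`.
  have key : ∀ (M Ω P Ω' P' : FGModuleCat.{v} A), Module.Projective A Ω → Module.Projective A P →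
      Module.Projective A Ω' → Module.Projective A P' → ∀ (δ : Ω →ₗ[A] P) (ε : P →ₗ[A] M)
      (δ' : Ω' →ₗ[A] P') (ε' : P' →ₗ[A] M), IsRes δ ε → IsRes δ' ε' →
      u P - u Ω = u P' - u Ω' := by
    intro M Ω P Ω' P' _ _ _ _ δ ε δ' ε' h h'
    obtain ⟨α, -, -⟩ := schanuel h h'
    have e := hiso (FGModuleCat.of A (Ω × P')) (FGModuleCat.of A (Ω' × P))
      (inferInstanceAs (Module.Projective A (Ω × P')))
      (inferInstanceAs (Module.Projective A (Ω' × P))) ⟨α⟩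
    rw [hprod Ω P' ‹_› ‹_›, hprod Ω' P ‹_› ‹_›] at e
    rw [sub_eq_sub_iff_add_eq_add, add_comm, ← e, add_comm]
  let ρ := fun M : FGModuleCat.{v} A => minimalResolution k M
  refine ⟨GrothendieckGroup.lift (fun M => u (ρ M).P - u (ρ M).Ω) ?_, fun P hP => ?_⟩
  · intro N L M f g w hS
    have hN := (ρ N).isRes
    have hM := (ρ M).isRes
    have hL := (ρ L).isRes
    have := (ρ N).projective_P
    have := (ρ N).projective_Ω
    have := (ρ M).projective_P
    have := (ρ M).projective_Ω
    obtain ⟨ψ, e, -, -⟩ := exists_push_equiv hM (isRes_of_shortExact hS)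
    -- The horseshoe lemma resolves `L` by the sums of the terms of the resolutions of `N` and `M`.
    obtain ⟨θ, hθ⟩ := Module.projective_lifting_property (ρ N).ε ψ hN.surjective
    subst hθ
    have hb := (isRes_blockMap hM hN θ).comp_equiv e
    rw [key L _ _ (FGModuleCat.of A ((ρ N).Ω × (ρ M).Ω)) (FGModuleCat.of A ((ρ N).P × (ρ M).P))
      (ρ L).projective_Ω (ρ L).projective_P
      (inferInstanceAs (Module.Projective A ((ρ N).Ω × (ρ M).Ω)))
      (inferInstanceAs (Module.Projective A ((ρ N).P × (ρ M).P))) _ _ _ _ hL hb,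
      hprod _ _ ‹_› ‹_›, hprod _ _ ‹_› ‹_›]
    abel
  · rw [GrothendieckGroup.lift_cl]
    have hz : Module.Projective A (FGModuleCat.of A PUnit.{v + 1}) :=
      inferInstanceAs (Module.Projective A PUnit.{v + 1})
    have hu : u (FGModuleCat.of A PUnit.{v + 1}) = 0 := by
      have e := hprod _ _ hz hz
      rw [hiso _ (FGModuleCat.of A PUnit.{v + 1})
        (inferInstanceAs (Module.Projective A (PUnit.{v + 1} × PUnit.{v + 1}))) hz
        ⟨(0 : (PUnit.{v + 1} × PUnit.{v + 1}) ≃ₗ[A] PUnit.{v + 1})⟩] at e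
      simpa using e
    rw [key P _ _ (FGModuleCat.of A PUnit.{v + 1}) P (ρ P).projective_Ω (ρ P).projective_P hz hP
      _ _ (0 : PUnit.{v + 1} →ₗ[A] P) LinearMap.id (ρ P).isRes
      ⟨Function.injective_of_subsingleton _, fun x => ?_, Function.surjective_id⟩, hu, sub_zero]
    constructor
    · intro hx
      exact ⟨0, hx.symm⟩
    · rintro ⟨_, rfl⟩
      rfl

/-- The number of pushouts isomorphic to `L`, in terms of extensions. -/
theorem card_push_iso_eq {Ω P M N : Type v} [AddCommGroup Ω] [AddCommGroup P] [AddCommGroup M]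
    [AddCommGroup N] [Module A Ω] [Module A P] [Module A M] [Module A N] [Module.Finite A Ω]
    [Module.Finite A P] [Module.Finite A M] [Module.Finite A N] [Module.Projective A P]
    {δ : Ω →ₗ[A] P} {ε : P →ₗ[A] M} (h : IsRes δ ε) (L : ModuleCat.{v} A) :
    (Nat.card {ψ : Ω →ₗ[A] N // Nonempty (ModuleCat.of A (Push δ ψ) ≅ L)} : ℂ) =
      vv k ^ (2 * eulerForm k A (mcl A P) (mcl A N)) *
        ((extCard (ModuleCat.of A M) (ModuleCat.of A N) L : ℂ) /
          Nat.card (ModuleCat.of A M ⟶ ModuleCat.of A N)) := by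
  have : Finite A := Module.finite_of_finite k
  have : Finite (M →ₗ[A] N) := by
    have : Finite M := Module.finite_of_finite A
    have : Finite N := Module.finite_of_finite A
    exact Finite.of_injective (fun f : M →ₗ[A] N => (f : M → N)) DFunLike.coe_injective
  have e : Nat.card (ModuleCat.of A M ⟶ ModuleCat.of A N) = Nat.card (M →ₗ[A] N) :=
    Nat.card_congr (ModuleCat.homEquiv (M := ModuleCat.of A M) (N := ModuleCat.of A N))
  have h0 : (Nat.card (M →ₗ[A] N) : ℂ) ≠ 0 := Nat.cast_ne_zero.2 Nat.card_pos.ne'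
  rw [card_push_iso h, ← card_hom_of_projective, card_eq_card_ker_mul_card_range (precompHom δ N),
    card_precompHom_ker h, e]
  push_cast
  field_simp

end

/-! ### Two-term complexes -/

/-- The condition that `m = 0` or `m > 2`, under which `n`, `n + 1`, `n + 2` are distinct in
`ℤ/m`. -/
class IsPeriod (m : ℕ) : Prop where
  eq_zero_or_lt : m = 0 ∨ 2 < m

section

variable {m : ℕ} [hm : IsPeriod m]

theorem natCast_ne_zero_of_isPeriod {a : ℕ} (h0 : 0 < a) (h : a ≤ 2) : (a : ZMod m) ≠ 0 := by
  rw [Ne, ZMod.natCast_eq_zero_iff]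
  intro hd
  rcases hm.eq_zero_or_lt with rfl | h'
  · exact h0.ne' (Nat.eq_zero_of_zero_dvd hd)
  · exact absurd (Nat.le_of_dvd h0 hd) (by omega)

theorem add_one_ne (n : ZMod m) : n + 1 ≠ n := fun h =>
  natCast_ne_zero_of_isPeriod (m := m) (a := 1) one_pos one_le_two (by simpa using h)

theorem add_one_add_one_ne (n : ZMod m) : n + 1 + 1 ≠ n := fun h =>
  natCast_ne_zero_of_isPeriod (m := m) (a := 2) two_pos le_rfl (by
    rw [add_assoc, add_eq_left] at h
    rw [← h]
    norm_num)

end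

section

variable {m : ℕ} {A : Type v} [Ring A]

/-- The complex `L` is isomorphic to `f : Q → P`, placed in degrees `i` and `i + 1`. -/
structure IsTwoTerm (L : ProjComplex m A) (i : ZMod m) {Q P : Type v} [AddCommGroup Q]
    [AddCommGroup P] [Module A Q] [Module A P] (f : Q →ₗ[A] P) : Prop where
  subsingleton : ∀ n, n ≠ i → n ≠ i + 1 → Subsingleton (L.obj.X n)
  exists_equiv : ∃ (a : Q ≃ₗ[A] L.obj.X i) (b : P ≃ₗ[A] L.obj.X (i + 1)),
    ∀ x, dif L i (i + 1) (a x) = b (f x)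

/-- Two equivalences in different degrees extend to a family, if all other terms vanish. -/
theorem exists_family {ι : Type*} {V : ι → Type*} (h0 : ∀ n, Nonempty (V n)) {i j : ι} (hij : i ≠ j)
    (a : V i) (b : V j) : ∃ w : ∀ n, V n, w i = a ∧ w j = b := by
  classical
  refine ⟨Function.update (Function.update (fun n => (h0 n).some) j b) i a, ?_, ?_⟩
  · rw [Function.update_self]
  · rw [Function.update_of_ne hij.symm, Function.update_self]

theorem exists_family₃ {ι : Type*} {V : ι → Type*} (h0 : ∀ n, Nonempty (V n)) {h i j : ι}
    (hhi : h ≠ i) (hhj : h ≠ j) (hij : i ≠ j) (a : V h) (b : V i) (c : V j) :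
    ∃ w : ∀ n, V n, w h = a ∧ w i = b ∧ w j = c := by
  classical
  obtain ⟨w, h₁, h₂⟩ := exists_family h0 hij b c
  refine ⟨Function.update w h a, ?_, ?_, ?_⟩
  · rw [Function.update_self]
  · rw [Function.update_of_ne hhi.symm, h₁]
  · rw [Function.update_of_ne hhj.symm, h₂]

theorem nonempty_equiv_of_subsingleton {V W : Type*} [AddCommGroup V] [AddCommGroup W] [Module A V]
    [Module A W] (h : Subsingleton V) (h' : Subsingleton W) : Nonempty (V ≃ₗ[A] W) :=
  ⟨0⟩

namespace IsTwoTerm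

variable {L L' M N : ProjComplex m A} {i : ZMod m} {Q P Q' P' : Type v} [AddCommGroup Q]
  [AddCommGroup P] [Module A Q] [Module A P] [AddCommGroup Q'] [AddCommGroup P'] [Module A Q']
  [Module A P'] {f : Q →ₗ[A] P} {f' : Q' →ₗ[A] P'}

theorem tcl_left [Module.Finite A Q] (h : IsTwoTerm L i f) : tcl L i = mcl A Q := by
  obtain ⟨a, b, -⟩ := h.exists_equiv
  exact (mcl_congr a).symm

theorem tcl_right [Module.Finite A P] (h : IsTwoTerm L i f) : tcl L (i + 1) = mcl A P := by
  obtain ⟨a, b, -⟩ := h.exists_equiv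
  exact (mcl_congr b).symm

theorem tcl_eq_zero (h : IsTwoTerm L i f) {n : ZMod m} (hn : n ≠ i) (hn' : n ≠ i + 1) :
    tcl L n = 0 := by
  have := h.subsingleton n hn hn'
  exact mcl_subsingleton _

theorem acyclic (h : IsTwoTerm L i f) (hf : Function.Bijective f) : L.obj.Acyclic := by
  obtain ⟨a, b, hab⟩ := h.exists_equiv
  refine acyclic_iff.2 ?_
  rintro n _ _ rfl rfl x hx
  by_cases hn : n = i
  · subst hn
    obtain ⟨y, rfl⟩ := b.surjective x
    obtain ⟨z, rfl⟩ := hf.2 y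
    exact ⟨a z, hab z⟩
  · by_cases hn' : n + 1 = i
    · subst hn'
      obtain ⟨y, rfl⟩ := a.surjective x
      have : y = 0 := hf.1 (b.injective (by rw [← hab, hx, map_zero, map_zero]))
      exact ⟨0, by rw [this, map_zero, map_zero]⟩
    · have := h.subsingleton (n + 1) hn' (fun h => hn (add_right_cancel h))
      exact ⟨0, Subsingleton.elim _ _⟩

/-- An extension of two-term complexes in the same degrees is a two-term complex, with a block
triangular differential. -/
theorem tsum (h : IsTwoTerm M i f) (h' : IsTwoTerm N i f') {t : Q →ₗ[A] P'}
    (θ : twist M N) (a : Q ≃ₗ[A] M.obj.X i) (b : P ≃ₗ[A] M.obj.X (i + 1))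
    (hab : ∀ x, dif M i (i + 1) (a x) = b (f x))
    (a' : Q' ≃ₗ[A] N.obj.X i) (b' : P' ≃ₗ[A] N.obj.X (i + 1))
    (hab' : ∀ x, dif N i (i + 1) (a' x) = b' (f' x))
    (ht : ∀ x, θ.1 i (i + 1) (a x) = b' (t x)) : IsTwoTerm (tsum θ) i (blockMap f' t f) := by
  refine ⟨fun n hn hn' => ?_, a'.prodCongr a, b'.prodCongr b, fun x => ?_⟩
  · have := h.subsingleton n hn hn'
    have := h'.subsingleton n hn hn'
    exact inferInstanceAs (Subsingleton (N.obj.X n × M.obj.X n))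
  · refine (dif_tsum θ i (i + 1) (a' x.1, a x.2)).trans ?_
    rw [hab, hab', ht, ← map_add]
    rfl

theorem dsum (h : IsTwoTerm M i f) (h' : IsTwoTerm N i f') :
    IsTwoTerm (dsum M N) i (f'.prodMap f) := by
  obtain ⟨a, b, hab⟩ := h.exists_equiv
  obtain ⟨a', b', hab'⟩ := h'.exists_equiv
  have := tsum h h' (t := 0) (0 : twist M N) a b hab a' b' hab' fun x => (map_zero b').symm
  have e : blockMap f' 0 f = f'.prodMap f := by
    ext x <;> simp [blockMap]
  rwa [e] at this

end IsTwoTerm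

variable [IsPeriod m]

/-- Complexes with terms in three consecutive degrees and no differential out of the last one are
isomorphic if their terms are compatibly isomorphic. -/
theorem nonempty_iso_of_three {L L' : ProjComplex m A} {i : ZMod m}
    (hL : ∀ n, n ≠ i → n ≠ i + 1 → n ≠ i + 1 + 1 → Subsingleton (L.obj.X n))
    (hL' : ∀ n, n ≠ i → n ≠ i + 1 → n ≠ i + 1 + 1 → Subsingleton (L'.obj.X n))
    (h0 : ∀ n x, dif L (i + 1 + 1) n x = 0) (h0' : ∀ n x, dif L' (i + 1 + 1) n x = 0)
    (a : L.obj.X i ≃ₗ[A] L'.obj.X i) (b : L.obj.X (i + 1) ≃ₗ[A] L'.obj.X (i + 1))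
    (c : L.obj.X (i + 1 + 1) ≃ₗ[A] L'.obj.X (i + 1 + 1))
    (hab : ∀ x, dif L' i (i + 1) (a x) = b (dif L i (i + 1) x))
    (hbc : ∀ x, dif L' (i + 1) (i + 1 + 1) (b x) = c (dif L (i + 1) (i + 1 + 1) x)) :
    Nonempty (L ≅ L') := by
  obtain ⟨e, h₁, h₂, h₃⟩ := exists_family₃ (V := fun n => L.obj.X n ≃ₗ[A] L'.obj.X n) (fun n => by
    by_cases hi : n = i
    · exact hi ▸ ⟨a⟩
    by_cases hj : n = i + 1
    · exact hj ▸ ⟨b⟩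
    by_cases hl : n = i + 1 + 1
    · exact hl ▸ ⟨c⟩
    exact nonempty_equiv_of_subsingleton (hL n hi hj hl) (hL' n hi hj hl))
    (add_one_ne i).symm (add_one_add_one_ne i).symm (add_one_ne _).symm a b c
  refine nonempty_iso_of_equiv e fun n n' x hn => ?_
  subst hn
  by_cases hi : n = i
  · subst hi
    rw [h₁, h₂, hab]
  by_cases hj : n = i + 1
  · subst hj
    rw [h₂, h₃, hbc]
  by_cases hl : n = i + 1 + 1
  · subst hl
    rw [h0, h0', map_zero]
  · have := hL n hi hj hl
    rw [Subsingleton.elim x 0]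
    simp only [map_zero]

namespace IsTwoTerm

variable {L L' M N : ProjComplex m A} {i : ZMod m} {Q P Q' P' : Type v} [AddCommGroup Q]
  [AddCommGroup P] [Module A Q] [Module A P] [AddCommGroup Q'] [AddCommGroup P'] [Module A Q']
  [Module A P'] {f : Q →ₗ[A] P} {f' : Q' →ₗ[A] P'}

theorem subsingleton_pred (h : IsTwoTerm L i f) {n : ZMod m} (hn : n + 1 = i) :
    Subsingleton (L.obj.X n) := by
  subst hn
  exact h.subsingleton n (add_one_ne n).symm (add_one_add_one_ne n).symm

theorem subsingleton_succ (h : IsTwoTerm L i f) : Subsingleton (L.obj.X (i + 1 + 1)) :=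
  h.subsingleton _ (add_one_add_one_ne i) (add_one_ne _)

theorem dif_eq_zero (h : IsTwoTerm L i f) {n n' : ZMod m} (hn : n ≠ i) (x : L.obj.X n) :
    dif L n n' x = 0 := by
  by_cases hj : n = i + 1
  · subst hj
    by_cases hn' : i + 1 + 1 = n'
    · subst hn'
      have := h.subsingleton_succ
      exact Subsingleton.elim _ _
    · rw [dif_shape L hn', LinearMap.zero_apply]
  · have := h.subsingleton n hn hj
    rw [Subsingleton.elim x 0, map_zero]

/-- A two-term complex is determined by its differential. -/
theorem nonempty_iso (h : IsTwoTerm L i f) (h' : IsTwoTerm L' i f') (α : Q ≃ₗ[A] Q')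
    (β : P ≃ₗ[A] P') (hαβ : ∀ x, f' (α x) = β (f x)) : Nonempty (L ≅ L') := by
  obtain ⟨i, rfl⟩ : ∃ l, l + 1 = i := ⟨i - 1, sub_add_cancel i 1⟩
  obtain ⟨a, b, hab⟩ := h.exists_equiv
  obtain ⟨a', b', hab'⟩ := h'.exists_equiv
  have s₁ := h.subsingleton_pred rfl
  have s₂ := h'.subsingleton_pred rfl
  refine nonempty_iso_of_three (i := i) (fun n _ hi hj => h.subsingleton n hi hj)
    (fun n _ hi hj => h'.subsingleton n hi hj) (fun n x => h.dif_eq_zero (add_one_ne _) x)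
    (fun n x => h'.dif_eq_zero (add_one_ne _) x) 0 (a.symm.trans (α.trans a'))
    (b.symm.trans (β.trans b')) (fun x => ?_) fun x => ?_
  · rw [Subsingleton.elim x 0]
    simp only [map_zero]
  · obtain ⟨x, rfl⟩ := a.surjective x
    simp [hab, hab', hαβ]

/-- Twisting cochains between two-term complexes in the same degrees. -/
theorem exists_twistEquiv (h : IsTwoTerm M i f) (h' : IsTwoTerm N i f') :
    ∃ E : twist M N ≃ (Q →ₗ[A] P'), ∀ θ,
      IsTwoTerm (BridgelandHall.tsum θ) i (blockMap f' (E θ) f) := by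
  classical
  obtain ⟨a, b, hab⟩ := h.exists_equiv
  obtain ⟨a', b', hab'⟩ := h'.exists_equiv
  have hz : ∀ (θ : ∀ n n', M.obj.X n →ₗ[A] N.obj.X n'), (∀ n n', n + 1 ≠ n' → θ n n' = 0) →
      ∀ n n', n ≠ i → ∀ x, θ n n' x = 0 := fun θ hθ n n' hn x => by
    by_cases hj : n = i + 1
    · subst hj
      by_cases hn' : i + 1 + 1 = n'
      · subst hn'
        have := h'.subsingleton_succ
        exact Subsingleton.elim _ _
      · rw [hθ _ _ hn', LinearMap.zero_apply]
    · have := h.subsingleton n hn hj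
      rw [Subsingleton.elim x 0, map_zero]
  let S : (Q →ₗ[A] P') → ∀ n n', M.obj.X n →ₗ[A] N.obj.X n' := fun t =>
    Pi.single i (Pi.single (i + 1) (b'.toLinearMap.comp (t.comp a.symm.toLinearMap)))
  have hS : ∀ t, S t i (i + 1) = b'.toLinearMap.comp (t.comp a.symm.toLinearMap) := fun t => by
    simp only [S, Pi.single_eq_same]
  have hs : ∀ t n n', n + 1 ≠ n' → S t n n' = 0 := fun t n n' hn => by
    by_cases hi : n = i
    · subst hi
      simp only [S, Pi.single_eq_same]
      rw [Pi.single_eq_of_ne hn.symm]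
    · simp only [S]
      rw [Pi.single_eq_of_ne hi]
      rfl
  have hc : ∀ t, S t ∈ twist M N := fun t => by
    refine ⟨hs t, fun n n' l x => ?_⟩
    have h₁ : S t n' l (dif M n n' x) = 0 := by
      by_cases hn : n' = i
      · subst hn
        have : dif M n n' x = 0 := by
          by_cases hn : n + 1 = n'
          · exact h.dif_eq_zero (by rw [← hn]; exact (add_one_ne n).symm) x
          · rw [dif_shape M hn, LinearMap.zero_apply]
        rw [this, map_zero]
      · exact hz (S t) (hs t) n' l hn _
    have h₂ : dif N n' l (S t n n' x) = 0 := by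
      by_cases hn : n + 1 = n'
      · by_cases hi : n = i
        · exact h'.dif_eq_zero (by rw [← hn, hi]; exact add_one_ne i) _
        · rw [hz (S t) (hs t) n n' hi, map_zero]
      · rw [hs t _ _ hn, LinearMap.zero_apply, map_zero]
    rw [h₁, h₂, add_zero]
  let E : twist M N ≃ (Q →ₗ[A] P') :=
    { toFun := fun θ => b'.symm.toLinearMap.comp ((θ.1 i (i + 1)).comp a.toLinearMap)
      invFun := fun t => ⟨S t, hc t⟩
      left_inv := fun θ => by
        refine Subtype.ext (funext fun n => funext fun n' => LinearMap.ext fun x => ?_)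
        by_cases hi : n = i
        · subst hi
          by_cases hn : n + 1 = n'
          · subst hn
            dsimp only
            rw [hS]
            simp
          · dsimp only
            rw [hs _ _ _ hn, twist_shape θ hn]
        · dsimp only
          rw [hz _ (hs _) _ _ hi, hz θ.1 θ.2.1 _ _ hi]
      right_inv := fun t => by
        dsimp only
        rw [hS]
        ext x
        simp }
  exact ⟨E, fun θ => tsum h h' θ a b hab a' b' hab' fun x => by simp [E]⟩

/-- Morphisms from the complex of an isomorphism `Q → P` to `N` are maps from `Q` to `N_i`. -/
theorem card_ker_from (h : IsTwoTerm M i f) (hf : Function.Bijective f) (N : ProjComplex m A) :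
    Nat.card (coboundary M N).ker = Nat.card (Q →ₗ[A] N.obj.X i) := by
  obtain ⟨a, b, hab⟩ := h.exists_equiv
  let F := LinearEquiv.ofBijective f hf
  have hF : ∀ x, f (F.symm x) = x := fun x => F.apply_symm_apply x
  refine Nat.card_congr (Equiv.ofBijective (fun s => (s.1 i).comp a.toLinearMap) ⟨?_, ?_⟩)
  · intro s s' hss
    have hc : ∀ (s : (coboundary M N).ker) n n' x, dif N n n' (s.1 n x) = s.1 n' (dif M n n' x) :=
      fun s n n' x => sub_eq_zero.1 (by
        rw [← coboundary_apply, AddMonoidHom.mem_ker.1 s.2]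
        rfl)
    have h₁ : s.1 i = s'.1 i := LinearMap.ext fun x => by
      obtain ⟨x, rfl⟩ := a.surjective x
      exact LinearMap.congr_fun hss x
    refine Subtype.ext (funext fun n => LinearMap.ext fun x => ?_)
    by_cases hi : n = i
    · subst hi
      rw [h₁]
    · by_cases hj : n = i + 1
      · subst hj
        obtain ⟨x, rfl⟩ := b.surjective x
        obtain ⟨x, rfl⟩ := hf.2 x
        rw [← hab, ← hc, ← hc, h₁]
      · have := h.subsingleton n hi hj
        rw [Subsingleton.elim x 0, map_zero, map_zero]
  · intro t
    obtain ⟨s, h₁, h₂⟩ := exists_family (V := fun n => M.obj.X n →ₗ[A] N.obj.X n) (fun _ => ⟨0⟩)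
      (add_one_ne i).symm (t.comp a.symm.toLinearMap)
      ((dif N i (i + 1)).comp (t.comp (F.symm.toLinearMap.comp b.symm.toLinearMap)))
    refine ⟨⟨s, AddMonoidHom.mem_ker.2 ?_⟩, by
      dsimp only
      rw [h₁]
      ext x
      simp⟩
    refine Subtype.ext (funext fun n => funext fun n' => LinearMap.ext fun x => ?_)
    by_cases hn : n + 1 = n'
    · subst hn
      rw [coboundary_apply]
      refine sub_eq_zero.2 ?_
      by_cases hi : n = i
      · subst hi
        obtain ⟨x, rfl⟩ := a.surjective x
        have hx : F.symm (f x) = x := F.symm_apply_apply x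
        rw [h₁, h₂, hab]
        simp [hx]
      · rw [h.dif_eq_zero hi, map_zero]
        by_cases hj : n = i + 1
        · subst hj
          rw [h₂]
          exact dif_dif N _ _ _ _
        · have := h.subsingleton n hi hj
          rw [Subsingleton.elim x 0, map_zero, map_zero]
    · rw [twist_shape _ hn]
      rfl

/-- Morphisms from `N` to the complex of an isomorphism `Q → P` are maps from `N_{i+1}` to `P`. -/
theorem card_ker_to (h : IsTwoTerm M i f) (hf : Function.Bijective f) (N : ProjComplex m A) :
    Nat.card (coboundary N M).ker = Nat.card (N.obj.X (i + 1) →ₗ[A] P) := by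
  obtain ⟨a, b, hab⟩ := h.exists_equiv
  let F := LinearEquiv.ofBijective f hf
  have hF : ∀ x, f (F.symm x) = x := fun x => F.apply_symm_apply x
  have hdi : ∀ x y, dif M i (i + 1) x = dif M i (i + 1) y → x = y := fun x y hxy => by
    obtain ⟨x, rfl⟩ := a.surjective x
    obtain ⟨y, rfl⟩ := a.surjective y
    rw [hab, hab] at hxy
    rw [hf.1 (b.injective hxy)]
  refine Nat.card_congr (Equiv.ofBijective (fun s => b.symm.toLinearMap.comp (s.1 (i + 1)))
    ⟨?_, ?_⟩)
  · intro s s' hss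
    have hc : ∀ (s : (coboundary N M).ker) n n' x, dif M n n' (s.1 n x) = s.1 n' (dif N n n' x) :=
      fun s n n' x => sub_eq_zero.1 (by
        rw [← coboundary_apply, AddMonoidHom.mem_ker.1 s.2]
        rfl)
    have h₁ : s.1 (i + 1) = s'.1 (i + 1) := LinearMap.ext fun x =>
      b.symm.injective (LinearMap.congr_fun hss x)
    refine Subtype.ext (funext fun n => LinearMap.ext fun x => ?_)
    by_cases hj : n = i + 1
    · subst hj
      rw [h₁]
    · by_cases hi : n = i
      · subst hi
        exact hdi _ _ (by rw [hc, hc, h₁])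
      · have := h.subsingleton n hi hj
        exact Subsingleton.elim _ _
  · intro t
    obtain ⟨s, h₁, h₂⟩ := exists_family (V := fun n => N.obj.X n →ₗ[A] M.obj.X n) (fun _ => ⟨0⟩)
      (add_one_ne i).symm (a.toLinearMap.comp (F.symm.toLinearMap.comp
        (t.comp (dif N i (i + 1))))) (b.toLinearMap.comp t)
    refine ⟨⟨s, AddMonoidHom.mem_ker.2 ?_⟩, by
      dsimp only
      rw [h₂]
      ext x
      simp⟩
    refine Subtype.ext (funext fun n => funext fun n' => LinearMap.ext fun x => ?_)
    by_cases hn : n + 1 = n'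
    · subst hn
      rw [coboundary_apply]
      refine sub_eq_zero.2 ?_
      by_cases hi : n = i
      · subst hi
        rw [h₁, h₂]
        simp [hab, hF]
      · rw [h.dif_eq_zero hi]
        by_cases hj : n + 1 = i
        · subst hj
          rw [h₁]
          simp [dif_dif]
        · have := h.subsingleton (n + 1) hj (fun h => hi (add_right_cancel h))
          exact Subsingleton.elim _ _
    · rw [twist_shape _ hn]
      rfl

/-- There are no twisting cochains from a complex in degrees `i + 1`, `i + 2` to the complex of an
injective map in degrees `i`, `i + 1`. -/
theorem twist_eq_zero (h : IsTwoTerm M i f) (hf : Function.Injective f)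
    (h' : IsTwoTerm N (i + 1) f') (θ : twist N M) : θ = 0 := by
  obtain ⟨a, b, hab⟩ := h.exists_equiv
  refine Subtype.ext (funext fun n => funext fun n' => LinearMap.ext fun x => ?_)
  change θ.1 n n' x = 0
  by_cases hn : n + 1 = n'
  · subst hn
    by_cases hi : n + 1 = i
    · -- The case `i + 2 = i - 1`, which occurs for `m = 3`.
      subst hi
      have h₁ := twist_cond θ n (n + 1) (n + 1 + 1) x
      obtain ⟨y, hy⟩ := a.surjective (θ.1 n (n + 1) x)
      have : dif N n (n + 1) x = 0 :=
        h'.dif_eq_zero (add_one_add_one_ne n).symm x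
      rw [this, map_zero, add_zero, ← hy, hab] at h₁
      have hy0 : y = 0 := hf (b.injective (by rw [h₁, map_zero, map_zero]))
      rw [← hy, hy0, map_zero]
    · by_cases hi' : n + 1 = i + 1
      · obtain rfl := add_right_cancel hi'
        have := h'.subsingleton_pred rfl
        rw [Subsingleton.elim x 0, map_zero]
      · have := h.subsingleton (n + 1) hi hi'
        exact Subsingleton.elim _ _
  · rw [twist_shape θ hn, LinearMap.zero_apply]

/-- Twisting cochains from a complex in degrees `i`, `i + 1` to one in degrees `i + 1`, `i + 2` are
(up to sign) commutative squares. -/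
theorem exists_twistEquiv_succ (h : IsTwoTerm M i f) (h' : IsTwoTerm N (i + 1) f')
    (a : Q ≃ₗ[A] M.obj.X i) (b : P ≃ₗ[A] M.obj.X (i + 1))
    (hab : ∀ x, dif M i (i + 1) (a x) = b (f x)) (a' : Q' ≃ₗ[A] N.obj.X (i + 1))
    (b' : P' ≃ₗ[A] N.obj.X (i + 1 + 1)) (hab' : ∀ x, dif N (i + 1) (i + 1 + 1) (a' x) = b' (f' x)) :
    ∃ E : twist M N ≃ {t : (Q →ₗ[A] Q') × (P →ₗ[A] P') // ∀ x, f' (t.1 x) + t.2 (f x) = 0},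
      ∀ θ, (∀ x, θ.1 i (i + 1) (a x) = a' ((E θ).1.1 x)) ∧
        ∀ x, θ.1 (i + 1) (i + 1 + 1) (b x) = b' ((E θ).1.2 x) := by
  classical
  let S : (Q →ₗ[A] Q') × (P →ₗ[A] P') → ∀ n n', M.obj.X n →ₗ[A] N.obj.X n' := fun t =>
    Pi.single i (Pi.single (i + 1) (a'.toLinearMap.comp (t.1.comp a.symm.toLinearMap))) +
    Pi.single (i + 1) (Pi.single (i + 1 + 1) (b'.toLinearMap.comp (t.2.comp b.symm.toLinearMap)))
  have hS₁ : ∀ t, S t i (i + 1) = a'.toLinearMap.comp (t.1.comp a.symm.toLinearMap) := fun t => by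
    simp only [S, Pi.add_apply, Pi.single_eq_same]
    rw [Pi.single_eq_of_ne (add_one_ne i).symm, Pi.zero_apply, add_zero]
  have hS₂ : ∀ t, S t (i + 1) (i + 1 + 1) =
      b'.toLinearMap.comp (t.2.comp b.symm.toLinearMap) := fun t => by
    simp only [S, Pi.add_apply, Pi.single_eq_same]
    rw [Pi.single_eq_of_ne (add_one_ne i), Pi.zero_apply, zero_add]
  have hs : ∀ t n n', n + 1 ≠ n' → S t n n' = 0 := fun t n n' hn => by
    simp only [S, Pi.add_apply]
    by_cases hi : n = i
    · subst hi
      rw [Pi.single_eq_same, Pi.single_eq_of_ne hn.symm, Pi.single_eq_of_ne (add_one_ne n).symm,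
        Pi.zero_apply, add_zero]
    · by_cases hj : n = i + 1
      · subst hj
        rw [Pi.single_eq_same, Pi.single_eq_of_ne hn.symm, Pi.single_eq_of_ne (add_one_ne i),
          Pi.zero_apply, add_zero]
      · rw [Pi.single_eq_of_ne hi, Pi.single_eq_of_ne hj, Pi.zero_apply, add_zero]
  have hc : ∀ t, (∀ x, f' (t.1 x) + t.2 (f x) = 0) → S t ∈ twist M N := fun t ht => by
    refine ⟨hs t, fun n n' l x => ?_⟩
    by_cases hn : n + 1 = n'
    · subst hn
      by_cases hl : n + 1 + 1 = l
      · subst hl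
        by_cases hi : n = i
        · subst hi
          obtain ⟨x, rfl⟩ := a.surjective x
          rw [hS₁, hS₂, hab]
          simp [hab', ← map_add, ht]
        · rw [h.dif_eq_zero hi, map_zero, add_zero]
          exact h'.dif_eq_zero (fun h => hi (add_right_cancel h)) _
      · rw [dif_shape N hl, hs t _ _ hl, LinearMap.zero_apply, LinearMap.zero_apply, add_zero]
    · rw [hs t _ _ hn, dif_shape M hn, LinearMap.zero_apply, LinearMap.zero_apply, map_zero,
        map_zero, add_zero]
  refine ⟨
    { toFun := fun θ => ⟨(a'.symm.toLinearMap.comp ((θ.1 i (i + 1)).comp a.toLinearMap),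
        b'.symm.toLinearMap.comp ((θ.1 (i + 1) (i + 1 + 1)).comp b.toLinearMap)), fun x => ?_⟩
      invFun := fun t => ⟨S t.1, hc t.1 t.2⟩
      left_inv := fun θ => ?_
      right_inv := fun t => ?_ }, fun θ => ⟨fun x => by simp, fun x => by simp⟩⟩
  · apply b'.injective
    have := twist_cond θ i (i + 1) (i + 1 + 1) (a x)
    rw [hab] at this
    simpa [← hab'] using this
  · refine Subtype.ext (funext fun n => funext fun n' => LinearMap.ext fun x => ?_)
    dsimp only
    by_cases hn : n + 1 = n'
    · subst hn
      by_cases hi : n = i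
      · subst hi
        rw [hS₁]
        simp
      · by_cases hj : n = i + 1
        · subst hj
          rw [hS₂]
          simp
        · have := h.subsingleton n hi hj
          rw [Subsingleton.elim x 0, map_zero, map_zero]
    · rw [hs _ _ _ hn, twist_shape θ hn]
  · refine Subtype.ext (Prod.ext ?_ ?_)
    · dsimp only
      rw [hS₁]
      ext x
      simp
    · dsimp only
      rw [hS₂]
      ext x
      simp

end IsTwoTerm

end

section

variable {m : ℕ} {A : Type v} [Ring A]

/-! ### Shifted cones -/

/-- The terms and the differential of `HomologicalComplex.double`, for degrees that are equal to its
two degrees only propositionally. -/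
theorem exists_equiv_double {Q P : ModuleCat.{v} A} (f : Q ⟶ P) {i j : ZMod m} (hij : i + 1 = j)
    (hne : i ≠ j) {n n' : ZMod m} (hn : n = i) (hn' : n' = j) :
    ∃ (a : Q ≃ₗ[A] (HomologicalComplex.double f (c := ComplexShape.up (ZMod m)) hij).X n)
      (b : P ≃ₗ[A] (HomologicalComplex.double f (c := ComplexShape.up (ZMod m)) hij).X n'),
      ∀ x, ((HomologicalComplex.double f (c := ComplexShape.up (ZMod m)) hij).d n n').hom (a x) =
        b (f.hom x) := by
  subst hn hn'
  refine ⟨(HomologicalComplex.doubleXIso₀ f hij).symm.toLinearEquiv,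
    (HomologicalComplex.doubleXIso₁ f hij hne).symm.toLinearEquiv, fun x => ?_⟩
  rw [HomologicalComplex.double_d f hij hne]
  change ((HomologicalComplex.doubleXIso₀ f hij).inv ≫ (HomologicalComplex.doubleXIso₀ f hij).hom ≫
    f ≫ (HomologicalComplex.doubleXIso₁ f hij hne).inv).hom x = _
  rw [Iso.inv_hom_id_assoc]
  rfl

/-- The complex `C_f[r]`. -/
noncomputable def shiftedCone (r : ZMod m) {Q P : Type v} [AddCommGroup Q] [AddCommGroup P]
    [Module A Q] [Module A P] [Module.Finite A Q] [Module.Finite A P] [hQ : Module.Projective A Q]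
    [hP : Module.Projective A P] (f : Q →ₗ[A] P) : ProjComplex m A :=
  shift m (r.cast : ℤ) (cone m (Q := FGModuleCat.of A Q) (P := FGModuleCat.of A P) hQ hP f)

/-- `C_f[r]` lives in degrees `-1 - r` and `-r`. -/
theorem isTwoTerm_shiftedCone [IsPeriod m] (r : ZMod m) {Q P : Type v} [AddCommGroup Q]
    [AddCommGroup P] [Module A Q] [Module A P] [Module.Finite A Q] [Module.Finite A P]
    [hQ : Module.Projective A Q] [hP : Module.Projective A P] (f : Q →ₗ[A] P) :
    IsTwoTerm (shiftedCone r f) (-1 - r) f := by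
  have hr : ((r.cast : ℤ) : ZMod m) = r := ZMod.intCast_zmod_cast r
  have hne : (-1 : ZMod m) ≠ 0 := fun h => add_one_ne (-1 : ZMod m) (by
    rw [h, zero_add, ← neg_neg (1 : ZMod m), h, neg_zero])
  refine ⟨fun n hn hn' => ?_, ?_⟩
  · refine (isZero_iff_subsingleton _).1 (HomologicalComplex.isZero_double_X (ModuleCat.ofHom f)
      (c := ComplexShape.up (ZMod m)) (i₀ := -1) (i₁ := 0) (by simp)
      (n + ((r.cast : ℤ) : ZMod m)) ?_ ?_)
    · rw [hr]
      exact fun h => hn (eq_sub_of_add_eq h)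
    · rw [hr]
      exact fun h => hn' (by rw [eq_neg_of_add_eq_zero_left h]; ring)
  · obtain ⟨a, b, hab⟩ := exists_equiv_double (ModuleCat.ofHom f) (i := (-1 : ZMod m)) (j := 0)
      (by simp) hne (n := -1 - r + ((r.cast : ℤ) : ZMod m))
      (n' := -1 - r + 1 + ((r.cast : ℤ) : ZMod m)) (by rw [hr]; ring) (by rw [hr]; ring)
    rcases Int.units_eq_one_or (r.cast : ℤ).negOnePow with h | h
    · refine ⟨a, b, fun x => ?_⟩
      have e : ∀ {V W : ModuleCat.{v} A} (g : V ⟶ W) (y : V),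
          ((r.cast : ℤ).negOnePow • g).hom y = g.hom y := fun g y => by rw [h, one_smul]
      exact (e _ _).trans (hab x)
    -- For odd `r` the sign of the shift is absorbed into the right term.
    · refine ⟨a, b.trans (LinearEquiv.neg A), fun x => ?_⟩
      refine Eq.trans ?_ (congrArg Neg.neg (hab x))
      have e : ∀ {V W : ModuleCat.{v} A} (g : V ⟶ W) (y : V),
          ((r.cast : ℤ).negOnePow • g).hom y = - g.hom y := fun g y => by
        rw [h, Units.neg_smul, one_smul]
        rfl
      exact e _ _

/-! ### Splitting the middle term of a Yoneda product -/

/-- A module is the sum of the range and the kernel of a map with projective range. Over a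
hereditary ring this applies to all maps into projectives. -/
theorem exists_split {X Y : Type v} [AddCommGroup X] [AddCommGroup Y] [Module A X] [Module A Y]
    (D : X →ₗ[A] Y) [Module.Projective A (LinearMap.range D)] :
    ∃ e : X ≃ₗ[A] (LinearMap.range D × LinearMap.ker D), (∀ x, ((e x).1 : Y) = D x) ∧
      ∀ z : LinearMap.ker D, e z = (0, z) := by
  obtain ⟨s, hs⟩ := Module.projective_lifting_property D.rangeRestrict LinearMap.id
    D.surjective_rangeRestrict
  have hs' : ∀ y, D (s y) = y := fun y => congrArg Subtype.val (LinearMap.congr_fun hs y)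
  let e : X ≃ₗ[A] (LinearMap.range D × LinearMap.ker D) :=
    LinearEquiv.ofBijective (D.rangeRestrict.prod
      ((LinearMap.id - s.comp D.rangeRestrict).codRestrict _ fun x => by
        simp [hs'])) <| by
      constructor
      · refine (injective_iff_map_eq_zero _).2 fun x hx => ?_
        have h₁ : D.rangeRestrict x = 0 := congrArg Prod.fst hx
        have h₂ : x - s (D.rangeRestrict x) = 0 := congrArg (fun t => (t.2 : X)) hx
        rw [h₁, map_zero, sub_zero] at h₂
        exact h₂
      · rintro ⟨y, z⟩
        have h₁ : D.rangeRestrict (s y + z) = y := Subtype.ext (by simp [hs'])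
        refine ⟨s y + z, Prod.ext h₁ (Subtype.ext ?_)⟩
        change s y + z - s (D.rangeRestrict (s y + z)) = z
        rw [h₁, add_sub_cancel_left]
  refine ⟨e, fun x => rfl, fun z => Prod.ext (Subtype.ext z.2) (Subtype.ext ?_)⟩
  have h₁ : D.rangeRestrict z = 0 := Subtype.ext z.2
  change z.1 - s (D.rangeRestrict z) = z
  rw [h₁, map_zero, sub_zero]

/-- The middle term of a twisting cochain between complexes in consecutive degrees is a direct sum
of two-term complexes once the middle term `Q' ⊕ P` of the complex `Q → Q' ⊕ P → P'` splits
accordingly. -/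
theorem tsum_iso_dsum_of_split [IsPeriod m] {M N M' N' : ProjComplex m A} {i : ZMod m}
    {Q P Q' P' B Z : Type v} [AddCommGroup Q] [AddCommGroup P] [Module A Q] [Module A P]
    [AddCommGroup Q'] [AddCommGroup P'] [Module A Q'] [Module A P'] [AddCommGroup B]
    [AddCommGroup Z] [Module A B] [Module A Z] {f : Q →ₗ[A] P} {f' : Q' →ₗ[A] P'}
    (h : IsTwoTerm M i f) (h' : IsTwoTerm N (i + 1) f')
    {a : Q ≃ₗ[A] M.obj.X i} {b : P ≃ₗ[A] M.obj.X (i + 1)}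
    (hab : ∀ x, dif M i (i + 1) (a x) = b (f x)) {a' : Q' ≃ₗ[A] N.obj.X (i + 1)}
    {b' : P' ≃ₗ[A] N.obj.X (i + 1 + 1)}
    (hab' : ∀ x, dif N (i + 1) (i + 1 + 1) (a' x) = b' (f' x)) (θ : twist M N) {t₁ : Q →ₗ[A] Q'}
    {t₂ : P →ₗ[A] P'} (ht₁ : ∀ x, θ.1 i (i + 1) (a x) = a' (t₁ x))
    (ht₂ : ∀ x, θ.1 (i + 1) (i + 1 + 1) (b x) = b' (t₂ x)) (e : (Q' × P) ≃ₗ[A] (B × Z))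
    {d₀ : Q →ₗ[A] Z} {d₁ : B →ₗ[A] P'} (h₀ : ∀ x, e (t₁ x, f x) = (0, d₀ x))
    (h₁ : ∀ y, d₁ (e y).1 = f' y.1 + t₂ y.2) (hM' : IsTwoTerm M' i d₀)
    (hN' : IsTwoTerm N' (i + 1) d₁) : Nonempty (tsum θ ≅ dsum M' N') := by
  obtain ⟨p, q, hpq⟩ := hM'.exists_equiv
  obtain ⟨p', q', hpq'⟩ := hN'.exists_equiv
  have sN := h'.subsingleton_pred rfl
  have sN' := hN'.subsingleton_pred rfl
  have sM := h.subsingleton_succ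
  have sM' := hM'.subsingleton_succ
  let α : (N.obj.X i × M.obj.X i) ≃ₗ[A] (N'.obj.X i × M'.obj.X i) :=
    (0 : N.obj.X i ≃ₗ[A] N'.obj.X i).prodCongr (a.symm.trans p)
  let β : (N.obj.X (i + 1) × M.obj.X (i + 1)) ≃ₗ[A] (N'.obj.X (i + 1) × M'.obj.X (i + 1)) :=
    (a'.symm.prodCongr b.symm).trans (e.trans (p'.prodCongr q))
  let γ : (N.obj.X (i + 1 + 1) × M.obj.X (i + 1 + 1)) ≃ₗ[A]
      (N'.obj.X (i + 1 + 1) × M'.obj.X (i + 1 + 1)) :=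
    (b'.symm.trans q').prodCongr (0 : M.obj.X (i + 1 + 1) ≃ₗ[A] M'.obj.X (i + 1 + 1))
  refine nonempty_iso_of_three (L := tsum θ) (L' := dsum M' N') (i := i) (fun n h₁ h₂ h₃ => ?_)
    (fun n h₁ h₂ h₃ => ?_) (fun n x => ?_) (fun n x => ?_) α β γ (fun x => ?_) fun x => ?_
  · have := h.subsingleton n h₁ h₂
    have := h'.subsingleton n h₂ h₃
    exact inferInstanceAs (Subsingleton (N.obj.X n × M.obj.X n))
  · have := hM'.subsingleton n h₁ h₂
    have := hN'.subsingleton n h₂ h₃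
    exact inferInstanceAs (Subsingleton (N'.obj.X n × M'.obj.X n))
  · refine (dif_tsum θ _ n x).trans ?_
    rw [Subsingleton.elim x.2 0, h'.dif_eq_zero (add_one_ne _), map_zero, map_zero, add_zero]
    rfl
  · refine (dif_dsum _ n x).trans ?_
    rw [Subsingleton.elim x.2 0, hN'.dif_eq_zero (add_one_ne _), map_zero]
    rfl
  · obtain ⟨y, x⟩ := x
    obtain ⟨x, rfl⟩ := a.surjective x
    obtain rfl : y = 0 := Subsingleton.elim _ _
    refine (dif_dsum i (i + 1) (0, p (a.symm (a x)))).trans ?_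
    change (dif N' i (i + 1) 0, dif M' i (i + 1) (p (a.symm (a x)))) = _
    refine Eq.trans ?_ (congrArg β (dif_tsum θ i (i + 1) (0, a x)).symm)
    change _ = (p' (e (a'.symm (dif N i (i + 1) 0 + θ.1 i (i + 1) (a x)),
      b.symm (dif M i (i + 1) (a x)))).1, q (e (a'.symm (dif N i (i + 1) 0 + θ.1 i (i + 1) (a x)),
      b.symm (dif M i (i + 1) (a x)))).2)
    rw [map_zero, map_zero, zero_add, ht₁, hab, LinearEquiv.symm_apply_apply, LinearEquiv.symm_apply_apply,
      LinearEquiv.symm_apply_apply, h₀, hpq]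
    simp
  · obtain ⟨y, x⟩ := x
    obtain ⟨x, rfl⟩ := b.surjective x
    obtain ⟨y, rfl⟩ := a'.surjective y
    have hβ : β (a' y, b x) = (p' (e (y, x)).1, q (e (y, x)).2) := by
      simp [β]
    refine (congrArg (dif (dsum M' N') (i + 1) (i + 1 + 1)) hβ).trans ?_
    refine (dif_dsum (i + 1) (i + 1 + 1) (p' (e (y, x)).1, q (e (y, x)).2)).trans ?_
    refine Eq.trans ?_ (congrArg γ (dif_tsum θ (i + 1) (i + 1 + 1) (a' y, b x)).symm)
    refine Prod.ext ?_ (Subsingleton.elim _ _)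
    change dif N' (i + 1) (i + 1 + 1) (p' (e (y, x)).1) =
      q' (b'.symm (dif N (i + 1) (i + 1 + 1) (a' y) + θ.1 (i + 1) (i + 1 + 1) (b x)))
    rw [hpq', h₁, hab', ht₂, ← map_add, LinearEquiv.symm_apply_apply]

/-! ### Resolutions of kernels and cokernels -/

section

variable {Ω P M Ω' P' N : Type v} [AddCommGroup Ω] [AddCommGroup P] [AddCommGroup M]
  [AddCommGroup Ω'] [AddCommGroup P'] [AddCommGroup N] [Module A Ω] [Module A P] [Module A M]
  [Module A Ω'] [Module A P'] [Module A N] {δ : Ω →ₗ[A] P} {ε : P →ₗ[A] M} {δ' : Ω' →ₗ[A] P'}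
  {ε' : P' →ₗ[A] N}

/-- The map `Ω → ker (Ω' ⊕ P → P')` given by an anticommutative square. -/
def toKer (δ : Ω →ₗ[A] P) (δ' : Ω' →ₗ[A] P') (t₁ : Ω →ₗ[A] Ω') (t₂ : P →ₗ[A] P')
    (ht : ∀ x, δ' (t₁ x) + t₂ (δ x) = 0) : Ω →ₗ[A] LinearMap.ker (δ'.coprod t₂) :=
  (t₁.prod δ).codRestrict _ ht

/-- If an anticommutative square lifts `φ : M → N`, then the kernel of `Ω' ⊕ P → P'`, with the map
from `Ω`, resolves the kernel of `φ`. -/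
theorem exists_isRes_ker (h : IsRes δ ε) (h' : IsRes δ' ε') {t₁ : Ω →ₗ[A] Ω'} {t₂ : P →ₗ[A] P'}
    (ht : ∀ x, δ' (t₁ x) + t₂ (δ x) = 0) {φ : M →ₗ[A] N} (hφ : ∀ x, φ (ε x) = ε' (t₂ x)) :
    ∃ η : LinearMap.ker (δ'.coprod t₂) →ₗ[A] LinearMap.ker φ, IsRes (toKer δ δ' t₁ t₂ ht) η := by
  have hε' : ∀ x, ε' (δ' x) = 0 := fun x => (h'.exact _).2 ⟨x, rfl⟩
  let η : LinearMap.ker (δ'.coprod t₂) →ₗ[A] LinearMap.ker φ :=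
    (ε.comp ((LinearMap.snd A Ω' P).comp (LinearMap.ker (δ'.coprod t₂)).subtype)).codRestrict _ <| by
      rintro ⟨⟨x, y⟩, hxy⟩
      have : δ' x + t₂ y = 0 := hxy
      change φ (ε y) = 0
      rw [hφ, eq_neg_of_add_eq_zero_right this, map_neg, hε', neg_zero]
  refine ⟨η, (injective_iff_map_eq_zero _).2 fun x hx => ?_, fun z => ⟨fun hz => ?_, ?_⟩, fun y => ?_⟩
  · have h₁ : δ x = 0 := congrArg (fun z => z.1.2) hx
    exact h.injective (by rw [h₁, map_zero])
  · obtain ⟨⟨x, y⟩, hxy⟩ := z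
    have hz' : ε y = 0 := congrArg Subtype.val hz
    have hxy' : δ' x + t₂ y = 0 := hxy
    obtain ⟨w, rfl⟩ := (h.exact y).1 hz'
    refine ⟨w, Subtype.ext (Prod.ext (h'.injective ?_) rfl)⟩
    change δ' (t₁ w) = δ' x
    rw [eq_neg_of_add_eq_zero_left (ht w), eq_neg_of_add_eq_zero_left hxy']
  · rintro ⟨w, rfl⟩
    exact Subtype.ext ((h.exact _).2 ⟨w, rfl⟩)
  · obtain ⟨y, hy⟩ := y
    obtain ⟨p, rfl⟩ := h.surjective y
    have hp : ε' (t₂ p) = 0 := by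
      rw [← hφ]
      exact hy
    obtain ⟨x, hx⟩ := (h'.exact _).1 hp
    exact ⟨⟨(-x, p), by
      change δ' (-x) + t₂ p = 0
      rw [map_neg, hx, neg_add_cancel]⟩, rfl⟩

/-- If `t₂ : P → P'` lifts `φ : M → N`, then the range of `Ω' ⊕ P → P'` and `P'` resolve the
cokernel of `φ`. -/
theorem isRes_coker (h : IsRes δ ε) (h' : IsRes δ' ε') {t₂ : P →ₗ[A] P'} {φ : M →ₗ[A] N}
    (hφ : ∀ x, φ (ε x) = ε' (t₂ x)) :
    IsRes (LinearMap.range (δ'.coprod t₂)).subtype ((LinearMap.range φ).mkQ.comp ε') := by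
  have hε' : ∀ x, ε' (δ' x) = 0 := fun x => (h'.exact _).2 ⟨x, rfl⟩
  refine ⟨Subtype.val_injective, fun p => ⟨fun hp => ?_, ?_⟩,
    (Submodule.mkQ_surjective _).comp h'.surjective⟩
  · obtain ⟨y, hy⟩ := (Submodule.Quotient.mk_eq_zero _).1 hp
    obtain ⟨y, rfl⟩ := h.surjective y
    obtain ⟨x, hx⟩ := (h'.exact (p - t₂ y)).1 (by rw [map_sub, ← hφ, hy, sub_self])
    exact ⟨⟨p, (x, y), by rw [LinearMap.coprod_apply, hx, sub_add_cancel]⟩, rfl⟩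
  · rintro ⟨⟨_, ⟨x, y⟩, rfl⟩, rfl⟩
    refine (Submodule.Quotient.mk_eq_zero _).2 ⟨ε y, ?_⟩
    change φ (ε y) = ε' (δ' x + t₂ y)
    rw [hφ, map_add, hε', zero_add]

end

end

/-! ### Products with classes of contractible two-term complexes -/

section

variable (k : Type u) [Field k] [Finite k] {m : ℕ} {A : Type v} [Ring A] [Algebra k A]
  [Module.Finite k A] [IsHereditaryRing A]

/-- If all cochains are coboundaries, then `splitCoeff M N` is determined by the number of morphisms
`M → N`. -/
theorem splitCoeff_mul_card_ker {M N : ProjComplex m A}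
    (h : ∀ θ : twist M N, θ ∈ (coboundary M N).range) :
    splitCoeff k M N * Nat.card (coboundary M N).ker = vv k ^ complexEuler k m M N := by
  have e : Nat.card (twist M N) = Nat.card (coboundary M N).range :=
    Nat.card_congr (Equiv.subtypeUnivEquiv h).symm
  have e' := card_eq_card_ker_mul_card_range (coboundary M N)
  have e'' := card_pi_hom k M N
  rw [e'] at e''
  push_cast at e''
  rw [splitCoeff, e, mul_assoc, mul_comm (Nat.card _ : ℂ), e'', ← zpow_add₀ (vv_ne_zero k)]
  congr 1
  ring

variable {i : ZMod m} {Q P : Type v} [AddCommGroup Q] [AddCommGroup P] [Module A Q] [Module A P]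
  [Module.Finite A Q] [Module.Finite A P] {f : Q →ₗ[A] P}

variable {M N : ProjComplex m A}

variable [IsPeriod m]

theorem IsTwoTerm.complexEuler_left (h : IsTwoTerm M i f) (N : ProjComplex m A) :
    complexEuler k m M N = eulerForm k A (mcl A Q) (tcl N i) +
      eulerForm k A (mcl A P) (tcl N (i + 1)) := by
  classical
  rw [complexEuler_eq_sum k M N {i, i + 1} fun n hn => by
    simp only [Finset.mem_insert, Finset.mem_singleton, not_or] at hn
    exact Or.inl (h.tcl_eq_zero hn.1 hn.2), Finset.sum_pair (add_one_ne i).symm, h.tcl_left,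
    h.tcl_right]

theorem IsTwoTerm.complexEuler_right (h : IsTwoTerm M i f) (N : ProjComplex m A) :
    complexEuler k m N M = eulerForm k A (tcl N i) (mcl A Q) +
      eulerForm k A (tcl N (i + 1)) (mcl A P) := by
  classical
  rw [complexEuler_eq_sum k N M {i, i + 1} fun n hn => by
    simp only [Finset.mem_insert, Finset.mem_singleton, not_or] at hn
    exact Or.inr (h.tcl_eq_zero hn.1 hn.2), Finset.sum_pair (add_one_ne i).symm, h.tcl_left,
    h.tcl_right]

/-- The number of morphisms out of a contractible two-term complex, and so the scalar, only depends
on the classes of two terms of `N`. -/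
theorem IsTwoTerm.splitCoeff_left [Module.Projective A P] (h : IsTwoTerm M i f) (hf : Function.Bijective f)
    (N : ProjComplex m A) :
    splitCoeff k M N = vv k ^ eulerForm k A (mcl A P) (tcl N (i + 1) - tcl N i) := by
  have : Module.Projective A Q := Module.Projective.of_equiv (LinearEquiv.ofBijective f hf).symm
  have h₁ := splitCoeff_mul_card_ker k (M := M) (N := N) (twist_acyclic_left (h.acyclic hf))
  rw [h.card_ker_from hf, card_hom_of_projective k, h.complexEuler_left k,
    mcl_congr (LinearEquiv.ofBijective f hf)] at h₁
  rw [← mul_left_inj' (zpow_ne_zero _ (vv_ne_zero k)), h₁, ← zpow_add₀ (vv_ne_zero k)]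
  congr 1
  rw [map_sub, tcl]
  ring

theorem IsTwoTerm.splitCoeff_right (h : IsTwoTerm M i f) (hf : Function.Bijective f)
    (N : ProjComplex m A) :
    splitCoeff k N M = vv k ^ eulerForm k A (tcl N i - tcl N (i + 1)) (mcl A P) := by
  have h₁ := splitCoeff_mul_card_ker k (M := N) (N := M) (twist_acyclic_right (h.acyclic hf))
  rw [h.card_ker_to hf, card_hom_of_projective k, h.complexEuler_right k,
    mcl_congr (LinearEquiv.ofBijective f hf)] at h₁
  rw [← mul_left_inj' (zpow_ne_zero _ (vv_ne_zero k)), h₁, ← zpow_add₀ (vv_ne_zero k)]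
  congr 1
  rw [map_sub, AddMonoidHom.sub_apply, tcl, tcl]
  ring

end

/-! ### The elements `K_{α,r}` -/

theorem position_succ {m : ℕ} (r : ZMod m) : (-1 - (r + 1) : ZMod m) + 1 = -1 - r := by ring

theorem isTwoTerm_shiftedCone_succ {m : ℕ} [IsPeriod m] {A : Type v} [Ring A] (r : ZMod m)
    {Q P : Type v} [AddCommGroup Q] [AddCommGroup P] [Module A Q] [Module A P] [Module.Finite A Q]
    [Module.Finite A P] [Module.Projective A Q] [Module.Projective A P] (f : Q →ₗ[A] P) :
    ∃ i, i + 1 = -1 - r ∧ IsTwoTerm (shiftedCone (r + 1) f) i f :=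
  ⟨_, position_succ r, isTwoTerm_shiftedCone (r + 1) f⟩

section

theorem vv_zpow_mul (k : Type u) [Field k] [Finite k] (a b : ℤ) :
    vv k ^ a * vv k ^ b = vv k ^ (a + b) :=
  (zpow_add₀ (vv_ne_zero k) a b).symm

variable (k : Type u) [Field k] {m : ℕ} {A : Type v} [Ring A] [Algebra k A]

namespace DH

/-- The canonical map to `DH_m(A)` as a linear map. -/
noncomputable def ofLinear : HallRing k m A →ₗ[ℂ] DH k m A where
  toFun x := of k m x
  map_add' x y := (RingQuot.mkAlgHom_rel ℂ (LocRel.add x y)).trans (map_add _ _ _)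
  map_smul' c x := (RingQuot.mkAlgHom_rel ℂ (LocRel.smul c x)).trans (map_smul _ _ _)

variable {k}

theorem ofLinear_hcl (M : ProjComplex m A) : ofLinear k (hcl k M) = cls k m M := rfl

theorem cls_congr [Finite k] {M N : ProjComplex m A} (h : Nonempty (M ≅ N)) : cls k m M = cls k m N := by
  rw [← ofLinear_hcl, hcl_congr k h, ofLinear_hcl]

/-- Classes of acyclic complexes are invertible by construction of the localization. -/
theorem isUnit_cls {K : ProjComplex m A} (hK : K.obj.Acyclic) : IsUnit (cls k m K) := by
  refine ⟨⟨cls k m K, RingQuot.mkAlgHom ℂ (LocRel k m A)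
    (FreeAlgebra.ι ℂ (Sum.inr ⟨K, hK⟩)), ?_, ?_⟩, rfl⟩
  · rw [cls, of, ← map_mul, ← map_one (RingQuot.mkAlgHom ℂ (LocRel k m A))]
    exact RingQuot.mkAlgHom_rel ℂ (LocRel.mul_inv ⟨K, hK⟩)
  · rw [cls, of, ← map_mul, ← map_one (RingQuot.mkAlgHom ℂ (LocRel k m A))]
    exact RingQuot.mkAlgHom_rel ℂ (LocRel.inv_mul ⟨K, hK⟩)

theorem ofLinear_mul [Finite A] (x y : HallRing k m A) :
    ofLinear k (x * y) = ofLinear k x * ofLinear k y := by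
  have : x * y = hallMul k m x y := (HallRing.mul_def k x y).trans (hallBilin_apply k m A x y)
  rw [this]
  exact (RingQuot.mkAlgHom_rel ℂ (LocRel.mul x y)).trans (map_mul _ _ _)

variable [Finite k] [Module.Finite k A] [IsHereditaryRing A]

theorem cls_mul_cls [Finite A] (M N : ProjComplex m A) :
    cls k m M * cls k m N = vv k ^ (-complexEuler k m M N) • ∑ θ : twist M N, cls k m (tsum θ) := by
  rw [← ofLinear_hcl, ← ofLinear_hcl, ← ofLinear_mul, hcl_mul_hcl, map_smul, map_sum]
  rfl

theorem cls_mul_of_split {M N : ProjComplex m A} (h : ∀ θ : twist M N, θ ∈ (coboundary M N).range) :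
    cls k m M * cls k m N = splitCoeff k M N • cls k m (dsum M N) := by
  have : Finite A := Module.finite_of_finite k
  rw [← ofLinear_hcl, ← ofLinear_hcl, ← ofLinear_mul, hcl_mul_of_split k h, map_smul]
  rfl

theorem cls_acyclic_mul {K : ProjComplex m A} (hK : K.obj.Acyclic) (M : ProjComplex m A) :
    cls k m K * cls k m M = splitCoeff k K M • cls k m (dsum M K) := by
  rw [cls_mul_of_split (twist_acyclic_left hK), cls_congr (dsum_comm K M)]

theorem cls_mul_acyclic {K : ProjComplex m A} (hK : K.obj.Acyclic) (M : ProjComplex m A) :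
    cls k m M * cls k m K = splitCoeff k M K • cls k m (dsum M K) :=
  cls_mul_of_split (twist_acyclic_right hK)

end DH

end

section

variable {k : Type u} [Field k] [Finite k] {m : ℕ} {A : Type v} [Ring A] [Algebra k A]
  [Module.Finite k A] [IsHereditaryRing A]

/-- The elements `x` with `K_{α,r} * x = v^(α, β) x * K_{α,r}` for all `α`. -/
def HasWeight (r : ZMod m) (x : DH k m A) (β : GrothendieckGroup A) : Prop :=
  ∀ α, DH.K k m r α * x = vv k ^ symEulerForm k A α β • (x * DH.K k m r α)

theorem symEulerForm_add_left (α β γ : GrothendieckGroup A) :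
    symEulerForm k A (α + β) γ = symEulerForm k A α γ + symEulerForm k A β γ := by
  simp only [symEulerForm, map_add, AddMonoidHom.add_apply]
  ring

theorem symEulerForm_neg_left (α γ : GrothendieckGroup A) :
    symEulerForm k A (-α) γ = -symEulerForm k A α γ := by
  simp only [symEulerForm, map_neg, AddMonoidHom.neg_apply]
  ring

theorem symEulerForm_comm (α β : GrothendieckGroup A) :
    symEulerForm k A α β = symEulerForm k A β α :=
  add_comm _ _

theorem symEulerForm_add_right (α β γ : GrothendieckGroup A) :
    symEulerForm k A γ (α + β) = symEulerForm k A γ α + symEulerForm k A γ β := by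
  rw [symEulerForm_comm, symEulerForm_add_left, symEulerForm_comm α, symEulerForm_comm β]

theorem symEulerForm_neg_right (α γ : GrothendieckGroup A) :
    symEulerForm k A γ (-α) = -symEulerForm k A γ α := by
  rw [symEulerForm_comm, symEulerForm_neg_left, symEulerForm_comm α]

theorem symEulerForm_zero_right (γ : GrothendieckGroup A) : symEulerForm k A γ 0 = 0 := by
  simp [symEulerForm]

namespace HasWeight

variable {r : ZMod m} {x y : DH k m A} {β γ : GrothendieckGroup A}

theorem mul (hx : HasWeight r x β) (hy : HasWeight r y γ) : HasWeight r (x * y) (β + γ) :=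
  fun α => by
    rw [← mul_assoc, hx α, smul_mul_assoc, mul_assoc, hy α, mul_smul_comm, smul_smul,
      vv_zpow_mul, symEulerForm_add_right, mul_assoc]

theorem smul (hx : HasWeight r x β) (c : ℂ) : HasWeight r (c • x) β := fun α => by
  rw [mul_smul_comm, hx α, smul_mul_assoc, smul_comm]

theorem mul_K (hx : HasWeight r x β) (α : GrothendieckGroup A) :
    x * DH.K k m r α = vv k ^ (-symEulerForm k A α β) • (DH.K k m r α * x) := by
  rw [hx α, smul_smul, vv_zpow_mul, neg_add_cancel, zpow_zero, one_smul]

end HasWeight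

end

section

variable (k : Type u) [Field k] {m : ℕ} {A : Type v} [Ring A] [Algebra k A]

/-- The class `[C_f[r]]` in `DH_m(A)`. -/
noncomputable def coneCls (r : ZMod m) {Q P : Type v} [AddCommGroup Q] [AddCommGroup P]
    [Module A Q] [Module A P] [Module.Finite A Q] [Module.Finite A P] [Module.Projective A Q]
    [Module.Projective A P] (f : Q →ₗ[A] P) : DH k m A :=
  DH.cls k m (shiftedCone r f)

/-- The class `[K_P[r]]` in `DH_m(A)`. -/
noncomputable def diskCls (r : ZMod m) (P : Type v) [AddCommGroup P] [Module A P]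
    [Module.Finite A P] [Module.Projective A P] : DH k m A :=
  coneCls k r (LinearMap.id : P →ₗ[A] P)

variable [IsPeriod m]

variable (m) in
theorem isUnit_diskCls (r : ZMod m) (P : Type v) [AddCommGroup P] [Module A P]
    [Module.Finite A P] [Module.Projective A P] : IsUnit (diskCls k r P : DH k m A) :=
  DH.isUnit_cls ((isTwoTerm_shiftedCone r _).acyclic Function.bijective_id)

variable [Finite k]

theorem IsTwoTerm.cls_eq {L : ProjComplex m A} {r : ZMod m} {Q P : Type v} [AddCommGroup Q]
    [AddCommGroup P] [Module A Q] [Module A P] [Module.Finite A Q] [Module.Finite A P]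
    [Module.Projective A Q] [Module.Projective A P] {f : Q →ₗ[A] P}
    (h : IsTwoTerm L (-1 - r) f) : DH.cls k m L = coneCls k r f :=
  DH.cls_congr (h.nonempty_iso (isTwoTerm_shiftedCone r f) (LinearEquiv.refl A Q)
    (LinearEquiv.refl A P) fun _ => rfl)

theorem coneCls_congr (r : ZMod m) {Q P Q' P' : Type v} [AddCommGroup Q] [AddCommGroup P]
    [Module A Q] [Module A P] [Module.Finite A Q] [Module.Finite A P] [Module.Projective A Q]
    [Module.Projective A P] [AddCommGroup Q'] [AddCommGroup P']
    [Module A Q'] [Module A P'] [Module.Finite A Q'] [Module.Finite A P'] [Module.Projective A Q']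
    [Module.Projective A P'] {f : Q →ₗ[A] P} {f' : Q' →ₗ[A] P'} (α : Q ≃ₗ[A] Q') (β : P ≃ₗ[A] P')
    (h : ∀ x, f' (α x) = β (f x)) : coneCls k r f = coneCls k r f' :=
  DH.cls_congr ((isTwoTerm_shiftedCone r f).nonempty_iso (isTwoTerm_shiftedCone r f') α β h)

theorem diskCls_congr (r : ZMod m) {P P' : Type v} [AddCommGroup P]
    [Module A P] [Module.Finite A P] [Module.Projective A P] [AddCommGroup P']
    [Module A P'] [Module.Finite A P'] [Module.Projective A P'] (e : P ≃ₗ[A] P') :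
    diskCls k r P = (diskCls k r P' : DH k m A) :=
  coneCls_congr k r e e fun _ => rfl

variable [Module.Finite k A] [IsHereditaryRing A]

section

variable (r : ZMod m) (P : Type v) [AddCommGroup P] [Module A P]
  [Module.Finite A P] [Module.Projective A P]

theorem diskCls_mul_cls (M : ProjComplex m A) : diskCls k r P * DH.cls k m M =
    vv k ^ eulerForm k A (mcl A P) (tcl M (-1 - r + 1) - tcl M (-1 - r)) •
      DH.cls k m (dsum M (shiftedCone r (LinearMap.id : P →ₗ[A] P))) := by
  have h := isTwoTerm_shiftedCone r (LinearMap.id : P →ₗ[A] P)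
  rw [diskCls, coneCls, DH.cls_acyclic_mul (h.acyclic Function.bijective_id),
    h.splitCoeff_left k Function.bijective_id]

theorem cls_mul_diskCls (M : ProjComplex m A) : DH.cls k m M * diskCls k r P =
    vv k ^ eulerForm k A (tcl M (-1 - r) - tcl M (-1 - r + 1)) (mcl A P) •
      DH.cls k m (dsum M (shiftedCone r (LinearMap.id : P →ₗ[A] P))) := by
  have h := isTwoTerm_shiftedCone r (LinearMap.id : P →ₗ[A] P)
  rw [diskCls, coneCls, DH.cls_mul_acyclic (h.acyclic Function.bijective_id),
    h.splitCoeff_right k Function.bijective_id]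

theorem diskCls_mul_cls_eq (M : ProjComplex m A) : diskCls k r P * DH.cls k m M =
    vv k ^ symEulerForm k A (mcl A P) (tcl M (-1 - r + 1) - tcl M (-1 - r)) •
      (DH.cls k m M * diskCls k r P) := by
  rw [diskCls_mul_cls, cls_mul_diskCls, smul_smul, vv_zpow_mul, symEulerForm]
  congr 2
  simp only [map_sub, AddMonoidHom.sub_apply]
  ring

theorem diskCls_mul_coneCls {Q P' : Type v} [AddCommGroup Q] [AddCommGroup P'] [Module A Q]
    [Module A P'] [Module.Finite A Q] [Module.Finite A P'] [Module.Projective A Q]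
    [Module.Projective A P'] (f : Q →ₗ[A] P') : diskCls k r P * coneCls k r f =
    (vv k ^ eulerForm k A (mcl A P) (mcl A P' - mcl A Q) •
      coneCls k r (f.prodMap (LinearMap.id : P →ₗ[A] P)) : DH k m A) := by
  have h := isTwoTerm_shiftedCone r f
  have h' := isTwoTerm_shiftedCone r (LinearMap.id : P →ₗ[A] P)
  rw [coneCls, diskCls_mul_cls, h.tcl_left, h.tcl_right, (h.dsum h').cls_eq k]
  rw [coneCls_congr k r (f := (LinearMap.id : P →ₗ[A] P).prodMap f)
    (f' := f.prodMap (LinearMap.id : P →ₗ[A] P)) (LinearEquiv.prodComm A P Q)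
    (LinearEquiv.prodComm A P P') fun _ => rfl]

theorem diskCls_prod (P' : Type v) [AddCommGroup P'] [Module A P']
    [Module.Finite A P'] [Module.Projective A P'] :
    (diskCls k r (P × P') : DH k m A) = diskCls k r P * diskCls k r P' := by
  have h := diskCls_mul_coneCls k r P (LinearMap.id : P' →ₗ[A] P') (m := m)
  rw [sub_self, map_zero, zpow_zero, one_smul] at h
  refine Eq.trans ?_ h.symm
  exact coneCls_congr k r (LinearEquiv.prodComm A P P') (LinearEquiv.prodComm A P P') fun _ => rfl

theorem diskCls_mul_comm (P' : Type v) [AddCommGroup P'] [Module A P']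
    [Module.Finite A P'] [Module.Projective A P'] :
    (diskCls k r P * diskCls k r P' : DH k m A) = diskCls k r P' * diskCls k r P := by
  rw [← diskCls_prod, ← diskCls_prod, diskCls_congr k r (LinearEquiv.prodComm A P P')]

end

variable (m A) in
/-- The map `P̂ ↦ [K_P[r]]` extends to a homomorphism from `K(A)` to the units. -/
theorem exists_unit_hom (r : ZMod m) : ∃ φ : Multiplicative (GrothendieckGroup A) →* (DH k m A)ˣ,
    ∀ (P : FGModuleCat.{v} A) (_ : Module.Projective A P),
      (φ (Multiplicative.ofAdd (cl P)) : DH k m A) = diskCls k r P := by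
  classical
  let S : Set (DH k m A)ˣ := {x | ∃ (P : FGModuleCat.{v} A) (_ : Module.Projective A P),
    (x : DH k m A) = diskCls k r P}
  have hS : ∀ x ∈ S, ∀ y ∈ S, x * y = y * x := by
    rintro x ⟨P, hP, hx⟩ y ⟨Q, hQ, hy⟩
    apply Units.ext
    rw [Units.val_mul, Units.val_mul, hx, hy, diskCls_mul_comm]
  -- Functions on `K(A)` are only constructed with values in commutative groups; the classes
  -- `[K_P[r]]` commute with each other, and so do all elements of the subgroup they generate.
  have := Subgroup.isMulCommutative_closure hS
  let : CommGroup (Subgroup.closure S) :=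
    { (inferInstance : Group (Subgroup.closure S)) with mul_comm := this.is_comm.comm }
  let u : FGModuleCat.{v} A → Additive (Subgroup.closure S) := fun P =>
    if hP : Module.Projective A P then
      Additive.ofMul ⟨(isUnit_diskCls k m r P).unit, Subgroup.subset_closure ⟨P, hP, rfl⟩⟩ else 0
  have hu : ∀ (P : FGModuleCat.{v} A) (hP : Module.Projective A P), u P =
      Additive.ofMul ⟨(isUnit_diskCls k m r P).unit, Subgroup.subset_closure ⟨P, hP, rfl⟩⟩ :=
    fun P hP => dif_pos hP
  obtain ⟨φ, hφ⟩ := exists_lift_of_projective k u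
    (fun P Q hP hQ ⟨e⟩ => by
      rw [hu P hP, hu Q hQ]
      exact congrArg Additive.ofMul (Subtype.ext (Units.ext (diskCls_congr k r e))))
    (fun P Q hP hQ => by
      have hPQ : Module.Projective A (FGModuleCat.of A (P × Q)) :=
        inferInstanceAs (Module.Projective A (P × Q))
      rw [hu P hP, hu Q hQ, hu _ hPQ]
      exact congrArg Additive.ofMul (Subtype.ext (Units.ext (diskCls_prod k r P Q))))
  refine ⟨(Subgroup.closure S).subtype.comp (AddMonoidHom.toMultiplicativeLeft φ), fun P hP => ?_⟩
  change ((φ (cl P)).toMul.1 : DH k m A) = _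
  rw [hφ P hP, hu P hP]
  rfl

variable {k}

variable (m A) in
/-- `α ↦ K_{α,r}` is a homomorphism from `K(A)` to the units of `DH_m(A)`. -/
theorem exists_K_hom (r : ZMod m) : ∃ φ : Multiplicative (GrothendieckGroup A) →* (DH k m A)ˣ,
    (∀ α, (φ (Multiplicative.ofAdd α) : DH k m A) = DH.K k m r α) ∧
    ∀ (P : FGModuleCat.{v} A) (_ : Module.Projective A P),
      (φ (Multiplicative.ofAdd (cl P)) : DH k m A) = diskCls k r P := by
  obtain ⟨φ, hφ⟩ := exists_unit_hom k m A r
  refine ⟨φ, fun α => ?_, hφ⟩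
  let h := exists_projective_sub k α
  have hP := h.choose_spec.1
  have hQ := h.choose_spec.2.1
  have e : DH.K k m r α = diskCls k r h.choose.1 * Ring.inverse (diskCls k r h.choose.2) := rfl
  rw [e, ← hφ _ hP, ← hφ _ hQ, Ring.inverse_unit, ← Units.val_mul, ← map_inv, ← map_mul]
  congr 2
  have := h.choose_spec.2.2
  rw [← ofAdd_neg, ← ofAdd_add, ← sub_eq_add_neg, ← this]

theorem K_add (r : ZMod m) (α β : GrothendieckGroup A) :
    DH.K k m r (α + β) = DH.K k m r α * DH.K k m r β := by
  obtain ⟨φ, hφ, -⟩ := exists_K_hom (k := k) m A r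
  rw [← hφ, ← hφ, ← hφ, ofAdd_add, map_mul, Units.val_mul]

theorem K_zero (r : ZMod m) : DH.K k m r (0 : GrothendieckGroup A) = 1 := by
  obtain ⟨φ, hφ, -⟩ := exists_K_hom (k := k) m A r
  rw [← hφ, ofAdd_zero, map_one, Units.val_one]

theorem K_mcl (r : ZMod m) (P : Type v) [AddCommGroup P] [Module A P]
    [Module.Finite A P] [hP : Module.Projective A P] :
    DH.K k m r (mcl A P) = diskCls k r P := by
  obtain ⟨φ, hφ, hφ'⟩ := exists_K_hom (k := k) m A r
  rw [← hφ]
  exact hφ' (FGModuleCat.of A P) hP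

theorem K_neg_mul (r : ZMod m) (α : GrothendieckGroup A) (x : DH k m A) :
    DH.K k m r (-α) * (DH.K k m r α * x) = x := by
  rw [← mul_assoc, ← K_add, neg_add_cancel, K_zero, one_mul]

theorem K_mul_neg (r : ZMod m) (α : GrothendieckGroup A) (x : DH k m A) :
    DH.K k m r α * (DH.K k m r (-α) * x) = x := by
  rw [← mul_assoc, ← K_add, add_neg_cancel, K_zero, one_mul]

namespace HasWeight

variable {r : ZMod m} {x : DH k m A} {β γ : GrothendieckGroup A}

/-- It suffices to consider the classes `α = P̂` with `P` projective. -/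
theorem of_disk (h : ∀ (P : FGModuleCat.{v} A) (_ : Module.Projective A P),
    diskCls k r P * x = vv k ^ symEulerForm k A (mcl A P) β • (x * diskCls k r P)) :
    HasWeight r x β := by
  intro α
  obtain ⟨⟨P, Q⟩, hP, hQ, rfl⟩ := exists_projective_sub k α
  dsimp only at hP hQ ⊢
  have h₁ : DH.K k m r (cl P) * x =
      vv k ^ symEulerForm k A (cl P) β • (x * DH.K k m r (cl P)) := by
    have e : DH.K k m r (cl P) = diskCls k r P := K_mcl r P
    rw [e]
    exact h P hP
  have h₂ : DH.K k m r (cl Q) * x =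
      vv k ^ symEulerForm k A (cl Q) β • (x * DH.K k m r (cl Q)) := by
    have e : DH.K k m r (cl Q) = diskCls k r Q := K_mcl r Q
    rw [e]
    exact h Q hQ
  have h₃ : DH.K k m r (-cl Q) * x =
      vv k ^ symEulerForm k A (-cl Q) β • (x * DH.K k m r (-cl Q)) := by
    have h₄ : x = vv k ^ symEulerForm k A (cl Q) β •
        (DH.K k m r (-cl Q) * x * DH.K k m r (cl Q)) := by
      rw [mul_assoc, ← mul_smul_comm, ← h₂, K_neg_mul]
    nth_rewrite 2 [h₄]
    rw [smul_mul_assoc, mul_assoc _ (DH.K k m r (cl Q)), ← K_add, add_neg_cancel, K_zero, mul_one,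
      smul_smul, vv_zpow_mul, symEulerForm_neg_left, neg_add_cancel, zpow_zero, one_smul]
  rw [sub_eq_add_neg, K_add, mul_assoc, h₃, mul_smul_comm, ← mul_assoc, h₁, smul_mul_assoc,
    mul_assoc, smul_smul, vv_zpow_mul, symEulerForm_add_left, add_comm (symEulerForm k A (cl P) β)]

end HasWeight

/-- The commutation of `K_{α,r}` with the class of a complex depends on the classes of its terms in
the two degrees where `K_P[r]` lives. -/
theorem hasWeight_cls (r : ZMod m) (M : ProjComplex m A) :
    HasWeight r (DH.cls k m M) (tcl M (-1 - r + 1) - tcl M (-1 - r)) :=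
  HasWeight.of_disk fun P _ => diskCls_mul_cls_eq k r P M

/-- The weight of `K_{α,s}` is linear in `α`, so it is determined by the classes of projectives. -/
theorem hasWeight_of_K {r s : ZMod m} {ε : GrothendieckGroup A →+ GrothendieckGroup A}
    (h : ∀ (P : FGModuleCat.{v} A) (_ : Module.Projective A P),
      HasWeight r (diskCls k s P) (ε (mcl A P))) (α : GrothendieckGroup A) :
    HasWeight r (DH.K k m s α) (ε α) := by
  obtain ⟨⟨P, Q⟩, hP, hQ, rfl⟩ := exists_projective_sub k α
  dsimp only at hP hQ ⊢
  have h₁ : HasWeight r (DH.K k m s (cl P)) (ε (cl P)) := by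
    have e : DH.K k m s (cl P) = diskCls k s P := K_mcl s P
    rw [e]
    exact h P hP
  have h₂ : HasWeight r (DH.K k m s (cl Q)) (ε (cl Q)) := by
    have e : DH.K k m s (cl Q) = diskCls k s Q := K_mcl s Q
    rw [e]
    exact h Q hQ
  have h₃ : HasWeight r (DH.K k m s (-cl Q)) (-ε (cl Q)) := fun γ => by
    have e : DH.K k m s (cl Q) * (DH.K k m r γ * DH.K k m s (-cl Q)) =
        vv k ^ symEulerForm k A γ (-ε (cl Q)) • DH.K k m r γ := by
      rw [← mul_assoc, h₂.mul_K, smul_mul_assoc, mul_assoc, ← K_add, add_neg_cancel, K_zero, mul_one,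
        symEulerForm_neg_right]
    rw [← K_neg_mul s (cl Q) (DH.K k m r γ * DH.K k m s (-cl Q)), e, mul_smul_comm]
  rw [sub_eq_add_neg, K_add, map_add, map_neg]
  exact h₁.mul h₃

theorem hasWeight_K_self (r : ZMod m) (α : GrothendieckGroup A) :
    HasWeight r (DH.K k m r α) 0 := fun γ => by
  rw [← K_add, add_comm, K_add, symEulerForm_zero_right, zpow_zero, one_smul]

section

variable (r : ZMod m) {Q P : Type v} [AddCommGroup Q] [AddCommGroup P] [Module A Q]
  [Module A P] [Module.Finite A Q] [Module.Finite A P] [Module.Projective A Q]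
  [Module.Projective A P] (f : Q →ₗ[A] P)

theorem hasWeight_coneCls : HasWeight r (coneCls k r f) (mcl A P - mcl A Q) := by
  have h := isTwoTerm_shiftedCone r f
  rw [← h.tcl_left, ← h.tcl_right]
  exact hasWeight_cls r _

theorem hasWeight_coneCls_succ : HasWeight r (coneCls k (r + 1) f) (-mcl A P) := by
  obtain ⟨i, hi, h⟩ := isTwoTerm_shiftedCone_succ r f
  have e := hasWeight_cls (k := k) r (shiftedCone (r + 1) f)
  rw [← hi, h.tcl_right, h.tcl_eq_zero (add_one_add_one_ne i) (add_one_ne _), zero_sub] at e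
  exact e

theorem hasWeight_succ_coneCls : HasWeight (r + 1) (coneCls k r f) (mcl A Q) := by
  have h := isTwoTerm_shiftedCone r f
  have e := hasWeight_cls (k := k) (r + 1) (shiftedCone r f)
  have hr : (-1 - (r + 1) : ZMod m) = -1 - r - 1 := by ring
  rw [position_succ, h.tcl_left, hr, h.tcl_eq_zero (fun h => add_one_ne (-1 - r - 1)
    (by rw [sub_add_cancel, h])) (fun h => add_one_add_one_ne (-1 - r - 1)
    (by rw [sub_add_cancel, h])), sub_zero] at e
  exact e

end

theorem hasWeight_K_succ (r : ZMod m) (α : GrothendieckGroup A) :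
    HasWeight r (DH.K k m (r + 1) α) (-α) :=
  hasWeight_of_K (ε := -AddMonoidHom.id _)
    (fun P _ => hasWeight_coneCls_succ r (LinearMap.id : P →ₗ[A] P)) α

theorem hasWeight_succ_K (r : ZMod m) (α : GrothendieckGroup A) :
    HasWeight (r + 1) (DH.K k m r α) α :=
  hasWeight_of_K (ε := AddMonoidHom.id _)
    (fun P _ => hasWeight_succ_coneCls r (LinearMap.id : P →ₗ[A] P)) α

end

/-! ### The elements `a_M e_{M,r}` -/

theorem IsRes.mcl_eq {A : Type v} [Ring A] {Ω P M : Type v} [AddCommGroup Ω] [AddCommGroup P]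
    [AddCommGroup M] [Module A Ω] [Module A P] [Module A M] [Module.Finite A Ω] [Module.Finite A P]
    [Module.Finite A M] {δ : Ω →ₗ[A] P} {ε : P →ₗ[A] M} (h : IsRes δ ε) :
    mcl A P = mcl A Ω + mcl A M :=
  mcl_exact δ ε h.injective h.exact h.surjective

section

variable {k : Type u} [Field k] [Finite k] {m : ℕ} {A : Type v} [Ring A] [Algebra k A]
  [Module.Finite k A] [IsHereditaryRing A]

section

variable {Ω P M : Type v} [AddCommGroup Ω] [AddCommGroup P] [AddCommGroup M]
    [Module A Ω] [Module A P] [Module A M] [Module.Finite A Ω] [Module.Finite A P]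
    [Module.Projective A Ω] [Module.Projective A P]

variable (k) in
/-- The element `v^⟨Ω, M⟩ K_{-Ω,r} * [C_δ[r]]` for a resolution `0 → Ω → P → M → 0`. -/
noncomputable def resElt (r : ZMod m) (δ : Ω →ₗ[A] P) : DH k m A :=
  vv k ^ eulerForm k A (mcl A Ω) (mcl A P - mcl A Ω) •
    (DH.K k m r (-mcl A Ω) * coneCls k r δ)

variable (k) in
/-- The element `a_M e_{M,r}`. -/
noncomputable def ringelElt (r : ZMod m) (M : Type v) [AddCommGroup M] [Module A M]
    [Module.Finite A M] : DH k m A :=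
  let ρ := minimalResolution k (FGModuleCat.of A M)
  have := ρ.projective_Ω
  have := ρ.projective_P
  resElt k r ρ.δ

theorem e_eq_smul_ringelElt (r : ZMod m) (M : FGModuleCat.{v} A) :
    DH.e k m r M = (autCard M : ℂ)⁻¹ • ringelElt k r M := by
  let ρ := minimalResolution k M
  have := ρ.projective_Ω
  have := ρ.projective_P
  have h : cl M = mcl A ρ.P - mcl A ρ.Ω := ρ.cl_eq_sub
  change ((autCard M : ℂ)⁻¹ * vv k ^ eulerForm k A (cl ρ.Ω) (cl M)) •
    (DH.K k m r (-mcl A ρ.Ω) * coneCls k r ρ.δ) = (autCard M : ℂ)⁻¹ • resElt k r ρ.δ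
  rw [resElt, smul_smul, h]
  rfl

variable [IsPeriod m]

/-- The element does not change if the contractible complex `K_{P'}[r]` is added to `C_δ[r]`: its
class is absorbed by the factor `K_{-Ω,r}`. -/
theorem resElt_prodMap (r : ZMod m) (δ : Ω →ₗ[A] P) (P' : Type v) [AddCommGroup P'] [Module A P']
    [Module.Finite A P'] [Module.Projective A P'] :
    resElt k r (δ.prodMap (LinearMap.id : P' →ₗ[A] P')) = resElt k r δ := by
  have h := diskCls_mul_coneCls k r P' δ
  have h' : coneCls k r (δ.prodMap (LinearMap.id : P' →ₗ[A] P')) =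
      vv k ^ (-eulerForm k A (mcl A P') (mcl A P - mcl A Ω)) •
        (DH.K k m r (mcl A P') * coneCls k r δ) := by
    rw [K_mcl, h, smul_smul, vv_zpow_mul, neg_add_cancel, zpow_zero, one_smul]
  rw [resElt, resElt, h', mul_smul_comm, smul_smul, vv_zpow_mul, ← mul_assoc, ← K_add]
  simp only [mcl_prod]
  congr 2
  · simp only [map_add, map_sub, AddMonoidHom.add_apply]
    ring
  · congr 2
    abel

theorem resElt_congr (r : ZMod m) {Ω' P' : Type v} [AddCommGroup Ω'] [AddCommGroup P']
    [Module A Ω'] [Module A P'] [Module.Finite A Ω'] [Module.Finite A P'] [Module.Projective A Ω']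
    [Module.Projective A P'] {δ : Ω →ₗ[A] P} {δ' : Ω' →ₗ[A] P'} (α : Ω ≃ₗ[A] Ω') (β : P ≃ₗ[A] P')
    (h : ∀ x, δ' (α x) = β (δ x)) : resElt k r δ = (resElt k r δ' : DH k m A) := by
  rw [resElt, resElt, coneCls_congr k r α β h, mcl_congr α, mcl_congr β]

/-- By Schanuel's lemma, two resolutions of the same module become isomorphic after adding
contractible complexes. -/
theorem resElt_eq_of_isRes (r : ZMod m) {Ω' P' : Type v} [AddCommGroup Ω'] [AddCommGroup P']
    [Module A Ω'] [Module A P'] [Module.Finite A Ω'] [Module.Finite A P'] [Module.Projective A Ω']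
    [Module.Projective A P'] {δ : Ω →ₗ[A] P} {ε : P →ₗ[A] M} {δ' : Ω' →ₗ[A] P'} {ε' : P' →ₗ[A] M}
    (h : IsRes δ ε) (h' : IsRes δ' ε') : resElt k r δ = (resElt k r δ' : DH k m A) := by
  obtain ⟨α, β, hαβ⟩ := schanuel h h'
  rw [← resElt_prodMap r δ P', ← resElt_prodMap r δ' P]
  exact resElt_congr r α β hαβ

variable [Module.Finite A M]

theorem resElt_eq (r : ZMod m) {δ : Ω →ₗ[A] P} {ε : P →ₗ[A] M} (h : IsRes δ ε) :
    resElt k r δ = (ringelElt k r M : DH k m A) := by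
  let ρ := minimalResolution k (FGModuleCat.of A M)
  have := ρ.projective_Ω
  have := ρ.projective_P
  exact resElt_eq_of_isRes r h ρ.isRes

theorem coneCls_eq (r : ZMod m) {δ : Ω →ₗ[A] P} {ε : P →ₗ[A] M} (h : IsRes δ ε) :
    coneCls k r δ = (vv k ^ (-eulerForm k A (mcl A Ω) (mcl A M)) •
      (DH.K k m r (mcl A Ω) * ringelElt k r M) : DH k m A) := by
  rw [← resElt_eq r h, resElt, mul_smul_comm, K_mul_neg, smul_smul, vv_zpow_mul, h.mcl_eq,
    add_sub_cancel_left, neg_add_cancel, zpow_zero, one_smul]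

theorem ringelElt_congr (r : ZMod m) {M' : Type v} [AddCommGroup M'] [Module A M']
    [Module.Finite A M'] (e : M ≃ₗ[A] M') :
    ringelElt k r M = (ringelElt k r M' : DH k m A) := by
  let ρ := minimalResolution k (FGModuleCat.of A M)
  have := ρ.projective_Ω
  have := ρ.projective_P
  exact resElt_eq r (ρ.isRes.comp_equiv e)

end

theorem exists_isRes (k : Type u) [Field k] [Finite k] (A : Type v) [Ring A] [Algebra k A]
    [Module.Finite k A] [IsHereditaryRing A] (M : Type v) [AddCommGroup M] [Module A M]
    [Module.Finite A M] : ∃ (Ω P : FGModuleCat.{v} A) (_ : Module.Projective A Ω)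
      (_ : Module.Projective A P) (δ : Ω →ₗ[A] P) (ε : P →ₗ[A] M), IsRes δ ε :=
  let ρ := minimalResolution k (FGModuleCat.of A M)
  ⟨ρ.Ω, ρ.P, ρ.projective_Ω, ρ.projective_P, ρ.δ, ρ.ε, ρ.isRes⟩

variable [IsPeriod m]

section

variable (M : Type v) [AddCommGroup M] [Module A M] [Module.Finite A M]

theorem hasWeight_ringelElt (r : ZMod m) : HasWeight r (ringelElt k r M : DH k m A) (mcl A M) := by
  obtain ⟨Ω, P, hΩ, hP, δ, ε, h⟩ := exists_isRes k A M
  rw [← resElt_eq r h, resElt]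
  have e := (hasWeight_K_self r (-mcl A Ω)).mul (hasWeight_coneCls (k := k) r δ)
  rw [h.mcl_eq, add_sub_cancel_left, zero_add] at e
  exact e.smul _

theorem hasWeight_ringelElt_succ (r : ZMod m) :
    HasWeight r (ringelElt k (r + 1) M : DH k m A) (-mcl A M) := by
  obtain ⟨Ω, P, hΩ, hP, δ, ε, h⟩ := exists_isRes k A M
  rw [← resElt_eq (r + 1) h, resElt]
  have e := (hasWeight_K_succ r (-mcl A Ω)).mul (hasWeight_coneCls_succ (k := k) r δ)
  have e' : - -mcl A Ω + -mcl A P = -mcl A M := by rw [h.mcl_eq]; abel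
  rw [e'] at e
  exact e.smul _

theorem hasWeight_succ_ringelElt (r : ZMod m) : HasWeight (r + 1) (ringelElt k r M : DH k m A) 0 := by
  obtain ⟨Ω, P, hΩ, hP, δ, ε, h⟩ := exists_isRes k A M
  rw [← resElt_eq r h, resElt]
  have e := (hasWeight_succ_K r (-mcl A Ω)).mul (hasWeight_succ_coneCls (k := k) r δ)
  rw [neg_add_cancel] at e
  exact e.smul _

end

theorem finite_linearMap (k : Type u) [Field k] [Finite k] (A : Type v) [Ring A] [Algebra k A]
    [Module.Finite k A] (V W : Type v) [AddCommGroup V] [AddCommGroup W] [Module A V] [Module A W]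
    [Module.Finite A V] [Module.Finite A W] : Finite (V →ₗ[A] W) := by
  have : Finite A := Module.finite_of_finite k
  have : Finite V := Module.finite_of_finite A
  have : Finite W := Module.finite_of_finite A
  exact Finite.of_injective (fun f : V →ₗ[A] W => (f : V → W)) DFunLike.coe_injective

/-! ### Isomorphism classes of modules -/

theorem isoClass_eq_iff {A : Type v} [Ring A] {M N : FGModuleCat.{v} A} :
    isoClass M = isoClass N ↔ Nonempty (M ≃ₗ[A] N) := by
  rw [isoClass, isoClass, Quotient.eq]
  exact ⟨fun ⟨φ⟩ => ⟨FGModuleCat.isoToLinearEquiv φ⟩, fun ⟨e⟩ => ⟨e.toFGModuleCatIso⟩⟩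

theorem isoClass_eq_iff_out {A : Type v} [Ring A] {M : FGModuleCat.{v} A} {L : IsoClass A} :
    isoClass M = L ↔ Nonempty (M ≃ₗ[A] L.out) := by
  rw [← isoClass_eq_iff]
  exact ⟨fun h => h.trans (Quotient.out_eq L).symm, fun h => h.trans (Quotient.out_eq L)⟩

theorem out_equiv {A : Type v} [Ring A] (M : FGModuleCat.{v} A) :
    Nonempty (M ≃ₗ[A] (isoClass M).out) := isoClass_eq_iff_out.1 rfl

/-! ### The product of two elements in the same degree -/

section

variable {Ω P Ω' P' M N : Type v} [AddCommGroup Ω] [AddCommGroup P] [AddCommGroup M]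
    [AddCommGroup Ω'] [AddCommGroup P'] [AddCommGroup N]
    [Module A Ω] [Module A P] [Module A M] [Module A Ω'] [Module A P'] [Module A N]
    [Module.Finite A Ω] [Module.Finite A P] [Module.Finite A M] [Module.Projective A Ω]
    [Module.Projective A P] [Module.Finite A Ω'] [Module.Finite A P'] [Module.Finite A N]
    [Module.Projective A Ω'] [Module.Projective A P']

/-- Twisting cochains between `C_δ[r]` and `C_{δ'}[r]` are maps from `Ω` to `P'`. -/
theorem coneCls_mul_coneCls [Fintype (Ω →ₗ[A] P')] (r : ZMod m) (δ : Ω →ₗ[A] P)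
    (δ' : Ω' →ₗ[A] P') : (coneCls k r δ * coneCls k r δ' : DH k m A) =
    vv k ^ (-(eulerForm k A (mcl A Ω) (mcl A Ω') + eulerForm k A (mcl A P) (mcl A P'))) •
      ∑ θ : Ω →ₗ[A] P', coneCls k r (blockMap δ' θ δ) := by
  have : Finite A := Module.finite_of_finite k
  have h := isTwoTerm_shiftedCone r δ
  have h' := isTwoTerm_shiftedCone r δ'
  obtain ⟨E, hE⟩ := h.exists_twistEquiv h'
  rw [coneCls, coneCls, DH.cls_mul_cls, h.complexEuler_left k, h'.tcl_left, h'.tcl_right]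
  congr 1
  exact Fintype.sum_equiv E _ _ fun θ => (hE θ).cls_eq k

/-- The elements `a_M e_{M,r}` multiply as in the Ringel–Hall algebra. -/
theorem ringelElt_mul_ringelElt (r : ZMod m) (M N : FGModuleCat.{v} A) :
    ((ringelElt k r M : DH k m A) * ringelElt k r N : DH k m A) =
      vv k ^ eulerForm k A (cl M) (cl N) • ∑ᶠ L : IsoClass A,
        ((extCard M.obj N.obj L.out.obj : ℂ) / (Nat.card (M.obj ⟶ N.obj) : ℂ)) •
          ringelElt k r L.out := by
  obtain ⟨Ω, P, hΩ, hP, δ, ε, h⟩ := exists_isRes k A M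
  obtain ⟨Ω', P', hΩ', hP', δ', ε', h'⟩ := exists_isRes k A N
  have f₁ := finite_linearMap k A Ω P'
  have f₂ := finite_linearMap k A Ω N
  let _ : Fintype (Ω →ₗ[A] P') := Fintype.ofFinite _
  let _ : Fintype (Ω →ₗ[A] N) := Fintype.ofFinite _
  -- The middle terms are resolutions of pushouts.
  have hterm : ∀ θ : Ω →ₗ[A] P', coneCls k r (blockMap δ' θ δ) =
      (vv k ^ (-eulerForm k A (mcl A Ω' + mcl A Ω) (mcl A N + mcl A M)) •
        (DH.K k m r (mcl A Ω' + mcl A Ω) * ringelElt k r (Push δ (ε'.comp θ))) : DH k m A) :=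
    fun θ => by
      have hp := isRes_push h (ε'.comp θ)
      rw [coneCls_eq r (isRes_blockMap h h' θ), hp.mcl_eq, mcl_prod]
  -- Summing over all lifts of a map `Ω → N` to `P'`.
  have hsum₁ : ∑ θ : Ω →ₗ[A] P', (ringelElt k r (Push δ (ε'.comp θ)) : DH k m A) =
      vv k ^ (2 * eulerForm k A (mcl A Ω) (mcl A Ω')) •
        ∑ ψ : Ω →ₗ[A] N, ringelElt k r (Push δ ψ) := by
    let F : (Ω →ₗ[A] P') →+ (Ω →ₗ[A] N) :=
      { toFun := fun θ => ε'.comp θ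
        map_zero' := LinearMap.comp_zero _
        map_add' := fun _ _ => LinearMap.comp_add _ _ _ }
    have hF : Function.Surjective F := fun ψ =>
      Module.projective_lifting_property ε' ψ h'.surjective
    have hk : Nat.card F.ker = Nat.card (Ω →ₗ[A] Ω') := by
      symm
      refine Nat.card_congr (Equiv.ofBijective (fun s => ⟨δ'.comp s, ?_⟩) ⟨fun s t hst => ?_, ?_⟩)
      · exact AddMonoidHom.mem_ker.2 (LinearMap.ext fun x => (h'.exact _).2 ⟨s x, rfl⟩)
      · exact LinearMap.ext fun x =>
          h'.injective (LinearMap.congr_fun (congrArg Subtype.val hst) x)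
      · rintro ⟨θ, hθ⟩
        have hr : ∀ x, θ x ∈ LinearMap.range δ' := fun x =>
          (h'.exact _).1 (LinearMap.congr_fun (AddMonoidHom.mem_ker.1 hθ) x)
        refine ⟨(LinearEquiv.ofInjective δ' h'.injective).symm.toLinearMap.comp
          (θ.codRestrict _ hr), Subtype.ext (LinearMap.ext fun x => ?_)⟩
        exact congrArg Subtype.val
          ((LinearEquiv.ofInjective δ' h'.injective).apply_symm_apply ⟨θ x, hr x⟩)
    refine sum_comp_of_card_fiber (fun θ => F θ) _ (fun ψ => ?_) fun ψ => ringelElt k r (Push δ ψ)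
    rw [card_fiber_addMonoidHom F hF, hk, card_hom_of_projective k]
  have hsum₂ : ∑ ψ : Ω →ₗ[A] N, (ringelElt k r (Push δ ψ) : DH k m A) =
      vv k ^ (2 * eulerForm k A (mcl A P) (cl N)) • ∑ᶠ L : IsoClass A,
        ((extCard M.obj N.obj L.out.obj : ℂ) / (Nat.card (M.obj ⟶ N.obj) : ℂ)) •
          ringelElt k r L.out := by
    have e : ∀ ψ : Ω →ₗ[A] N, (ringelElt k r (Push δ ψ) : DH k m A) =
        ringelElt k r (isoClass (FGModuleCat.of A (Push δ ψ))).out := fun ψ =>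
      ringelElt_congr r (out_equiv (FGModuleCat.of A (Push δ ψ))).some
    rw [Finset.sum_congr rfl fun ψ _ => e ψ, sum_comp_eq_finsum
      (fun ψ : Ω →ₗ[A] N => isoClass (FGModuleCat.of A (Push δ ψ)))
      (fun L => (ringelElt k r L.out : DH k m A)), smul_finsum]
    refine finsum_congr fun L => ?_
    rw [smul_smul]
    congr 1
    refine Eq.trans ?_ (card_push_iso_eq k (N := N) h L.out.obj)
    congr 1
    refine Nat.card_congr (Equiv.subtypeEquivRight fun ψ => isoClass_eq_iff_out.trans ?_)
    exact ⟨fun ⟨e⟩ => ⟨e.toModuleIso⟩, fun ⟨φ⟩ => ⟨φ.toLinearEquiv⟩⟩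
  -- It remains to collect the factors `K` on the left; they cancel.
  have hw := (hasWeight_coneCls (k := k) r δ).mul_K (-mcl A Ω')
  rw [← resElt_eq r h, ← resElt_eq r h', resElt, resElt, smul_mul_assoc, mul_smul_comm, smul_smul,
    mul_assoc, ← mul_assoc (coneCls k r δ), hw, smul_mul_assoc, mul_smul_comm, smul_smul,
    mul_assoc (DH.K k m r (-mcl A Ω')), coneCls_mul_coneCls, Finset.sum_congr rfl fun θ _ => hterm θ,
    ← Finset.smul_sum, ← Finset.mul_sum, hsum₁, hsum₂]
  simp only [mul_smul_comm, smul_smul, vv_zpow_mul]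
  rw [← mul_assoc (DH.K k m r (-mcl A Ω')), ← K_add, ← mul_assoc, ← K_add]
  have hz : -mcl A Ω + (-mcl A Ω' + (mcl A Ω' + mcl A Ω)) = 0 := by abel
  rw [hz, K_zero, one_mul]
  congr 2
  have hM : mcl A M = cl M := rfl
  have hN : mcl A N = cl N := rfl
  rw [h.mcl_eq, h'.mcl_eq, hM, hN, symEulerForm]
  simp only [map_add, map_neg, map_sub, AddMonoidHom.add_apply, AddMonoidHom.neg_apply,
    AddMonoidHom.sub_apply]
  ring

end

end

/-! ### The product of two elements in consecutive degrees -/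

instance projective_of_submodule {A : Type v} [Ring A] [IsHereditaryRing A] {P : Type*}
    [AddCommGroup P] [Module A P] [Module.Finite A P] [Module.Projective A P]
    (N : Submodule A P) : Module.Projective A N :=
  projective_submodule N

theorem IsRes.exists_desc {A : Type v} [Ring A] {Ω P M N : Type*} [AddCommGroup Ω]
    [AddCommGroup P] [AddCommGroup M] [AddCommGroup N] [Module A Ω] [Module A P] [Module A M]
    [Module A N] {δ : Ω →ₗ[A] P} {ε : P →ₗ[A] M} (h : IsRes δ ε) (g : P →ₗ[A] N)
    (hg : ∀ w, g (δ w) = 0) : ∃ φ : M →ₗ[A] N, ∀ x, φ (ε x) = g x := by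
  have hk : LinearMap.ker ε ≤ LinearMap.ker g := fun x hx => by
    obtain ⟨w, rfl⟩ := (h.exact x).1 hx
    exact hg w
  refine ⟨((LinearMap.ker ε).liftQ g hk).comp
    (ε.quotKerEquivOfSurjective h.surjective).symm.toLinearMap, fun x => ?_⟩
  have : (ε.quotKerEquivOfSurjective h.surjective).symm (ε x) = Submodule.Quotient.mk x := by
    rw [LinearEquiv.symm_apply_eq]
    rfl
  change (LinearMap.ker ε).liftQ g hk ((ε.quotKerEquivOfSurjective h.surjective).symm (ε x)) = g x
  rw [this]
  rfl

/-- Anticommutative squares between two maps. -/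
abbrev AntiSquare {A : Type v} [Ring A] {Ω P Ω' P' : Type v} [AddCommGroup Ω] [AddCommGroup P]
    [AddCommGroup Ω'] [AddCommGroup P'] [Module A Ω] [Module A P] [Module A Ω'] [Module A P']
    (δ : Ω →ₗ[A] P) (δ' : Ω' →ₗ[A] P') : Type v :=
  {t : (Ω →ₗ[A] Ω') × (P →ₗ[A] P') // ∀ x, δ' (t.1 x) + t.2 (δ x) = 0}

section

variable {A : Type v} [Ring A] {Ω P Ω' P' M N : Type v} [AddCommGroup Ω] [AddCommGroup P]
  [AddCommGroup M] [AddCommGroup Ω'] [AddCommGroup P'] [AddCommGroup N]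
  [Module A Ω] [Module A P] [Module A M] [Module A Ω'] [Module A P'] [Module A N]

/-- The anticommutative squares between two resolutions that induce a given map of modules are a
torsor under the homotopies `P → Ω'`. -/
theorem card_antiSquare_fiber [Module.Projective A P] {δ : Ω →ₗ[A] P} {ε : P →ₗ[A] M}
    {δ' : Ω' →ₗ[A] P'} {ε' : P' →ₗ[A] N} (h : IsRes δ ε) (h' : IsRes δ' ε') (φ : M →ₗ[A] N) :
    Nat.card {t : AntiSquare δ δ' // ∀ x, φ (ε x) = ε' (t.1.2 x)} = Nat.card (P →ₗ[A] Ω') := by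
  obtain ⟨t₂, ht₂⟩ := Module.projective_lifting_property ε' (φ.comp ε) h'.surjective
  have ht₂' : ∀ x, ε' (t₂ x) = φ (ε x) := fun x => LinearMap.congr_fun ht₂ x
  let σ := (LinearEquiv.ofInjective δ' h'.injective).symm
  have hσ : ∀ y, δ' (σ y) = y := fun y =>
    congrArg Subtype.val ((LinearEquiv.ofInjective δ' h'.injective).apply_symm_apply y)
  have hr : ∀ w, (-(t₂.comp δ)) w ∈ LinearMap.range δ' := fun w => by
    refine (h'.exact _).1 ?_
    rw [LinearMap.neg_apply, map_neg, LinearMap.comp_apply, ht₂', (h.exact _).2 ⟨w, rfl⟩, map_zero,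
      neg_zero]
  let t₁ : Ω →ₗ[A] Ω' := σ.toLinearMap.comp ((-(t₂.comp δ)).codRestrict _ hr)
  have ht₁ : ∀ w, δ' (t₁ w) = -t₂ (δ w) := fun w => hσ ⟨_, hr w⟩
  symm
  refine Nat.card_congr (Equiv.ofBijective (fun s => ⟨⟨(t₁ - s.comp δ, t₂ + δ'.comp s), ?_⟩, ?_⟩)
    ⟨fun s s' hs => LinearMap.ext fun x => h'.injective ?_, ?_⟩)
  · intro x
    simp [ht₁]
  · intro x
    have : ε' (δ' (s x)) = 0 := (h'.exact _).2 ⟨s x, rfl⟩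
    simp [ht₂', this]
  · have := LinearMap.congr_fun (congrArg (fun t => t.1.1.2) hs) x
    simpa using this
  · rintro ⟨⟨⟨t₁', t₂'⟩, ht⟩, ht'⟩
    have hr' : ∀ x, (t₂' - t₂) x ∈ LinearMap.range δ' := fun x => by
      refine (h'.exact _).1 ?_
      rw [LinearMap.sub_apply, map_sub, ht₂', ht', sub_self]
    have hs : ∀ x, δ' (σ ((t₂' - t₂).codRestrict _ hr' x)) = t₂' x - t₂ x := fun x => hσ ⟨_, hr' x⟩
    refine ⟨σ.toLinearMap.comp ((t₂' - t₂).codRestrict _ hr'), Subtype.ext (Subtype.ext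
      (Prod.ext (LinearMap.ext fun x => h'.injective ?_) (LinearMap.ext fun x => ?_)))⟩
    · change δ' (t₁ x - σ ((t₂' - t₂).codRestrict _ hr' (δ x))) = δ' (t₁' x)
      rw [map_sub, hs, ht₁, eq_neg_of_add_eq_zero_left (ht x)]
      abel
    · change t₂ x + δ' (σ ((t₂' - t₂).codRestrict _ hr' x)) = t₂' x
      rw [hs, add_sub_cancel]

end

section

variable {k : Type u} [Field k] [Finite k] {m : ℕ} {A : Type v} [Ring A] [Algebra k A]
  [Module.Finite k A] [IsHereditaryRing A] [IsPeriod m]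

variable {Ω P Ω' P' M N : Type v} [AddCommGroup Ω] [AddCommGroup P]
  [AddCommGroup Ω'] [AddCommGroup P']
  [Module A Ω] [Module A P] [Module A Ω'] [Module A P']
  [Module.Finite A Ω] [Module.Finite A P] [Module.Projective A Ω]
  [Module.Projective A P] [Module.Finite A Ω'] [Module.Finite A P']
  [Module.Projective A Ω'] [Module.Projective A P']

/-- There are no nonzero twisting cochains here, not even for `m = 3`, where the two complexes also
meet in the degrees at the other end. -/
theorem coneCls_mul_coneCls_succ (r : ZMod m) {δ : Ω →ₗ[A] P} (hδ : Function.Injective δ)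
    (δ' : Ω' →ₗ[A] P') : (coneCls k r δ' * coneCls k (r + 1) δ : DH k m A) =
    vv k ^ (-eulerForm k A (mcl A Ω') (mcl A P)) •
      DH.cls k m (dsum (shiftedCone (r + 1) δ) (shiftedCone r δ')) := by
  obtain ⟨i, hi, h⟩ := isTwoTerm_shiftedCone_succ r δ
  have h' := isTwoTerm_shiftedCone r δ'
  rw [← hi] at h'
  have h0 := h.twist_eq_zero hδ h'
  have : Unique (twist (shiftedCone r δ') (shiftedCone (r + 1) δ)) := ⟨⟨0⟩, h0⟩
  rw [coneCls, coneCls, DH.cls_mul_of_split fun θ => by rw [h0 θ]; exact zero_mem _, splitCoeff,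
    Nat.card_unique, Nat.cast_one, mul_one, h.complexEuler_right k, h'.tcl_left,
    h'.tcl_eq_zero (add_one_ne i).symm (add_one_add_one_ne i).symm, map_zero,
    AddMonoidHom.zero_apply, zero_add, DH.cls_congr (dsum_comm _ _)]

set_option maxHeartbeats 1000000 in
/-- The middle terms are three-term complexes `Ω → Ω' ⊕ P → P'`, which split into a complex with the
range and one with the kernel of the second map. The direct sum is rewritten as a product in the
order without extensions. -/
theorem coneCls_succ_mul_coneCls [Finite A] (r : ZMod m) {δ : Ω →ₗ[A] P}
    (hδ : Function.Injective δ) (δ' : Ω' →ₗ[A] P') [Fintype (AntiSquare δ δ')] :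
    (coneCls k (r + 1) δ * coneCls k r δ' : DH k m A) =
      vv k ^ (-eulerForm k A (mcl A P) (mcl A Ω')) • ∑ t : AntiSquare δ δ',
        vv k ^ eulerForm k A (mcl A (LinearMap.range (δ'.coprod t.1.2)))
            (mcl A (LinearMap.ker (δ'.coprod t.1.2))) •
          (coneCls k r (LinearMap.range (δ'.coprod t.1.2)).subtype *
            coneCls k (r + 1) (toKer δ δ' t.1.1 t.1.2 t.2)) := by
  obtain ⟨i, hi, h⟩ := isTwoTerm_shiftedCone_succ r δ
  have h' := isTwoTerm_shiftedCone r δ'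
  rw [← hi] at h'
  obtain ⟨a, b, hab⟩ := h.exists_equiv
  obtain ⟨a', b', hab'⟩ := h'.exists_equiv
  obtain ⟨E, hE⟩ := h.exists_twistEquiv_succ h' a b hab a' b' hab'
  rw [coneCls, coneCls, DH.cls_mul_cls, h.complexEuler_left k, h'.tcl_left,
    h'.tcl_eq_zero (add_one_ne i).symm (add_one_add_one_ne i).symm, map_zero, zero_add]
  congr 1
  refine Fintype.sum_equiv E _ _ fun θ => ?_
  obtain ⟨e, he₁, he₂⟩ := exists_split (δ'.coprod (E θ).1.2)
  have hinj : Function.Injective (toKer δ δ' (E θ).1.1 (E θ).1.2 (E θ).2) := fun x y hxy =>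
    hδ (congrArg (fun z => z.1.2) hxy)
  obtain ⟨i', hi', hM'⟩ := isTwoTerm_shiftedCone_succ r (toKer δ δ' (E θ).1.1 (E θ).1.2 (E θ).2)
  obtain rfl : i' = i := add_right_cancel (hi'.trans hi.symm)
  have hN' := isTwoTerm_shiftedCone r (LinearMap.range (δ'.coprod (E θ).1.2)).subtype
  rw [← hi] at hN'
  rw [DH.cls_congr (tsum_iso_dsum_of_split h h' hab hab' θ (hE θ).1 (hE θ).2 e
    (fun x => he₂ (toKer δ δ' (E θ).1.1 (E θ).1.2 (E θ).2 x)) (fun y => he₁ y) hM' hN'),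
    coneCls_mul_coneCls_succ r hinj, smul_smul, vv_zpow_mul, add_neg_cancel, zpow_zero, one_smul]

end

section

variable {k : Type u} [Field k] [Finite k] {m : ℕ} {A : Type v} [Ring A] [Algebra k A]
  [Module.Finite k A] [IsHereditaryRing A] [IsPeriod m]

/-- The contribution of one anticommutative square to the product. -/
theorem antiSquare_term [Finite A] {Ω P Ω' P' M N : Type v} [AddCommGroup Ω] [AddCommGroup P]
    [AddCommGroup M] [AddCommGroup Ω'] [AddCommGroup P'] [AddCommGroup N]
    [Module A Ω] [Module A P] [Module A M] [Module A Ω'] [Module A P'] [Module A N]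
    [Module.Finite A Ω] [Module.Finite A P] [Module.Finite A M] [Module.Projective A Ω]
    [Module.Projective A P] [Module.Finite A Ω'] [Module.Finite A P'] [Module.Finite A N]
    [Module.Projective A Ω'] [Module.Projective A P'] (r : ZMod m) {δ : Ω →ₗ[A] P}
    {ε : P →ₗ[A] M} {δ' : Ω' →ₗ[A] P'} {ε' : P' →ₗ[A] N} (h : IsRes δ ε) (h' : IsRes δ' ε')
    (t : AntiSquare δ δ') {φ : M →ₗ[A] N} (hφ : ∀ x, φ (ε x) = ε' (t.1.2 x)) :
    vv k ^ (eulerForm k A (mcl A Ω) (mcl A M) + eulerForm k A (mcl A Ω') (mcl A N) -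
        symEulerForm k A (mcl A Ω') (mcl A P) + eulerForm k A (mcl A P) (mcl A Ω')) •
      (DH.K k m (r + 1) (-mcl A Ω) * (DH.K k m r (-mcl A Ω') *
        (vv k ^ eulerForm k A (mcl A (LinearMap.range (δ'.coprod t.1.2)))
            (mcl A (LinearMap.ker (δ'.coprod t.1.2))) •
          (coneCls k r (LinearMap.range (δ'.coprod t.1.2)).subtype *
            coneCls k (r + 1) (toKer δ δ' t.1.1 t.1.2 t.2))))) =
      vv k ^ eulerForm k A (mcl A M - mcl A (LinearMap.ker φ))
          (mcl A (LinearMap.ker φ) - mcl A (N ⧸ LinearMap.range φ)) •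
        (DH.K k m r (mcl A M - mcl A (LinearMap.ker φ)) * ringelElt k r (N ⧸ LinearMap.range φ) *
          ringelElt k (r + 1) (LinearMap.ker φ)) := by
  obtain ⟨η, hη⟩ := exists_isRes_ker h h' t.2 hφ
  have hc := isRes_coker h h' hφ
  have eM : mcl A M = mcl A (LinearMap.ker φ) + mcl A (LinearMap.range φ) :=
    mcl_exact (LinearMap.ker φ).subtype φ.rangeRestrict Subtype.val_injective
      (fun x => ⟨fun hx => ⟨⟨x, congrArg Subtype.val hx⟩, rfl⟩, by
        rintro ⟨y, rfl⟩
        exact Subtype.ext y.2⟩) φ.surjective_rangeRestrict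
  have eN : mcl A N = mcl A (LinearMap.range φ) + mcl A (N ⧸ LinearMap.range φ) :=
    mcl_exact (LinearMap.range φ).subtype (LinearMap.range φ).mkQ Subtype.val_injective
      (fun x => ⟨fun hx => ⟨⟨x, (Submodule.Quotient.mk_eq_zero _).1 hx⟩, rfl⟩, by
        rintro ⟨y, rfl⟩
        exact (Submodule.Quotient.mk_eq_zero _).2 y.2⟩) (Submodule.mkQ_surjective _)
  have eP := h.mcl_eq
  have eP' := h'.mcl_eq
  have eZ := hη.mcl_eq
  have eB := hc.mcl_eq
  rw [coneCls_eq r hc, coneCls_eq (r + 1) hη]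
  generalize mcl A (LinearMap.range (δ'.coprod t.1.2)) = B at *
  generalize mcl A (LinearMap.ker (δ'.coprod t.1.2)) = Z at *
  generalize hY : (ringelElt k r (N ⧸ LinearMap.range φ) : DH k m A) = RY
  generalize hX : (ringelElt k (r + 1) (LinearMap.ker φ) : DH k m A) = RX
  generalize mcl A (LinearMap.range φ) = γ at *
  have hw : HasWeight (r + 1) (DH.K k m r γ * RY) (γ + 0) := by
    rw [← hY]
    exact (hasWeight_succ_K r γ).mul (hasWeight_succ_ringelElt _ r)
  have eB' : B = γ + mcl A Ω' := by
    refine add_right_cancel (b := mcl A (N ⧸ LinearMap.range φ)) ?_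
    rw [← eB, eP', eN]
    abel
  have eK : DH.K k m r (-mcl A Ω') * (DH.K k m r B * RY) = DH.K k m r γ * RY := by
    rw [← mul_assoc, ← K_add, eB', neg_add_cancel_comm_assoc]
  have e : DH.K k m (r + 1) (-mcl A Ω) * (DH.K k m r (-mcl A Ω') * (DH.K k m r B * RY *
      (DH.K k m (r + 1) (mcl A Ω) * RX))) =
      vv k ^ symEulerForm k A (-mcl A Ω) (γ + 0) • (DH.K k m r γ * RY * RX) := by
    rw [← mul_assoc (DH.K k m r (-mcl A Ω')), eK, ← mul_assoc (DH.K k m (r + 1) (-mcl A Ω)), hw,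
      smul_mul_assoc, mul_assoc _ (DH.K k m (r + 1) (-mcl A Ω)), K_neg_mul]
  simp only [mul_smul_comm, smul_mul_assoc, smul_smul]
  rw [e, smul_smul]
  simp only [vv_zpow_mul]
  rw [eM, add_sub_cancel_left]
  congr 2
  rw [eB', eZ, eP, eM, eN, symEulerForm, symEulerForm]
  simp only [map_add, map_neg, map_sub, AddMonoidHom.add_apply, AddMonoidHom.neg_apply, map_zero,
    AddMonoidHom.zero_apply]
  ring

end

/-! ### Counting maps by kernel and cokernel -/

section

variable {A : Type v} [Ring A]

/-- The maps `M → N` with kernel isomorphic to `X` and cokernel isomorphic to `Y`. -/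
abbrev HomWith (M N X Y : FGModuleCat.{v} A) : Type v :=
  {φ : M →ₗ[A] N // Nonempty (LinearMap.ker φ ≃ₗ[A] X) ∧ Nonempty ((N ⧸ LinearMap.range φ) ≃ₗ[A] Y)}

/-- An exact sequence `0 → X → M → N → Y → 0` is a map `M → N` with an identification of `X` with
its kernel and of `Y` with its cokernel. -/
theorem card_exactTriples (M N X Y : FGModuleCat.{v} A) : Nat.card (exactTriples M N X Y) =
    Nat.card (HomWith M N X Y) * autCard X * autCard Y := by
  rw [autCard, autCard, mul_assoc, ← Nat.card_prod, ← Nat.card_prod]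
  have a : ∀ φ : HomWith M N X Y, LinearMap.ker φ.1 ≃ₗ[A] X := fun φ => φ.2.1.some
  have b : ∀ φ : HomWith M N X Y, (N ⧸ LinearMap.range φ.1) ≃ₗ[A] Y := fun φ => φ.2.2.some
  symm
  refine Nat.card_congr (Equiv.ofBijective (fun x => ⟨(x.1.1,
    (LinearMap.ker x.1.1).subtype.comp (x.2.1.trans (a x.1).symm).toLinearMap,
    ((b x.1).trans x.2.2).toLinearMap.comp (LinearMap.range x.1.1).mkQ), ?_, ?_, ?_, ?_⟩) ⟨?_, ?_⟩)
  · exact Subtype.val_injective.comp (x.2.1.trans (a x.1).symm).injective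
  · intro y
    constructor
    · intro hy
      obtain ⟨z, hz⟩ := (x.2.1.trans (a x.1).symm).surjective ⟨y, hy⟩
      exact ⟨z, congrArg Subtype.val hz⟩
    · rintro ⟨z, rfl⟩
      exact ((x.2.1.trans (a x.1).symm) z).2
  · intro y
    constructor
    · intro hy
      have : (LinearMap.range x.1.1).mkQ y = 0 :=
        ((b x.1).trans x.2.2).injective (hy.trans (map_zero _).symm)
      exact (Submodule.Quotient.mk_eq_zero _).1 this
    · intro hy
      have : (LinearMap.range x.1.1).mkQ y = 0 := (Submodule.Quotient.mk_eq_zero _).2 hy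
      change ((b x.1).trans x.2.2) ((LinearMap.range x.1.1).mkQ y) = 0
      rw [this, map_zero]
  · exact ((b x.1).trans x.2.2).surjective.comp (Submodule.mkQ_surjective _)
  · rintro ⟨φ, α, β⟩ ⟨φ', α', β'⟩ hx
    obtain rfl : φ = φ' := Subtype.ext (congrArg (fun t => t.1.1) hx)
    have hα : ∀ z, ((a φ).symm (α z) : M) = (a φ).symm (α' z) := fun z =>
      LinearMap.congr_fun (congrArg (fun t => t.1.2.1) hx) z
    have hβ : ∀ z, β (b φ (Submodule.Quotient.mk z)) = β' (b φ (Submodule.Quotient.mk z)) :=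
      fun z => LinearMap.congr_fun (congrArg (fun t => t.1.2.2) hx) z
    refine Prod.ext rfl (Prod.ext (LinearEquiv.ext fun z => ?_) (LinearEquiv.ext fun z => ?_))
    · exact (a φ).symm.injective (Subtype.ext (hα z))
    · obtain ⟨z, rfl⟩ := (b φ).surjective z
      obtain ⟨z, rfl⟩ := Submodule.Quotient.mk_surjective _ z
      exact hβ z
  · rintro ⟨⟨f, g, h⟩, h₁, h₂, h₃, h₄⟩
    dsimp only at h₁ h₂ h₃ h₄
    have eg : LinearMap.ker f = LinearMap.range g := h₂.linearMap_ker_eq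
    have eh : LinearMap.ker h = LinearMap.range f := h₃.linearMap_ker_eq
    let α : X ≃ₗ[A] LinearMap.ker f :=
      (LinearEquiv.ofInjective g h₁).trans (LinearEquiv.ofEq _ _ eg.symm)
    let β : (N ⧸ LinearMap.range f) ≃ₗ[A] Y :=
      (Submodule.quotEquivOfEq _ _ eh.symm).trans (h.quotKerEquivOfSurjective h₄)
    let φ : HomWith M N X Y := ⟨f, ⟨α.symm⟩, ⟨β⟩⟩
    refine ⟨(φ, α.trans (a φ), (b φ).symm.trans β), Subtype.ext (Prod.ext rfl (Prod.ext
      (LinearMap.ext fun z => ?_) (LinearMap.ext fun z => ?_)))⟩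
    · change ((a φ).symm (a φ (α z)) : M) = g z
      rw [LinearEquiv.symm_apply_apply]
      rfl
    · change β ((b φ).symm (b φ (Submodule.Quotient.mk z))) = h z
      rw [LinearEquiv.symm_apply_apply]
      rfl

end

section

variable {k : Type u} [Field k] [Finite k] {m : ℕ} {A : Type v} [Ring A] [Algebra k A]
  [Module.Finite k A] [IsHereditaryRing A] [IsPeriod m]

/-- The product of two elements `a_M e_{M,r+1}` and `a_N e_{N,r}`. -/
theorem ringelElt_succ_mul_ringelElt (r : ZMod m) (M N : FGModuleCat.{v} A) :
    ((ringelElt k (r + 1) M : DH k m A) * ringelElt k r N : DH k m A) =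
      ∑ᶠ XY : IsoClass A × IsoClass A, (Nat.card (HomWith M N XY.1.out XY.2.out) : ℂ) •
        (vv k ^ eulerForm k A (cl M - cl XY.1.out) (cl XY.1.out - cl XY.2.out) •
          (DH.K k m r (cl M - cl XY.1.out) * ringelElt k r XY.2.out *
            ringelElt k (r + 1) XY.1.out)) := by
  have : Finite A := Module.finite_of_finite k
  obtain ⟨Ω, P, hΩ, hP, δ, ε, h⟩ := exists_isRes k A M
  obtain ⟨Ω', P', hΩ', hP', δ', ε', h'⟩ := exists_isRes k A N
  have f₁ := finite_linearMap k A Ω Ω'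
  have f₂ := finite_linearMap k A P P'
  have f₃ := finite_linearMap k A M N
  let _ : Fintype (AntiSquare δ δ') := Fintype.ofFinite _
  let _ : Fintype (M →ₗ[A] N) := Fintype.ofFinite _
  have hdesc : ∀ t : AntiSquare δ δ', ∃ φ : M →ₗ[A] N, ∀ x, φ (ε x) = ε' (t.1.2 x) := fun t =>
    h.exists_desc (ε'.comp t.1.2) fun w => by
      have := congrArg ε' (t.2 w)
      rwa [map_add, (h'.exact _).2 ⟨_, rfl⟩, zero_add, map_zero] at this
  choose Φ hΦ using hdesc
  have hw := (hasWeight_coneCls_succ (k := k) r δ).mul_K (-mcl A Ω')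
  have e₁ : ((ringelElt k (r + 1) M : DH k m A) * ringelElt k r N : DH k m A) =
      ∑ t : AntiSquare δ δ', vv k ^ (-(2 * eulerForm k A (mcl A P) (mcl A Ω'))) •
        (vv k ^ eulerForm k A (mcl A M - mcl A (LinearMap.ker (Φ t)))
          (mcl A (LinearMap.ker (Φ t)) - mcl A (N ⧸ LinearMap.range (Φ t))) •
        (DH.K k m r (mcl A M - mcl A (LinearMap.ker (Φ t))) *
          ringelElt k r (N ⧸ LinearMap.range (Φ t)) *
          ringelElt k (r + 1) (LinearMap.ker (Φ t)))) := by
    rw [Finset.sum_congr rfl fun t _ => by rw [← antiSquare_term r h h' t (hΦ t)]]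
    rw [← resElt_eq (r + 1) h, ← resElt_eq r h', resElt, resElt, smul_mul_assoc, mul_smul_comm,
      smul_smul, mul_assoc, ← mul_assoc (coneCls k (r + 1) δ), hw, smul_mul_assoc, mul_smul_comm,
      smul_smul, mul_assoc (DH.K k m r (-mcl A Ω')), coneCls_succ_mul_coneCls r h.injective]
    simp only [mul_smul_comm, smul_smul, vv_zpow_mul, Finset.mul_sum, Finset.smul_sum]
    refine Finset.sum_congr rfl fun t _ => ?_
    congr 2
    rw [h.mcl_eq, h'.mcl_eq, symEulerForm, symEulerForm]
    simp only [map_add, map_neg, map_sub, AddMonoidHom.add_apply, AddMonoidHom.neg_apply]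
    ring
  -- Each map `M → N` is induced by the same number of squares.
  have hfib : ∀ φ, (Nat.card {t : AntiSquare δ δ' // Φ t = φ} : ℂ) =
      vv k ^ (2 * eulerForm k A (mcl A P) (mcl A Ω')) := fun φ => by
    rw [← card_hom_of_projective k, ← card_antiSquare_fiber h h' φ]
    congr 1
    refine Nat.card_congr (Equiv.subtypeEquivRight fun t => ⟨fun ht x => ht ▸ hΦ t x, fun ht => ?_⟩)
    refine LinearMap.ext fun y => ?_
    obtain ⟨x, rfl⟩ := h.surjective y
    rw [hΦ, ht]
  rw [e₁, ← Finset.smul_sum, sum_comp_of_card_fiber Φ _ hfib fun φ =>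
    vv k ^ eulerForm k A (mcl A M - mcl A (LinearMap.ker φ))
      (mcl A (LinearMap.ker φ) - mcl A (N ⧸ LinearMap.range φ)) •
    (DH.K k m r (mcl A M - mcl A (LinearMap.ker φ)) * ringelElt k r (N ⧸ LinearMap.range φ) *
      ringelElt k (r + 1) (LinearMap.ker φ)), smul_smul, vv_zpow_mul, neg_add_cancel, zpow_zero,
    one_smul]
  let F : IsoClass A × IsoClass A → DH k m A := fun XY =>
    vv k ^ eulerForm k A (cl M - cl XY.1.out) (cl XY.1.out - cl XY.2.out) •
      (DH.K k m r (cl M - cl XY.1.out) * ringelElt k r XY.2.out * ringelElt k (r + 1) XY.1.out)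
  let f : (M →ₗ[A] N) → IsoClass A × IsoClass A := fun φ =>
    (isoClass (FGModuleCat.of A (LinearMap.ker φ)),
      isoClass (FGModuleCat.of A (N ⧸ LinearMap.range φ)))
  have e₂ : ∀ φ : M →ₗ[A] N, vv k ^ eulerForm k A (mcl A M - mcl A (LinearMap.ker φ))
      (mcl A (LinearMap.ker φ) - mcl A (N ⧸ LinearMap.range φ)) •
    (DH.K k m r (mcl A M - mcl A (LinearMap.ker φ)) * ringelElt k r (N ⧸ LinearMap.range φ) *
      ringelElt k (r + 1) (LinearMap.ker φ)) = F (f φ) := fun φ => by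
    obtain ⟨a⟩ := out_equiv (FGModuleCat.of A (LinearMap.ker φ))
    obtain ⟨b⟩ := out_equiv (FGModuleCat.of A (N ⧸ LinearMap.range φ))
    have ha : cl (f φ).1.out = mcl A (LinearMap.ker φ) := (mcl_congr (A := A) a).symm
    have hb : cl (f φ).2.out = mcl A (N ⧸ LinearMap.range φ) := (mcl_congr (A := A) b).symm
    have ha' : ringelElt k (r + 1) (f φ).1.out = ringelElt k (r + 1) (LinearMap.ker φ) :=
      (ringelElt_congr (k := k) (m := m) (A := A) (r + 1) a).symm
    have hb' : ringelElt k r (f φ).2.out = ringelElt k r (N ⧸ LinearMap.range φ) :=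
      (ringelElt_congr (k := k) (m := m) (A := A) r b).symm
    have hM : cl M = mcl A M := rfl
    change _ = vv k ^ eulerForm k A (cl M - cl (f φ).1.out) (cl (f φ).1.out - cl (f φ).2.out) •
      (DH.K k m r (cl M - cl (f φ).1.out) * ringelElt k r (f φ).2.out *
        ringelElt k (r + 1) (f φ).1.out)
    rw [ha, hb, ha', hb', hM]
  rw [Finset.sum_congr rfl fun φ _ => e₂ φ, sum_comp_eq_finsum f F]
  refine finsum_congr fun XY => ?_
  congr 2
  refine Nat.card_congr (Equiv.subtypeEquivRight fun φ => ?_)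
  rw [Prod.ext_iff]
  exact and_congr isoClass_eq_iff_out isoClass_eq_iff_out

end

/-! ### The homomorphism `J` -/

theorem autCard_ne_zero (k : Type u) [Field k] [Finite k] {A : Type v} [Ring A]
    [Algebra k A] [Module.Finite k A] (M : FGModuleCat.{v} A) : (autCard M : ℂ) ≠ 0 := by
  have := finite_linearMap k A M M
  have : Finite (M ≃ₗ[A] M) :=
    Finite.of_injective (fun e => e.toLinearMap) LinearEquiv.toLinearMap_injective
  exact Nat.cast_ne_zero.2 Nat.card_pos.ne'

theorem autCard_congr {A : Type v} [Ring A] {M N : FGModuleCat.{v} A} (e : M ≃ₗ[A] N) : autCard M = autCard N :=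
  Nat.card_congr
    { toFun := fun φ => (e.symm.trans φ).trans e
      invFun := fun φ => (e.trans φ).trans e.symm
      left_inv := fun φ => LinearEquiv.ext fun x => by simp
      right_inv := fun φ => LinearEquiv.ext fun x => by simp }

theorem finite_support_hallNumber (k : Type u) [Field k] [Finite k] {A : Type v} [Ring A]
    [Algebra k A] [Module.Finite k A]
    [IsHereditaryRing A] (M N : FGModuleCat.{v} A) :
    {L : IsoClass A | hallNumber M N L.out ≠ 0}.Finite := by
  obtain ⟨Ω, P, hΩ, hP, δ, ε, h⟩ := exists_isRes k A M
  have f₁ := finite_linearMap k A Ω N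
  refine (finite_support_card_fiber
    fun ψ : Ω →ₗ[A] N => isoClass (FGModuleCat.of A (Push δ ψ))).subset fun L hL h0 => hL ?_
  have e := card_push_iso_eq k (N := N) h L.out.obj
  have e' : Nat.card {ψ : Ω →ₗ[A] N // Nonempty (ModuleCat.of A (Push δ ψ) ≅ L.out.obj)} = 0 := by
    rw [← h0]
    refine Nat.card_congr (Equiv.subtypeEquivRight fun ψ => Iff.trans ?_ isoClass_eq_iff_out.symm)
    exact ⟨fun ⟨φ⟩ => ⟨φ.toLinearEquiv⟩, fun ⟨e⟩ => ⟨e.toModuleIso⟩⟩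
  rw [e', Nat.cast_zero, eq_comm, mul_eq_zero, or_iff_right (zpow_ne_zero _ (vv_ne_zero k))] at e
  exact mul_eq_zero_of_left e _

theorem gammaNumber_eq {A : Type v} [Ring A] (M N X Y : FGModuleCat.{v} A) : 
    gammaNumber M N X Y = (Nat.card (HomWith M N X Y) : ℂ) * autCard X * autCard Y / (autCard M * autCard N) := by
  rw [gammaNumber, card_exactTriples, Nat.cast_mul, Nat.cast_mul]

theorem finite_support_gammaNumber (k : Type u) [Field k] [Finite k] {A : Type v} [Ring A]
    [Algebra k A] [Module.Finite k A]
    [IsHereditaryRing A] (M N : FGModuleCat.{v} A) :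
    {XY : IsoClass A × IsoClass A | gammaNumber M N XY.1.out XY.2.out ≠ 0}.Finite := by
  have : Finite A := Module.finite_of_finite k
  have f₁ := finite_linearMap k A M N
  refine (finite_support_card_fiber fun φ : M →ₗ[A] N =>
    (isoClass (FGModuleCat.of A (LinearMap.ker φ)),
      isoClass (FGModuleCat.of A (N ⧸ LinearMap.range φ)))).subset fun XY hXY h0 => hXY ?_
  have e' : Nat.card (HomWith M N XY.1.out XY.2.out) = 0 := by
    rw [← h0]
    refine Nat.card_congr (Equiv.subtypeEquivRight fun φ => ?_)
    rw [Prod.ext_iff]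
    exact Iff.symm (and_congr isoClass_eq_iff_out isoClass_eq_iff_out)
  rw [gammaNumber_eq, e', Nat.cast_zero, zero_mul, zero_mul, zero_div]

section

variable {k : Type u} [Field k] [Finite k] {m : ℕ} {A : Type v} [Ring A] [Algebra k A]
  [Module.Finite k A] [IsHereditaryRing A]

theorem ringelElt_eq_smul_e (r : ZMod m) (M : FGModuleCat.{v} A) :
    (ringelElt k r M : DH k m A) = (autCard M : ℂ) • DH.e k m r M := by
  rw [e_eq_smul_ringelElt, smul_smul, mul_inv_cancel₀ (autCard_ne_zero k M), one_smul]

variable [IsPeriod m]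

theorem e_congr (r : ZMod m) {M N : FGModuleCat.{v} A} (e : M ≃ₗ[A] N) :
    DH.e k m r M = DH.e k m r N := by
  rw [e_eq_smul_ringelElt, e_eq_smul_ringelElt, ringelElt_congr r e, autCard_congr e]

theorem e_out (r : ZMod m) (M : FGModuleCat.{v} A) :
    DH.e k m r (isoClass M).out = DH.e k m r M :=
  e_congr r (out_equiv M).some.symm

/-- The zero module is resolved by zero modules, whose two-term complex has class `K_{0,r} = 1`. -/
theorem e_of_subsingleton (r : ZMod m) (M : FGModuleCat.{v} A) [Subsingleton M] :
    DH.e k m r M = 1 := by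
  have h : IsRes (LinearMap.id : PUnit.{v + 1} →ₗ[A] PUnit.{v + 1})
      (0 : PUnit.{v + 1} →ₗ[A] M) :=
    ⟨fun _ _ _ => rfl, fun x => ⟨fun _ => ⟨x, rfl⟩, fun _ => rfl⟩, fun x => ⟨0, Subsingleton.elim _ _⟩⟩
  have e₁ : (ringelElt k r M : DH k m A) = 1 := by
    have e₂ : (coneCls k r (LinearMap.id : PUnit.{v + 1} →ₗ[A] PUnit.{v + 1}) : DH k m A) = 1 := by
      refine (K_mcl r PUnit).symm.trans ?_
      rw [mcl_subsingleton, K_zero]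
    rw [← resElt_eq r h, resElt, e₂, mcl_subsingleton, neg_zero, K_zero, map_zero,
      AddMonoidHom.zero_apply, zpow_zero, one_smul, mul_one]
  have e₃ : autCard M = 1 := by
    have : Unique (M ≃ₗ[A] M) :=
      ⟨⟨LinearEquiv.refl A M⟩, fun e => LinearEquiv.ext fun x => Subsingleton.elim _ _⟩
    exact Nat.card_unique
  rw [e_eq_smul_ringelElt, e₁, e₃, Nat.cast_one, inv_one, one_smul]

/-- The Ringel–Hall relation for the elements `e_{M,r}`. -/
theorem e_mul_e (r : ZMod m) (M N : FGModuleCat.{v} A) : DH.e k m r M * DH.e k m r N =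
    vv k ^ eulerForm k A (cl M) (cl N) •
      ∑ᶠ L : IsoClass A, hallNumber M N L.out • DH.e k m r L.out := by
  rw [e_eq_smul_ringelElt, e_eq_smul_ringelElt, smul_mul_smul_comm, ringelElt_mul_ringelElt,
    smul_comm, smul_finsum]
  congr 1
  refine finsum_congr fun L => ?_
  rw [ringelElt_eq_smul_e, smul_smul, smul_smul, hallNumber]
  congr 1
  field_simp

/-- The relation between `Z⁻` and `Z⁺` for the elements `e_{M,r+1}` and `e_{N,r}`. -/
theorem e_succ_mul_e (r : ZMod m) (M N : FGModuleCat.{v} A) :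
    DH.e k m (r + 1) M * DH.e k m r N = ∑ᶠ XY : IsoClass A × IsoClass A,
      (vv k ^ eulerForm k A (cl M - cl XY.1.out) (cl XY.1.out - cl XY.2.out) *
          gammaNumber M N XY.1.out XY.2.out) •
        (DH.K k m r (cl M - cl XY.1.out) * DH.e k m r XY.2.out * DH.e k m (r + 1) XY.1.out) := by
  rw [e_eq_smul_ringelElt, e_eq_smul_ringelElt, smul_mul_smul_comm, ringelElt_succ_mul_ringelElt,
    smul_finsum]
  refine finsum_congr fun XY => ?_
  rw [ringelElt_eq_smul_e, ringelElt_eq_smul_e, mul_smul_comm, mul_smul_comm, smul_mul_assoc,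
    smul_smul, smul_smul, smul_smul, smul_smul, gammaNumber_eq]
  congr 1
  field_simp

theorem hasWeight_e (r : ZMod m) (M : FGModuleCat.{v} A) : HasWeight r (DH.e k m r M) (cl M) := by
  rw [e_eq_smul_ringelElt]
  exact (hasWeight_ringelElt M r).smul _

theorem hasWeight_e_succ (r : ZMod m) (M : FGModuleCat.{v} A) :
    HasWeight r (DH.e k m (r + 1) M) (-cl M) := by
  rw [e_eq_smul_ringelElt]
  exact (hasWeight_ringelElt_succ M r).smul _

theorem hasWeight_succ_e (r : ZMod m) (M : FGModuleCat.{v} A) :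
    HasWeight (r + 1) (DH.e k m r M) 0 := by
  rw [e_eq_smul_ringelElt]
  exact (hasWeight_succ_ringelElt M r).smul _

variable (k) in
/-- The images of the generators of the Heisenberg double. -/
noncomputable def heisGenImage (r : ZMod m) : HeisGen A → DH k m A
  | .Zp M => DH.e k m r M.out
  | .Zm M => DH.e k m (r + 1) M.out
  | .Kp α => DH.K k m r α
  | .Km α => DH.K k m (r + 1) α

/-- The images of the generators satisfy the relations of the Heisenberg double. The sums in the
relations have finite support, so that they may be mapped termwise. -/
theorem lift_heisGenImage_rel (r : ZMod m) {x y : FreeAlgebra ℂ (HeisGen A)} (h : HeisRel k A x y) :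
    FreeAlgebra.lift ℂ (heisGenImage k r) x = FreeAlgebra.lift ℂ (heisGenImage k r) y := by
  have fin : ∀ {ι V : Type (v + 1)} [AddCommGroup V] [Module ℂ V] {c : ι → ℂ} (x : ι → V),
      {i | c i ≠ 0}.Finite → (Function.support fun i => c i • x i).Finite :=
    fun x hc => hc.subset fun i hi h0 => hi (by simp only [h0, zero_smul])
  cases h with
  | Zp_mul M N =>
    rw [map_mul, map_smul, map_finsum]
    · simp only [map_smul, FreeAlgebra.lift_ι_apply, heisGenImage, e_out]
      exact e_mul_e r M N
    · exact fin _ (finite_support_hallNumber k M N)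
  | Zm_mul M N =>
    rw [map_mul, map_smul, map_finsum]
    · simp only [map_smul, FreeAlgebra.lift_ι_apply, heisGenImage, e_out]
      exact e_mul_e (r + 1) M N
    · exact fin _ (finite_support_hallNumber k M N)
  | Zp_zero M hM =>
    rw [map_one, FreeAlgebra.lift_ι_apply, heisGenImage, e_out, e_of_subsingleton]
  | Zm_zero M hM =>
    rw [map_one, FreeAlgebra.lift_ι_apply, heisGenImage, e_out, e_of_subsingleton]
  | Kp_add α β => simp only [map_mul, FreeAlgebra.lift_ι_apply, heisGenImage, K_add]
  | Km_add α β => simp only [map_mul, FreeAlgebra.lift_ι_apply, heisGenImage, K_add]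
  | Kp_zero => simp only [map_one, FreeAlgebra.lift_ι_apply, heisGenImage, K_zero]
  | Km_zero => simp only [map_one, FreeAlgebra.lift_ι_apply, heisGenImage, K_zero]
  | Kp_Zp α M =>
    simp only [map_mul, map_smul, FreeAlgebra.lift_ι_apply, heisGenImage, e_out]
    exact hasWeight_e r M α
  | Km_Zm α M =>
    simp only [map_mul, map_smul, FreeAlgebra.lift_ι_apply, heisGenImage, e_out]
    exact hasWeight_e (r + 1) M α
  | Zm_Zp M N =>
    rw [map_finsum]
    · simp only [map_mul, map_smul, FreeAlgebra.lift_ι_apply, heisGenImage, e_out]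
      exact e_succ_mul_e r M N
    · exact fin _ ((finite_support_gammaNumber k M N).subset fun XY => right_ne_zero_of_mul)
  | Kp_Zm α M =>
    simp only [map_mul, map_smul, FreeAlgebra.lift_ι_apply, heisGenImage, e_out]
    rw [← symEulerForm_neg_right]
    exact hasWeight_e_succ r M α
  | Km_Zp α M =>
    simp only [map_mul, FreeAlgebra.lift_ι_apply, heisGenImage, e_out]
    rw [hasWeight_succ_e r M α, symEulerForm_zero_right, zpow_zero, one_smul]
  | Kp_Km α β =>
    simp only [map_mul, map_smul, FreeAlgebra.lift_ι_apply, heisGenImage]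
    rw [hasWeight_K_succ r β α, symEulerForm_neg_right]

variable (k A) in
/-- The homomorphism `J_r`. -/
noncomputable def heisToDH (r : ZMod m) : Heis k A →ₐ[ℂ] DH k m A :=
  RingQuot.liftAlgHom ℂ ⟨FreeAlgebra.lift ℂ (heisGenImage k r), fun _ _ => lift_heisGenImage_rel r⟩

theorem heisToDH_mk (r : ZMod m) (x : FreeAlgebra ℂ (HeisGen A)) :
    heisToDH k A r (RingQuot.mkAlgHom ℂ (HeisRel k A) x) =
      FreeAlgebra.lift ℂ (heisGenImage k r) x :=
  RingQuot.liftAlgHom_mkAlgHom_apply _ _ _ _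

theorem heisToDH_Zp (r : ZMod m) (M : FGModuleCat.{v} A) :
    heisToDH k A r (Heis.Zp k M) = DH.e k m r M := by
  rw [Heis.Zp, heisToDH_mk, FreeAlgebra.lift_ι_apply]
  exact e_out r M

theorem heisToDH_Zm (r : ZMod m) (M : FGModuleCat.{v} A) :
    heisToDH k A r (Heis.Zm k M) = DH.e k m (r + 1) M := by
  rw [Heis.Zm, heisToDH_mk, FreeAlgebra.lift_ι_apply]
  exact e_out (r + 1) M

theorem heisToDH_Kp (r : ZMod m) (α : GrothendieckGroup A) :
    heisToDH k A r (Heis.Kp k α) = DH.K k m r α := by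
  rw [Heis.Kp, heisToDH_mk, FreeAlgebra.lift_ι_apply]
  rfl

theorem heisToDH_Km (r : ZMod m) (α : GrothendieckGroup A) :
    heisToDH k A r (Heis.Km k α) = DH.K k m (r + 1) α := by
  rw [Heis.Km, heisToDH_mk, FreeAlgebra.lift_ι_apply]
  rfl

end

/-! ### A spanning set of the Heisenberg double -/

theorem isoClass_out {A : Type v} [Ring A] (L : IsoClass A) : isoClass L.out = L := Quotient.out_eq L

section

variable (k : Type u) [Field k] [Finite k] {A : Type v} [Ring A] [Algebra k A]
  [Module.Finite k A] [IsHereditaryRing A]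

variable (A) in
/-- The span of the elements `Z⁺_{[M]}`. -/
noncomputable def spanZp : Submodule ℂ (Heis k A) := Submodule.span ℂ (Set.range (Heis.Zp k))

variable (A) in
/-- The span of the elements `Z⁻_{[M]}`. -/
noncomputable def spanZm : Submodule ℂ (Heis k A) := Submodule.span ℂ (Set.range (Heis.Zm k))

variable (A) in
/-- The span of the elements `K_α`. -/
noncomputable def spanKp : Submodule ℂ (Heis k A) := Submodule.span ℂ (Set.range (Heis.Kp k))

variable (A) in
/-- The span of the elements `K⁻_α`. -/
noncomputable def spanKm : Submodule ℂ (Heis k A) := Submodule.span ℂ (Set.range (Heis.Km k))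

theorem Zp_mem (M : FGModuleCat.{v} A) : Heis.Zp k M ∈ spanZp k A := Submodule.subset_span ⟨M, rfl⟩
theorem Zm_mem (M : FGModuleCat.{v} A) : Heis.Zm k M ∈ spanZm k A := Submodule.subset_span ⟨M, rfl⟩
theorem Kp_mem (α : GrothendieckGroup A) : Heis.Kp k α ∈ spanKp k A :=
  Submodule.subset_span ⟨α, rfl⟩
theorem Km_mem (α : GrothendieckGroup A) : Heis.Km k α ∈ spanKm k A :=
  Submodule.subset_span ⟨α, rfl⟩

variable {k}

theorem span_mul_span_le {ι κ : Type*} {f : ι → Heis k A} {g : κ → Heis k A}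
    {S : Submodule ℂ (Heis k A)} (h : ∀ i j, f i * g j ∈ S) :
    Submodule.span ℂ (Set.range f) * Submodule.span ℂ (Set.range g) ≤ S := by
  rw [Submodule.span_mul_span, Submodule.span_le]
  rintro _ ⟨_, ⟨i, rfl⟩, _, ⟨j, rfl⟩, rfl⟩
  exact h i j

/-- A sum in the free algebra lies in a submodule of the Heisenberg double if its terms do; there is
no condition on the support, as an infinite sum has the value zero. -/
theorem mk_finsum_mem {ι : Type*} {S : Submodule ℂ (Heis k A)} {c : ι → ℂ}
    {x : ι → FreeAlgebra ℂ (HeisGen A)} (h : ∀ i, RingQuot.mkAlgHom ℂ (HeisRel k A) (x i) ∈ S) :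
    RingQuot.mkAlgHom ℂ (HeisRel k A) (∑ᶠ i, c i • x i) ∈ S := by
  refine finsum_induction (fun y => RingQuot.mkAlgHom ℂ (HeisRel k A) y ∈ S) ?_ (fun y z hy hz => ?_)
    fun i => ?_
  · rw [map_zero]
    exact zero_mem S
  · rw [map_add]
    exact add_mem hy hz
  · rw [map_smul]
    exact S.smul_mem _ (h i)

theorem mk_rel {x y : FreeAlgebra ℂ (HeisGen A)} (h : HeisRel k A x y) :
    RingQuot.mkAlgHom ℂ (HeisRel k A) x = RingQuot.mkAlgHom ℂ (HeisRel k A) y :=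
  RingQuot.mkAlgHom_rel ℂ h

theorem spanZp_mul_spanZp : spanZp k A * spanZp k A ≤ spanZp k A :=
  span_mul_span_le fun M N => by
    rw [Heis.Zp, Heis.Zp, ← map_mul, mk_rel (HeisRel.Zp_mul M N), map_smul]
    refine Submodule.smul_mem _ _ (mk_finsum_mem fun L => ?_)
    rw [← isoClass_out L]
    exact Zp_mem k L.out

theorem spanZm_mul_spanZm : spanZm k A * spanZm k A ≤ spanZm k A :=
  span_mul_span_le fun M N => by
    rw [Heis.Zm, Heis.Zm, ← map_mul, mk_rel (HeisRel.Zm_mul M N), map_smul]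
    refine Submodule.smul_mem _ _ (mk_finsum_mem fun L => ?_)
    rw [← isoClass_out L]
    exact Zm_mem k L.out

theorem spanKp_mul_spanKp : spanKp k A * spanKp k A ≤ spanKp k A :=
  span_mul_span_le fun α β => by
    rw [Heis.Kp, Heis.Kp, ← map_mul, mk_rel (HeisRel.Kp_add α β)]
    exact Kp_mem k _

theorem spanKm_mul_spanKm : spanKm k A * spanKm k A ≤ spanKm k A :=
  span_mul_span_le fun α β => by
    rw [Heis.Km, Heis.Km, ← map_mul, mk_rel (HeisRel.Km_add α β)]
    exact Km_mem k _

theorem spanZm_mul_spanZp : spanZm k A * spanZp k A ≤ spanKp k A * spanZp k A * spanZm k A :=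
  span_mul_span_le fun M N => by
    rw [Heis.Zm, Heis.Zp, ← map_mul, mk_rel (HeisRel.Zm_Zp M N)]
    refine mk_finsum_mem fun XY => ?_
    rw [map_mul, map_mul]
    refine Submodule.mul_mem_mul (Submodule.mul_mem_mul (Kp_mem k _) ?_) ?_
    · rw [← isoClass_out XY.2]
      exact Zp_mem k _
    · rw [← isoClass_out XY.1]
      exact Zm_mem k _

theorem eq_smul_of_smul_eq {x y : Heis k A} {n : ℤ} (h : x = vv k ^ n • y) :
    y = (vv k ^ n)⁻¹ • x := by
  rw [h, smul_smul, inv_mul_cancel₀ (zpow_ne_zero _ (vv_ne_zero k)), one_smul]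

theorem spanZp_mul_spanKp : spanZp k A * spanKp k A ≤ spanKp k A * spanZp k A :=
  span_mul_span_le fun M α => by
    have h : Heis.Kp k α * Heis.Zp k M =
        vv k ^ symEulerForm k A α (cl M) • (Heis.Zp k M * Heis.Kp k α) := by
      simpa only [Heis.Kp, Heis.Zp, map_mul, map_smul] using mk_rel (HeisRel.Kp_Zp α M)
    rw [eq_smul_of_smul_eq h]
    exact Submodule.smul_mem _ _ (Submodule.mul_mem_mul (Kp_mem k α) (Zp_mem k M))

theorem spanZm_mul_spanKm : spanZm k A * spanKm k A ≤ spanKm k A * spanZm k A :=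
  span_mul_span_le fun M α => by
    have h : Heis.Km k α * Heis.Zm k M =
        vv k ^ symEulerForm k A α (cl M) • (Heis.Zm k M * Heis.Km k α) := by
      simpa only [Heis.Km, Heis.Zm, map_mul, map_smul] using mk_rel (HeisRel.Km_Zm α M)
    rw [eq_smul_of_smul_eq h]
    exact Submodule.smul_mem _ _ (Submodule.mul_mem_mul (Km_mem k α) (Zm_mem k M))

theorem spanZm_mul_spanKp : spanZm k A * spanKp k A ≤ spanKp k A * spanZm k A :=
  span_mul_span_le fun M α => by
    have h : Heis.Kp k α * Heis.Zm k M =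
        vv k ^ (-symEulerForm k A α (cl M)) • (Heis.Zm k M * Heis.Kp k α) := by
      simpa only [Heis.Kp, Heis.Zm, map_mul, map_smul] using mk_rel (HeisRel.Kp_Zm α M)
    rw [eq_smul_of_smul_eq h]
    exact Submodule.smul_mem _ _ (Submodule.mul_mem_mul (Kp_mem k α) (Zm_mem k M))

theorem spanKm_mul_spanKp : spanKm k A * spanKp k A ≤ spanKp k A * spanKm k A :=
  span_mul_span_le fun β α => by
    have h : Heis.Kp k α * Heis.Km k β =
        vv k ^ (-symEulerForm k A α β) • (Heis.Km k β * Heis.Kp k α) := by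
      simpa only [Heis.Kp, Heis.Km, map_mul, map_smul] using mk_rel (HeisRel.Kp_Km α β)
    rw [eq_smul_of_smul_eq h]
    exact Submodule.smul_mem _ _ (Submodule.mul_mem_mul (Kp_mem k α) (Km_mem k β))

theorem spanKm_mul_spanZp : spanKm k A * spanZp k A ≤ spanZp k A * spanKm k A :=
  span_mul_span_le fun α M => by
    rw [Heis.Km, Heis.Zp, ← map_mul, mk_rel (HeisRel.Km_Zp α M), map_mul]
    exact Submodule.mul_mem_mul (Zp_mem k M) (Km_mem k α)

theorem mul_mul_le_of_mul_le {X Y Z W : Submodule ℂ (Heis k A)} (h : X * Y ≤ Z) :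
    X * (Y * W) ≤ Z * W := by
  rw [← mul_assoc]
  exact mul_le_mul' h le_rfl

variable (k A) in
/-- The products `K_α Z⁺_{[M]} K⁻_β Z⁻_{[N]}` span the Heisenberg double. -/
theorem span_products_eq_top : spanKp k A * (spanZp k A * (spanKm k A * spanZm k A)) = ⊤ := by
  set S := spanKp k A * (spanZp k A * (spanKm k A * spanZm k A)) with hS
  -- The span of the monomials is stable under left multiplication by each kind of generator, since
  -- each generator can be moved to its place in the monomial.
  have hKp : spanKp k A * S ≤ S := mul_mul_le_of_mul_le spanKp_mul_spanKp
  have hZp : spanZp k A * S ≤ S := by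
    refine (mul_mul_le_of_mul_le spanZp_mul_spanKp).trans ?_
    rw [mul_assoc]
    exact mul_le_mul' le_rfl (mul_mul_le_of_mul_le spanZp_mul_spanZp)
  have hKm : spanKm k A * S ≤ S := by
    refine (mul_mul_le_of_mul_le spanKm_mul_spanKp).trans ?_
    rw [mul_assoc]
    refine mul_le_mul' le_rfl ((mul_mul_le_of_mul_le spanKm_mul_spanZp).trans ?_)
    rw [mul_assoc]
    exact mul_le_mul' le_rfl (mul_mul_le_of_mul_le spanKm_mul_spanKm)
  have hZm' : spanZm k A * (spanKm k A * spanZm k A) ≤ spanKm k A * spanZm k A := by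
    refine (mul_mul_le_of_mul_le spanZm_mul_spanKm).trans ?_
    rw [mul_assoc]
    exact mul_le_mul' le_rfl spanZm_mul_spanZm
  have hZm : spanZm k A * S ≤ S := by
    refine (mul_mul_le_of_mul_le spanZm_mul_spanKp).trans ?_
    rw [mul_assoc]
    refine (mul_le_mul' le_rfl (mul_mul_le_of_mul_le spanZm_mul_spanZp)).trans ?_
    rw [mul_assoc, mul_assoc]
    exact (mul_le_mul' le_rfl (mul_le_mul' le_rfl (mul_le_mul' le_rfl hZm'))).trans hKp
  have h1 : (1 : Heis k A) ∈ S := by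
    have e₁ : Heis.Kp k (0 : GrothendieckGroup A) = 1 :=
      (mk_rel HeisRel.Kp_zero).trans (map_one _)
    have e₂ : Heis.Km k (0 : GrothendieckGroup A) = 1 :=
      (mk_rel HeisRel.Km_zero).trans (map_one _)
    let Z : FGModuleCat.{v} A := FGModuleCat.of A PUnit.{v + 1}
    have hZ : Subsingleton Z := inferInstanceAs (Subsingleton PUnit)
    have e₃ : Heis.Zp k Z = 1 := (mk_rel (HeisRel.Zp_zero Z hZ)).trans (map_one _)
    have e₄ : Heis.Zm k Z = 1 := (mk_rel (HeisRel.Zm_zero Z hZ)).trans (map_one _)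
    have := Submodule.mul_mem_mul (Kp_mem k (0 : GrothendieckGroup A)) (Submodule.mul_mem_mul
      (Zp_mem k Z) (Submodule.mul_mem_mul (Km_mem k (0 : GrothendieckGroup A)) (Zm_mem k Z)))
    rwa [e₁, e₂, e₃, e₄, mul_one, mul_one, mul_one] at this
  have hmul : ∀ a : FreeAlgebra ℂ (HeisGen A), ∀ y ∈ S,
      RingQuot.mkAlgHom ℂ (HeisRel k A) a * y ∈ S := by
    intro a
    induction a using FreeAlgebra.induction with
    | grade0 c =>
      intro y hy
      rw [AlgHom.commutes, Algebra.algebraMap_eq_smul_one, smul_mul_assoc, one_mul]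
      exact S.smul_mem c hy
    | grade1 g =>
      intro y hy
      cases g with
      | Zp M =>
        rw [← isoClass_out M]
        exact hZp (Submodule.mul_mem_mul (Zp_mem k _) hy)
      | Zm M =>
        rw [← isoClass_out M]
        exact hZm (Submodule.mul_mem_mul (Zm_mem k _) hy)
      | Kp α => exact hKp (Submodule.mul_mem_mul (Kp_mem k α) hy)
      | Km α => exact hKm (Submodule.mul_mem_mul (Km_mem k α) hy)
    | mul a b ha hb =>
      intro y hy
      rw [map_mul, mul_assoc]
      exact ha _ (hb y hy)
    | add a b ha hb =>
      intro y hy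
      rw [map_add, add_mul]
      exact add_mem (ha y hy) (hb y hy)
  refine eq_top_iff.2 fun x _ => ?_
  obtain ⟨a, rfl⟩ := RingQuot.mkAlgHom_surjective ℂ (HeisRel k A) x
  have := hmul a 1 h1
  rwa [mul_one] at this

variable (k) in
/-- The element `K_α Z⁺_{[M]} K⁻_β Z⁻_{[N]}` of the Heisenberg double. -/
noncomputable def heisMonomial
    (t : (GrothendieckGroup A × IsoClass A) × (GrothendieckGroup A × IsoClass A)) : Heis k A :=
  Heis.Kp k t.1.1 * (Heis.Zp k t.1.2.out * (Heis.Km k t.2.1 * Heis.Zm k t.2.2.out))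

variable (k A) in
theorem span_heisMonomial : Submodule.span ℂ (Set.range (heisMonomial k (A := A))) = ⊤ := by
  rw [← span_products_eq_top k A, spanKp, spanZp, spanKm, spanZm, Submodule.span_mul_span,
    Submodule.span_mul_span, Submodule.span_mul_span]
  congr 1
  ext x
  constructor
  · rintro ⟨⟨⟨α, M⟩, β, N⟩, rfl⟩
    exact ⟨_, ⟨α, rfl⟩, _, ⟨_, ⟨M.out, rfl⟩, _, ⟨_, ⟨β, rfl⟩, _, ⟨N.out, rfl⟩, rfl⟩, rfl⟩, rfl⟩
  · rintro ⟨_, ⟨α, rfl⟩, _, ⟨_, ⟨M, rfl⟩, _, ⟨_, ⟨β, rfl⟩, _, ⟨N, rfl⟩, rfl⟩, rfl⟩, rfl⟩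
    refine ⟨((α, isoClass M), (β, isoClass N)), ?_⟩
    have h₁ : Heis.Zp k (isoClass M).out = Heis.Zp k M := by rw [Heis.Zp, isoClass_out, Heis.Zp]
    have h₂ : Heis.Zm k (isoClass N).out = Heis.Zm k N := by rw [Heis.Zm, isoClass_out, Heis.Zm]
    rw [heisMonomial, h₁, h₂]

end

/-! ### Homology -/

section

variable {m : ℕ} {A : Type v} [Ring A]

/-- The homology of `L` in degree `n` is isomorphic to `X`, by a map on the cycles whose kernel
consists of the boundaries. -/
def HasHomology (L : ProjComplex m A) (n : ZMod m) (X : Type v) [AddCommGroup X] [Module A X] :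
    Prop :=
  ∃ φ : LinearMap.ker (dif L n (n + 1)) →ₗ[A] X, Function.Surjective φ ∧
    ∀ z, φ z = 0 ↔ ∃ p, p + 1 = n ∧ ∃ w, dif L p n w = z.1

/-- The homology of `L` in degree `n` vanishes. -/
def IsExactAt (L : ProjComplex m A) (n : ZMod m) : Prop :=
  ∀ z, dif L n (n + 1) z = 0 → ∃ p, p + 1 = n ∧ ∃ w, dif L p n w = z

variable {L L' : ProjComplex m A} {n : ZMod m} {X X' : Type v} [AddCommGroup X] [Module A X]
  [AddCommGroup X'] [Module A X']

theorem HasHomology.unique (h : HasHomology L n X) (h' : HasHomology L n X') :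
    Nonempty (X ≃ₗ[A] X') := by
  obtain ⟨φ, hφ, hk⟩ := h
  obtain ⟨φ', hφ', hk'⟩ := h'
  have e : LinearMap.ker φ = LinearMap.ker φ' := by
    ext z
    rw [LinearMap.mem_ker, LinearMap.mem_ker, hk, hk']
  exact ⟨((φ.quotKerEquivOfSurjective hφ).symm.trans (Submodule.quotEquivOfEq _ _ e)).trans
    (φ'.quotKerEquivOfSurjective hφ')⟩

theorem HasHomology.of_iso (h : HasHomology L n X) (e : Nonempty (L ≅ L')) :
    HasHomology L' n X := by
  obtain ⟨φ, hφ, hk⟩ := h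
  obtain ⟨a, ha⟩ := exists_equiv_of_iso e.some.symm
  have hz : ∀ z : LinearMap.ker (dif L' n (n + 1)), (a n).toLinearMap.comp
      (LinearMap.ker (dif L' n (n + 1))).subtype z ∈ LinearMap.ker (dif L n (n + 1)) := fun z => by
    have := ha n (n + 1) z.1
    rw [LinearMap.mem_ker.1 z.2, map_zero] at this
    exact this
  refine ⟨φ.comp (LinearMap.codRestrict _ _ hz), fun x => ?_, fun z => ?_⟩
  · obtain ⟨z, rfl⟩ := hφ x
    refine ⟨⟨(a n).symm z.1, ?_⟩, ?_⟩
    · have := ha n (n + 1) ((a n).symm z.1)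
      rw [LinearEquiv.apply_symm_apply, LinearMap.mem_ker.1 z.2] at this
      exact (a (n + 1)).injective (this.symm.trans (map_zero _).symm)
    · exact congrArg φ (Subtype.ext ((a n).apply_symm_apply z.1))
  · refine (hk _).trans ⟨?_, ?_⟩
    · rintro ⟨p, hp, w, hw⟩
      refine ⟨p, hp, (a p).symm w, (a n).injective ?_⟩
      rw [← ha, LinearEquiv.apply_symm_apply, hw]
      rfl
    · rintro ⟨p, hp, w, hw⟩
      refine ⟨p, hp, a p w, ?_⟩
      rw [ha, hw]
      rfl

/-- Adding a complex that is exact in degree `n` does not change the homology in degree `n`. -/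
theorem HasHomology.dsum_right (h : HasHomology L n X) (h' : IsExactAt L' n) :
    HasHomology (dsum L L') n X := by
  obtain ⟨φ, hφ, hk⟩ := h
  have hd : ∀ (p q : ZMod m) (z : L'.obj.X p × L.obj.X p), dif (dsum L L') p q z =
      ((dif L' p q z.1, dif L p q z.2) : L'.obj.X q × L.obj.X q) := fun p q z => dif_dsum p q z
  have hz : ∀ z : LinearMap.ker (dif (dsum L L') n (n + 1)),
      ((LinearMap.snd A (L'.obj.X n) (L.obj.X n)).comp
        (LinearMap.ker (dif (dsum L L') n (n + 1))).subtype) z ∈ LinearMap.ker (dif L n (n + 1)) :=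
    fun z => congrArg Prod.snd ((hd n (n + 1) z.1).symm.trans (LinearMap.mem_ker.1 z.2))
  refine ⟨φ.comp (LinearMap.codRestrict _ _ hz), fun x => ?_, fun z => ?_⟩
  · obtain ⟨z, rfl⟩ := hφ x
    refine ⟨⟨((0, z.1) : L'.obj.X n × L.obj.X n), ?_⟩, rfl⟩
    refine LinearMap.mem_ker.2 ((hd n (n + 1) _).trans (Prod.ext (map_zero _) z.2))
  · refine (hk _).trans ⟨?_, ?_⟩
    · rintro ⟨p, hp, w, hw⟩
      obtain ⟨p', hp', w', hw'⟩ := h' z.1.1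
        (congrArg Prod.fst ((hd n (n + 1) z.1).symm.trans (LinearMap.mem_ker.1 z.2)))
      obtain rfl : p' = p := add_right_cancel (hp'.trans hp.symm)
      exact ⟨p', hp', ((w', w) : L'.obj.X p' × L.obj.X p'), (hd _ _ _).trans (Prod.ext hw' hw)⟩
    · rintro ⟨p, hp, w, hw⟩
      exact ⟨p, hp, w.2, congrArg Prod.snd ((hd _ _ _).symm.trans hw)⟩

theorem HasHomology.dsum_left (h : HasHomology L n X) (h' : IsExactAt L' n) :
    HasHomology (dsum L' L) n X :=
  (h.dsum_right h').of_iso (dsum_comm _ _)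

theorem isExactAt_of_acyclic (h : L.obj.Acyclic) (n : ZMod m) : IsExactAt L n := fun z hz =>
  ⟨n - 1, sub_add_cancel n 1, acyclic_iff.1 h (n - 1) n (n + 1) (sub_add_cancel n 1) rfl z hz⟩

theorem isExactAt_of_subsingleton (h : Subsingleton (L.obj.X n)) : IsExactAt L n := fun _ _ =>
  ⟨n - 1, sub_add_cancel n 1, 0, Subsingleton.elim _ _⟩

variable {Q P : Type v} [AddCommGroup Q] [AddCommGroup P] [Module A Q] [Module A P]
  {f : Q →ₗ[A] P} {i : ZMod m}

theorem IsTwoTerm.isExactAt (h : IsTwoTerm L i f) (hf : Function.Injective f) : IsExactAt L i :=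
  fun z hz => by
    obtain ⟨a, b, hab⟩ := h.exists_equiv
    obtain ⟨x, rfl⟩ := a.surjective z
    rw [hab] at hz
    have hx : x = 0 := hf ((b.injective (hz.trans (map_zero b).symm)).trans (map_zero f).symm)
    exact ⟨i - 1, sub_add_cancel i 1, 0, by rw [map_zero, hx, map_zero]⟩

/-- The complex of a resolution of `X` has homology `X` in its right degree. -/
theorem IsTwoTerm.hasHomology [IsPeriod m] {ε : P →ₗ[A] X} (h : IsTwoTerm L i f) (hf : IsRes f ε) :
    HasHomology L (i + 1) X := by
  obtain ⟨a, b, hab⟩ := h.exists_equiv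
  refine ⟨(ε.comp b.symm.toLinearMap).comp (Submodule.subtype _), fun x => ?_, fun z => ?_⟩
  · obtain ⟨y, rfl⟩ := hf.surjective x
    refine ⟨⟨b y, LinearMap.mem_ker.2 (h.dif_eq_zero (add_one_ne i) _)⟩, ?_⟩
    exact congrArg ε (b.symm_apply_apply y)
  · refine (hf.exact _).trans ⟨?_, ?_⟩
    · rintro ⟨w, hw⟩
      refine ⟨i, rfl, a w, ?_⟩
      rw [hab, hw]
      exact b.apply_symm_apply _
    · rintro ⟨p, hp, w, hw⟩
      obtain rfl := add_right_cancel hp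
      obtain ⟨w, rfl⟩ := a.surjective w
      refine ⟨w, ?_⟩
      rw [hab] at hw
      exact ((b.symm_apply_apply _).symm).trans (congrArg b.symm hw)

end

/-! ### Linear independence of the images of the monomials -/

/-- Finitely many elements of `K(A)` become classes of projectives after adding the class of a
single projective. -/
theorem exists_common_denominator (k : Type u) [Field k] [Finite k] {A : Type v} [Ring A]
    [Algebra k A] [Module.Finite k A] [IsHereditaryRing A] {ι : Type*} (s : Finset ι)
    (a : ι → GrothendieckGroup A) : ∃ Q : FGModuleCat.{v} A, Module.Projective A Q ∧
      ∀ i ∈ s, ∃ P : FGModuleCat.{v} A, Module.Projective A P ∧ cl Q + a i = cl P := by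
  classical
  induction s using Finset.induction_on with
  | empty =>
    exact ⟨FGModuleCat.of A PUnit.{v + 1}, inferInstanceAs (Module.Projective A PUnit.{v + 1}),
      fun i hi => absurd hi (Finset.notMem_empty i)⟩
  | insert j s _ ih =>
    obtain ⟨Q, hQ, h⟩ := ih
    obtain ⟨⟨P₀, Q₀⟩, hP₀, hQ₀, hj⟩ := exists_projective_sub k (a j)
    dsimp only at hP₀ hQ₀ hj
    refine ⟨FGModuleCat.of A (Q × Q₀), inferInstanceAs (Module.Projective A (Q × Q₀)),
      fun i hi => ?_⟩
    obtain rfl | hi := Finset.mem_insert.1 hi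
    · refine ⟨FGModuleCat.of A (Q × P₀), inferInstanceAs (Module.Projective A (Q × P₀)), ?_⟩
      rw [cl_prod, cl_prod, hj]
      abel
    · obtain ⟨P, hP, e⟩ := h i hi
      refine ⟨FGModuleCat.of A (P × Q₀), inferInstanceAs (Module.Projective A (P × Q₀)), ?_⟩
      rw [cl_prod, cl_prod, ← e]
      abel

/-- Classes of pairwise nonisomorphic complexes are linearly independent. -/
theorem eq_zero_of_sum_hcl_eq_zero {k : Type u} [Field k] [Finite k] {m : ℕ} {A : Type v} [Ring A]
    [Algebra k A] {ι : Type*} {s : Finset ι} {T : ι → ProjComplex m A}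
    (hT : ∀ i ∈ s, ∀ j ∈ s, Nonempty (T i ≅ T j) → i = j) {c : ι → ℂ}
    (h : ∑ i ∈ s, c i • hcl k (T i) = 0) {j : ι} (hj : j ∈ s) : c j = 0 := by
  let ev : HallRing k m A →ₗ[ℂ] ℂ :=
    (Finsupp.lapply (Quotient.mk _ (T j)) : TwistedHall m A →ₗ[ℂ] ℂ)
  have e : ∀ i, ev (hcl k (T i)) =
      (Finsupp.single (Quotient.mk _ (T i)) 1 : TwistedHall m A) (Quotient.mk _ (T j)) :=
    fun i => rfl
  have h' := congrArg ev h
  rw [map_sum, map_zero, Finset.sum_eq_single j, map_smul, e, Finsupp.single_eq_same, smul_eq_mul,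
    mul_one] at h'
  · exact h'
  · intro i hi hij
    rw [map_smul, e, Finsupp.single_eq_of_ne, smul_zero]
    exact fun hq => hij (hT i hi j hj (Quotient.exact hq.symm))
  · exact fun hn => absurd hj hn

section

variable {k : Type u} [Field k] [Finite k] {m : ℕ} {A : Type v} [Ring A] [Algebra k A]
  [Module.Finite k A] [IsHereditaryRing A] [IsPeriod m]

/-- Up to a nonzero scalar, the image of a monomial is a product of two elements `K` and the class
of `C_δ[r] ⊕ C_{δ'}[r+1]`. -/
theorem exists_monomial_eq (r : ZMod m) (α β : GrothendieckGroup A) {M N : FGModuleCat.{v} A}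
    {Ω P Ω' P' : FGModuleCat.{v} A} [Module.Projective A Ω] [Module.Projective A P]
    [Module.Projective A Ω'] [Module.Projective A P'] {δ : Ω →ₗ[A] P} {ε : P →ₗ[A] M}
    {δ' : Ω' →ₗ[A] P'} {ε' : P' →ₗ[A] N} (h : IsRes δ ε) (h' : IsRes δ' ε') :
    ∃ c : ℂ, c ≠ 0 ∧
      DH.K k m r α * (DH.e k m r M * (DH.K k m (r + 1) β * DH.e k m (r + 1) N)) =
        c • (DH.K k m r (-cl Ω + α) * (DH.K k m (r + 1) (-cl Ω' + β) *
          DH.cls k m (dsum (shiftedCone (r + 1) δ') (shiftedCone r δ)))) := by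
  have hv : ∀ n : ℤ, vv k ^ n ≠ 0 := fun n => zpow_ne_zero n (vv_ne_zero k)
  have ha : ∀ X : FGModuleCat.{v} A, (autCard X : ℂ)⁻¹ ≠ 0 := fun X =>
    inv_ne_zero (autCard_ne_zero k X)
  have hw := (hasWeight_succ_coneCls (k := k) r δ).mul_K (-cl Ω' + β)
  have eC : DH.K k m r α * (DH.K k m r (-cl Ω) * coneCls k r δ * (DH.K k m (r + 1) β *
      (DH.K k m (r + 1) (-cl Ω') * coneCls k (r + 1) δ'))) =
      vv k ^ (-symEulerForm k A (-cl Ω' + β) (mcl A Ω)) •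
        vv k ^ (-eulerForm k A (mcl A Ω) (mcl A P')) •
        (DH.K k m r (-cl Ω + α) * (DH.K k m (r + 1) (-cl Ω' + β) *
          DH.cls k m (dsum (shiftedCone (r + 1) δ') (shiftedCone r δ)))) := by
    rw [← mul_assoc (DH.K k m (r + 1) β), ← K_add, add_comm β, mul_assoc (DH.K k m r (-cl Ω)),
      ← mul_assoc (coneCls k r δ), hw, smul_mul_assoc, mul_assoc (DH.K k m (r + 1) (-cl Ω' + β)),
      coneCls_mul_coneCls_succ r h'.injective, ← mul_smul_comm, ← mul_assoc (DH.K k m r α), ← K_add,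
      add_comm α]
    simp only [mul_smul_comm]
  rw [e_eq_smul_ringelElt, e_eq_smul_ringelElt, ← resElt_eq r h, ← resElt_eq (r + 1) h', resElt,
    resElt]
  simp only [smul_mul_assoc, mul_smul_comm, smul_smul]
  refine ⟨(autCard N : ℂ)⁻¹ * vv k ^ eulerForm k A (mcl A Ω') (mcl A P' - mcl A Ω') *
    ((autCard M : ℂ)⁻¹ * vv k ^ eulerForm k A (mcl A Ω) (mcl A P - mcl A Ω)) *
    (vv k ^ (-symEulerForm k A (-cl Ω' + β) (mcl A Ω)) *
      vv k ^ (-eulerForm k A (mcl A Ω) (mcl A P'))), ?_, ?_⟩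
  · exact mul_ne_zero (mul_ne_zero (mul_ne_zero (ha N) (hv _)) (mul_ne_zero (ha M) (hv _)))
      (mul_ne_zero (hv _) (hv _))
  · refine (congrArg (HSMul.hSMul _) eC).trans ?_
    simp only [smul_smul, mul_assoc]

/-- Multiplication by classes of projectives clears the denominators of `K_{α,r}` and
`K_{β,r+1}`. -/
theorem exists_K_mul_K_mul_cls (r : ZMod m) {α β : GrothendieckGroup A}
    {P P' Q Q' : FGModuleCat.{v} A} [Module.Projective A P] [Module.Projective A P']
    (h : cl Q + α = cl P) (h' : cl Q' + β = cl P') (L : ProjComplex m A) :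
    ∃ c : ℂ, c ≠ 0 ∧ DH.K k m (r + 1) (cl Q') * (DH.K k m r (cl Q) *
      (DH.K k m r α * (DH.K k m (r + 1) β * DH.cls k m L))) =
        c • DH.cls k m (dsum (dsum L (shiftedCone (r + 1) (LinearMap.id : P' →ₗ[A] P')))
          (shiftedCone r (LinearMap.id : P →ₗ[A] P))) := by
  have e : DH.K k m r (cl P) = diskCls k r P := K_mcl r P
  have e' : DH.K k m (r + 1) (cl P') = diskCls k (r + 1) P' := K_mcl (r + 1) P'
  rw [← mul_assoc (DH.K k m r (cl Q)), ← K_add, h, ← mul_assoc (DH.K k m (r + 1) (cl Q')),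
    hasWeight_succ_K r (cl P) (cl Q'), smul_mul_assoc, mul_assoc,
    ← mul_assoc (DH.K k m (r + 1) (cl Q')), ← K_add, h', e, e', diskCls_mul_cls, mul_smul_comm,
    diskCls_mul_cls, smul_smul, smul_smul]
  exact ⟨_, mul_ne_zero (mul_ne_zero (zpow_ne_zero _ (vv_ne_zero k)) (zpow_ne_zero _ (vv_ne_zero k)))
    (zpow_ne_zero _ (vv_ne_zero k)), rfl⟩

end

section

variable {m : ℕ} {A : Type v} [Ring A] [IsPeriod m] {L₁ L₂ D₁ D₂ K : ProjComplex m A} {i : ZMod m}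
  {Ω P M Ω' P' N S S' : Type v} [AddCommGroup Ω] [AddCommGroup P] [AddCommGroup M]
  [AddCommGroup Ω'] [AddCommGroup P'] [AddCommGroup N] [AddCommGroup S] [AddCommGroup S']
  [Module A Ω] [Module A P] [Module A M] [Module A Ω'] [Module A P'] [Module A N] [Module A S]
  [Module A S'] {δ : Ω →ₗ[A] P} {ε : P →ₗ[A] M} {δ' : Ω' →ₗ[A] P'} {ε' : P' →ₗ[A] N}

/-- For the complexes used in the proof of linear independence, homology recovers the modules: in
degree `i + 2` only the complex of `δ` contributes, and in degree `i + 1` only that of `δ'`, as `δ`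
is injective. -/
theorem hasHomology_of_resolutions (h₁ : IsTwoTerm L₁ i δ') (h₂ : IsTwoTerm L₂ (i + 1) δ)
    (hδ' : IsRes δ' ε') (hδ : IsRes δ ε) (hD₁ : D₁.obj.Acyclic) (hD₂ : D₂.obj.Acyclic)
    (hK : K.obj.Acyclic) :
    HasHomology (dsum (dsum (dsum (dsum L₁ L₂) D₁) D₂) K) (i + 1 + 1) M ∧
      HasHomology (dsum (dsum (dsum (dsum L₁ L₂) D₁) D₂) K) (i + 1) N := by
  have a : ∀ {n : ZMod m} {X : Type v} [AddCommGroup X] [Module A X],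
      HasHomology (dsum L₁ L₂) n X →
      HasHomology (dsum (dsum (dsum (dsum L₁ L₂) D₁) D₂) K) n X := fun h =>
    ((h.dsum_right (isExactAt_of_acyclic hD₁ _)).dsum_right (isExactAt_of_acyclic hD₂ _)).dsum_right
      (isExactAt_of_acyclic hK _)
  exact ⟨a ((h₂.hasHomology hδ).dsum_left (isExactAt_of_subsingleton h₁.subsingleton_succ)),
    a ((h₁.hasHomology hδ').dsum_right (h₂.isExactAt hδ.injective))⟩

variable [Module.Finite A Ω'] [Module.Finite A P] [Module.Finite A S] [Module.Finite A S']

/-- In the outer degrees `i + 2` and `i`, besides `K`, only one of the two resolutions and one of the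
two contractible complexes contribute. -/
theorem tcl_of_resolutions (h₁ : IsTwoTerm L₁ i δ') (h₂ : IsTwoTerm L₂ (i + 1) δ)
    (hD₁ : IsTwoTerm D₁ i (LinearMap.id : S' →ₗ[A] S'))
    (hD₂ : IsTwoTerm D₂ (i + 1) (LinearMap.id : S →ₗ[A] S)) :
    tcl (dsum (dsum (dsum (dsum L₁ L₂) D₁) D₂) K) (i + 1 + 1) =
        tcl K (i + 1 + 1) + mcl A P + mcl A S ∧
      tcl (dsum (dsum (dsum (dsum L₁ L₂) D₁) D₂) K) i = tcl K i + mcl A Ω' + mcl A S' := by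
  have n₁ := add_one_ne i
  have n₂ := add_one_add_one_ne i
  have n₃ := add_one_ne (i + 1)
  constructor
  · simp only [tcl_tsum, h₂.tcl_right, hD₂.tcl_right, h₁.tcl_eq_zero n₂ n₃, hD₁.tcl_eq_zero n₂ n₃]
    abel
  · simp only [tcl_tsum, h₁.tcl_left, hD₁.tcl_left, h₂.tcl_eq_zero n₁.symm n₂.symm,
      hD₂.tcl_eq_zero n₁.symm n₂.symm]
    abel

end

section

variable {k : Type u} [Field k] [Finite k] {m : ℕ} {A : Type v} [Ring A] [Algebra k A]
  [Module.Finite k A] [IsHereditaryRing A] [IsPeriod m]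

variable (k A) in
/-- The images of the monomials are linearly independent, since a relation between them yields one
between classes of pairwise nonisomorphic complexes. -/
theorem linearIndependent_heisToDH (r : ZMod m) :
    LinearIndependent ℂ fun t => heisToDH k A r (heisMonomial k t) := by
  have : Finite A := Module.finite_of_finite k
  rw [linearIndependent_iff']
  intro s g hg
  choose Ω P hΩ hP δ ε hδ using fun X : IsoClass A => exists_isRes k A X.out
  -- Common denominators for all monomials in the relation.
  obtain ⟨Q, hQ, hs⟩ := exists_common_denominator k s fun t => -cl (Ω t.1.2) + t.1.1
  obtain ⟨Q', hQ', hs'⟩ := exists_common_denominator k s fun t => -cl (Ω t.2.2) + t.2.1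
  have hs₁ : ∀ t, ∃ S : FGModuleCat.{v} A, Module.Projective A S ∧
      (t ∈ s → cl Q + (-cl (Ω t.1.2) + t.1.1) = cl S) := fun t => by
    by_cases ht : t ∈ s
    · obtain ⟨S, hS, e⟩ := hs t ht
      exact ⟨S, hS, fun _ => e⟩
    · exact ⟨Q, hQ, fun h => absurd h ht⟩
  have hs₂ : ∀ t, ∃ S : FGModuleCat.{v} A, Module.Projective A S ∧
      (t ∈ s → cl Q' + (-cl (Ω t.2.2) + t.2.1) = cl S) := fun t => by
    by_cases ht : t ∈ s
    · obtain ⟨S, hS, e⟩ := hs' t ht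
      exact ⟨S, hS, fun _ => e⟩
    · exact ⟨Q, hQ, fun h => absurd h ht⟩
  choose S hS eS using hs₁
  choose S' hS' eS' using hs₂
  let R : ((GrothendieckGroup A × IsoClass A) × (GrothendieckGroup A × IsoClass A)) →
      ProjComplex m A := fun t =>
    dsum (dsum (dsum (shiftedCone (r + 1) (δ t.2.2)) (shiftedCone r (δ t.1.2)))
      (shiftedCone (r + 1) (LinearMap.id : S' t →ₗ[A] S' t)))
      (shiftedCone r (LinearMap.id : S t →ₗ[A] S t))
  -- After clearing denominators, the image of the monomial `t` is a nonzero multiple of the class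
  -- of the complex `R t`.
  have hR : ∀ t, ∃ c : ℂ, c ≠ 0 ∧ (t ∈ s → DH.K k m (r + 1) (cl Q') * (DH.K k m r (cl Q) *
      heisToDH k A r (heisMonomial k t)) = c • DH.cls k m (R t)) := fun t => by
    by_cases ht : t ∈ s
    · obtain ⟨c, hc, e⟩ := exists_monomial_eq (k := k) r t.1.1 t.2.1 (hδ t.1.2) (hδ t.2.2)
      obtain ⟨c', hc', e'⟩ := exists_K_mul_K_mul_cls (k := k) r (eS t ht) (eS' t ht)
        (dsum (shiftedCone (r + 1) (δ t.2.2)) (shiftedCone r (δ t.1.2)))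
      refine ⟨c * c', mul_ne_zero hc hc', fun _ => ?_⟩
      rw [heisMonomial, map_mul, map_mul, map_mul, heisToDH_Kp, heisToDH_Zp, heisToDH_Km,
        heisToDH_Zm, e, mul_smul_comm, mul_smul_comm, e', smul_smul]
    · exact ⟨1, one_ne_zero, fun h => absurd h ht⟩
  choose c hc eR using hR
  have h₁ : DH.of k m (∑ t ∈ s, (g t * c t) • hcl k (R t) : HallRing k m A) = 0 := by
    change DH.ofLinear k (∑ t ∈ s, (g t * c t) • hcl k (R t)) = 0
    have := congrArg (fun x => DH.K k m (r + 1) (cl Q') * (DH.K k m r (cl Q) * x)) hg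
    simp only [Finset.mul_sum, mul_zero, mul_smul_comm] at this
    rw [← this, map_sum]
    refine Finset.sum_congr rfl fun t ht => ?_
    rw [map_smul, DH.ofLinear_hcl, eR t ht, smul_smul]
  -- The relation lifts to the twisted Hall algebra after multiplication by an acyclic class.
  obtain ⟨K, hK, h₂⟩ := exists_acyclic_mul_eq_zero k h₁
  have h₃ : ∑ t ∈ s, (g t * c t * splitCoeff k K (R t)) • hcl k (dsum (R t) K) = 0 := by
    rw [← h₂, Finset.mul_sum]
    refine Finset.sum_congr rfl fun t _ => ?_
    rw [mul_smul_comm, hcl_acyclic_mul k hK, smul_smul]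
  -- The complex determines the monomial: its homology gives the modules, and then the classes of
  -- its outer terms give the elements of `K(A)`.
  have hinj : ∀ t ∈ s, ∀ t' ∈ s, Nonempty (dsum (R t) K ≅ dsum (R t') K) → t = t' := by
    intro t ht t' ht' e
    have hi := position_succ r
    generalize hi' : (-1 - (r + 1) : ZMod m) = i at hi
    have q : ∀ {Q P : FGModuleCat.{v} A} [Module.Projective A Q] [Module.Projective A P]
        (f : Q →ₗ[A] P), IsTwoTerm (shiftedCone (r + 1) f) i f := fun f =>
      hi' ▸ isTwoTerm_shiftedCone (r + 1) f
    have q' : ∀ {Q P : FGModuleCat.{v} A} [Module.Projective A Q] [Module.Projective A P]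
        (f : Q →ₗ[A] P), IsTwoTerm (shiftedCone r f) (i + 1) f := fun f =>
      hi ▸ isTwoTerm_shiftedCone r f
    have hom : ∀ t, HasHomology (dsum (R t) K) (i + 1 + 1) t.1.2.out ∧
        HasHomology (dsum (R t) K) (i + 1) t.2.2.out := fun t =>
      hasHomology_of_resolutions (q _) (q' _) (hδ _) (hδ _) ((q _).acyclic Function.bijective_id)
        ((q' _).acyclic Function.bijective_id) hK
    have tc : ∀ t, tcl (dsum (R t) K) (i + 1 + 1) =
        tcl K (i + 1 + 1) + cl (P t.1.2) + cl (S t) ∧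
        tcl (dsum (R t) K) i = tcl K i + cl (Ω t.2.2) + cl (S' t) := fun t =>
      tcl_of_resolutions (q (δ t.2.2)) (q' (δ t.1.2)) (q _) (q' _)
    have e₁ : t.1.2 = t'.1.2 := by
      rw [← isoClass_out t.1.2, ← isoClass_out t'.1.2]
      exact isoClass_eq_iff.2 (((hom t).1.of_iso e).unique (hom t').1)
    have e₂ : t.2.2 = t'.2.2 := by
      rw [← isoClass_out t.2.2, ← isoClass_out t'.2.2]
      exact isoClass_eq_iff.2 (((hom t).2.of_iso e).unique (hom t').2)
    have e₃ : t.1.1 = t'.1.1 := by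
      have h := congrFun (tcl_congr e) (i + 1 + 1)
      rw [(tc t).1, (tc t').1, ← eS t ht, ← eS t' ht', e₁] at h
      exact add_left_cancel (add_left_cancel (add_left_cancel h))
    have e₄ : t.2.1 = t'.2.1 := by
      have h := congrFun (tcl_congr e) i
      rw [(tc t).2, (tc t').2, ← eS' t ht, ← eS' t' ht', e₂] at h
      exact add_left_cancel (add_left_cancel (add_left_cancel h))
    exact Prod.ext (Prod.ext e₃ e₁) (Prod.ext e₄ e₂)
  intro t ht
  have h₄ := eq_zero_of_sum_hcl_eq_zero hinj h₃ ht
  exact (mul_eq_zero.1 ((mul_eq_zero.1 h₄).resolve_right (splitCoeff_ne_zero k K (R t)))).resolve_right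
    (hc t)

variable (k A) in
theorem heisToDH_injective (r : ZMod m) : Function.Injective (heisToDH k A r) := by
  refine (injective_iff_map_eq_zero _).2 fun x hx => ?_
  have hmem : x ∈ Submodule.span ℂ (Set.range (heisMonomial k (A := A))) := by
    rw [span_heisMonomial]
    exact Submodule.mem_top
  obtain ⟨c, rfl⟩ := (Finsupp.mem_span_range_iff_exists_finsupp).1 hmem
  have : c = 0 := by
    refine linearIndependent_iff.1 (linearIndependent_heisToDH k A r) c ?_
    rw [Finsupp.linearCombination_apply, ← hx, map_finsuppSum]
    simp only [map_smul]
  rw [this, Finsupp.sum_zero_index]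

end

end BridgelandHall

theorem corollary3p3 (k : Type u) [Field k] [Finite k] (A : Type v) [Ring A] [Algebra k A]
    [Module.Finite k A] [IsHereditaryRing A] (m : ℕ) (hm : m = 0 ∨ 2 < m) (i : ZMod m) :
    ∃ J : BridgelandHall.Heis k A →ₐ[ℂ] BridgelandHall.DH k m A,
      Function.Injective J ∧
      (∀ M : FGModuleCat.{v} A,
        J (BridgelandHall.Heis.Zp k M) = BridgelandHall.DH.e k m i M) ∧
      (∀ M : FGModuleCat.{v} A,
        J (BridgelandHall.Heis.Zm k M) = BridgelandHall.DH.e k m (i + 1) M) ∧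
      (∀ α : BridgelandHall.GrothendieckGroup A,
        J (BridgelandHall.Heis.Kp k α) = BridgelandHall.DH.K k m i α) ∧
      (∀ α : BridgelandHall.GrothendieckGroup A,
        J (BridgelandHall.Heis.Km k α) = BridgelandHall.DH.K k m (i + 1) α) := by
  have : BridgelandHall.IsPeriod m := ⟨hm⟩
  exact ⟨BridgelandHall.heisToDH k A i, BridgelandHall.heisToDH_injective k A i,
    BridgelandHall.heisToDH_Zp i, BridgelandHall.heisToDH_Zm i, BridgelandHall.heisToDH_Kp i,
    BridgelandHall.heisToDH_Km i⟩
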